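/- \textbf{Setting.} For each $n\ge 1$ observe $\mathbf y=\mathbf f+\boldsymbol\epsilon\in\mathbb R^n$ with $\mathbf f=\mathbf X\boldsymbol\beta$, where $\mathbf X\in\mathbb R^{n\times p_n}$ is a non-random matrix of full column rank, $1\le p_n\le n$, and $\epsilon_1,\dots,\epsilon_n$ are i.i.d. sub-Gaussian with mean $0$ and variance $\sigma^2>0$ ($\sigma^2$ and the sub-Gaussian parameter do not depend on $n$). Let $\mathbf P_m$ be the least squares projection matrix on the first $m$ columns of $\mathbf X$, $\mathbf P_0=\mathbf 0$, write $\mathbf P_j-\mathbf P_{j-1}=\boldsymbol\phi_j\boldsymbol\phi_j^\top$ with $\|\boldsymbol\phi_j\|=1$, and let $\theta_j=\boldsymbol\phi_j^\top\mathbf f/\sqrt n$, $1\le j\le p_n$. The $\theta_j$ are the initial terms of one infinite sequence $(\theta_j)_{j\ge1}$ that does not depend on $n$. Assume $\limsup_n n^{-1}\|\mathbf f\|^2<\infty$ and that $(|\theta_j|)_{j\ge1}$ is positive and non-increasing. For a non-empty set $\mathcal M\subseteq\{1,\dots,p_n\}$ of sizes of nested models $\{1,\dots,k\}$ and $\mathbf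 w$ in the unit simplex $\mathcal W_{\mathcal M}\subset[0,1]^{\mathcal M}$, put $\mathbf P_{\mathbf w|\mathcal M}=\sum_{k\in\mathcal M}w_k\mathbf P_k$, $$L_n(\mathbf w|\mathcal M,\mathbf f)=\tfrac1n\|\mathbf P_{\mathbf w|\mathcal M}\mathbf y-\mathbf f\|^2,\qquad R_n(\mathbf w|\mathcal M,\mathbf f)=\tfrac1n\|\mathbf f-\mathbf P_{\mathbf w|\mathcal M}\mathbf f\|^2+\tfrac{\sigma^2}{n}\operatorname{tr}(\mathbf P_{\mathbf w|\mathcal M}^\top\mathbf P_{\mathbf w|\mathcal M}).$$ Let $R_n(\mathbf w^*|\mathcal M,\mathbf f)=\min_{\mathbf w\in\mathcal W_{\mathcal M}}R_n(\mathbf w|\mathcal M,\mathbf f)$, let $\mathcal M_A=\{1,\dots,p_n\}$, let $R_n(m|\mathcal M_A,\mathbf f)$ be the risk of the single model of size $m$, and let $m_n^*$ be a minimizer of it over $1\le m\le p_n$. With an estimator $\hat\sigma^2$ of $\sigma^2$, the Mallows model averaging (MMA) weights $\hat{\mathbf w}|\mathcal M$ are a (measurable) minimizer over $\mathcal W_{\mathcal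 M}$ of $\tfrac1n\|\mathbf y-\mathbf P_{\mathbf w|\mathcal M}\mathbf y\|^2+\tfrac{2\hat\sigma^2}{n}\sum_{k\in\mathcal M}k\,w_k$. For a (possibly random) size $\hat m_n\in\{1,\dots,p_n\}$ and numbers $\kappa_l=\kappa_l(n)>1$, $\kappa_u=\kappa_u(n)>1$ with $\kappa_l\vee\kappa_u\le C$ for all $n$, let $$\hat{\mathcal M}_{MS2}=\{m:\hat l_n\le m\le\hat u_n\},\qquad \hat l_n=1\vee\lfloor\kappa_l^{-1}\hat m_n\rfloor,\quad \hat u_n=p_n\wedge\lfloor\kappa_u\hat m_n\rfloor .$$ \textbf{Theorem.} (i) (Slow decay.) Suppose there are constants $\kappa>1$ and $0<\delta\le\nu<1$ with $\kappa\nu^2<1$ such that $\delta\le|\theta_{\lfloor\kappa l\rfloor}/\theta_l|\le\nu$ for all large $l$, and suppose that $\theta_{p_n+1}^2\le\sigma^2/n$ for all large $n$. Then, even when $\hat m_n=m_n^*$, $$\mathbb E R_n(\hat{\mathbf w}|\hat{\mathcal M}_{MS2},\mathbf f)-R_n(\mathbf w^*|\mathcal M_A,\mathbf f)\gtrsim R_n(\mathbf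 w^*|\mathcal M_A,\mathbf f),$$ i.e. for some constant $c>0$ the left side is at least $c\,R_n(\mathbf w^*|\mathcal M_A,\mathbf f)$ for all large $n$. (ii) (Fast decay.) Suppose $\lim_{l\to\infty}|\theta_{\lfloor\kappa l\rfloor}/\theta_l|=0$ for every constant $\kappa>1$. If $m_n^*\to\infty$, $\mathbb E R_n(\hat m_n|\mathcal M_A,\mathbf f)/R_n(m_n^*|\mathcal M_A,\mathbf f)\to1$, there is a constant $C_2\ge1$ with $\hat u_n-\hat l_n\le C_2$ almost surely for all $n$, and $\mathbb E(\hat\sigma^2-\sigma^2)^2$ is finite with $p_n\mathbb E(\hat\sigma^2-\sigma^2)^2=o[nR_n(\mathbf w^*|\mathcal M_A,\mathbf f)]$, then $$\mathbb E Q_n(\hat{\mathbf w}|\hat{\mathcal M}_{MS2},\mathbf f)\le[1+o(1)]\,R_n(\mathbf w^*|\mathcal M_A,\mathbf f).$$ Here $Q_n(\hat{\mathbf w}|\mathcal M,\mathbf f)$ is either of $\mathbb E L_n(\hat{\mathbf w}|\mathcal M,\mathbf f)$ and $\mathbb E R_n(\hat{\mathbf w}|\mathcal M,\mathbf f)$.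 The bound holds both when $\hat{\mathcal M}_{MS2}$ is plugged into the function $\mathcal M\mapsto Q_n(\hat{\mathbf w}|\mathcal M,\mathbf f)$ and the expectation over $\hat{\mathcal M}_{MS2}$ is then taken, and when $\mathbb E Q_n$ is read as the single expectation $\mathbb E L_n(\hat{\mathbf w}|\hat{\mathcal M}_{MS2},\mathbf f)$, respectively $\mathbb E R_n(\hat{\mathbf w}|\hat{\mathcal M}_{MS2},\mathbf f)$, with $\hat m_n$, $\hat\sigma^2$, $\hat{\mathbf w}$ and $\mathbf y$ from the same sample. -/

import Mathlib

open Filter Topology MeasureTheory ProbabilityTheory Matrix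
open scoped NNReal

namespace MallowsMA

/-- Squared Euclidean norm of a vector in `ℝⁿ`. -/
def sqNorm {n : ℕ} (v : Fin n → ℝ) : ℝ := ∑ i, v i ^ 2

/-- The design matrix `X_I` of the nested model `I = {1, …, m}`: the first `m` columns of `X`. -/
def nestedDesign {n p : ℕ} (X : Matrix (Fin n) (Fin p) ℝ) (m : ℕ) :
    Matrix (Fin n) {j : Fin p // (j : ℕ) < m} ℝ :=
  X.submatrix id Subtype.val

/-- The least squares matrix `P_m = X_I (X_Iᵀ X_I)⁻¹ X_Iᵀ` of the nested model `I = {1, …, m}`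
(in particular `P_0 = 0`). -/
noncomputable def hatMatrix {n p : ℕ} (X : Matrix (Fin n) (Fin p) ℝ) (m : ℕ) :
    Matrix (Fin n) (Fin n) ℝ :=
  nestedDesign X m * ((nestedDesign X m)ᵀ * nestedDesign X m)⁻¹ * (nestedDesign X m)ᵀ

/-- `φ_1, …, φ_p` are unit vectors with `P_j - P_{j-1} = φ_j φ_jᵀ`. Each `φ_j` is determined by the
design up to its sign; the index `j : Fin p` stands for the regressor number `j + 1`. -/
def IsNestedEigenbasis {n p : ℕ} (X : Matrix (Fin n) (Fin p) ℝ) (φ : Fin p → Fin n → ℝ) : Prop :=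
  ∀ j : Fin p, sqNorm (φ j) = 1 ∧
    hatMatrix X ((j : ℕ) + 1) - hatMatrix X (j : ℕ) = vecMulVec (φ j) (φ j)

/-- The transformed coefficient `φ_jᵀ f / √n`. -/
noncomputable def transCoef {n p : ℕ} (φ : Fin p → Fin n → ℝ) (f : Fin n → ℝ) (j : Fin p) : ℝ :=
  (φ j ⬝ᵥ f) / Real.sqrt n

/-- A set of nested candidate models `{1, …, k}` is given by the finite set `K` of the sizes `k`.
The weight set of `K`: weight vectors in the unit simplex, extended by `0` outside `K`. -/
def weightSet (K : Finset ℕ) : Set (ℕ → ℝ) :=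
  {w | (∀ k ∈ K, w k ∈ Set.Icc (0 : ℝ) 1) ∧ (∀ k ∉ K, w k = 0) ∧ ∑ k ∈ K, w k = 1}

/-- The model averaging matrix `P_w = ∑ w_k P_k`. -/
noncomputable def avgMatrix {n p : ℕ} (X : Matrix (Fin n) (Fin p) ℝ) (K : Finset ℕ) (w : ℕ → ℝ) :
    Matrix (Fin n) (Fin n) ℝ :=
  ∑ k ∈ K, w k • hatMatrix X k

/-- The loss `L_n(w|K, f) = n⁻¹ ‖P_w y - f‖²` of the model averaging estimator `P_w y`. -/
noncomputable def maLoss {n p : ℕ} (X : Matrix (Fin n) (Fin p) ℝ) (f : Fin n → ℝ)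
    (K : Finset ℕ) (w : ℕ → ℝ) (y : Fin n → ℝ) : ℝ :=
  sqNorm (avgMatrix X K w *ᵥ y - f) / n

/-- The risk `R_n(w|K, f) = n⁻¹ ‖f - P_w f‖² + n⁻¹ σ² tr(P_wᵀ P_w)` of the model averaging
estimator with weights `w`. For non-random `w` it is the expected loss,
see `integral_maLoss_eq_maRisk`. -/
noncomputable def maRisk {n p : ℕ} (X : Matrix (Fin n) (Fin p) ℝ) (f : Fin n → ℝ) (σ : ℝ)
    (K : Finset ℕ) (w : ℕ → ℝ) : ℝ :=
  sqNorm (f - avgMatrix X K w *ᵥ f) / n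
    + σ ^ 2 / n * ((avgMatrix X K w)ᵀ * avgMatrix X K w).trace

/-- The risk of the single nested model of size `m`: all the weight is on `m`. -/
noncomputable def msRisk {n p : ℕ} (X : Matrix (Fin n) (Fin p) ℝ) (f : Fin n → ℝ) (σ : ℝ)
    (m : ℕ) : ℝ :=
  maRisk X f σ {m} (Pi.single m 1)

/-- The optimal model averaging risk `R_n(w*|K, f)`, the minimum of the risk over the weight set
(a compact set, so that the infimum is attained). -/
noncomputable def optRisk {n p : ℕ} (X : Matrix (Fin n) (Fin p) ℝ) (f : Fin n → ℝ) (σ : ℝ)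
    (K : Finset ℕ) : ℝ :=
  sInf (maRisk X f σ K '' weightSet K)

/-- The optimal risk `R_n(w*|M_A, f)` over all the nested models of sizes `1, …, p`. -/
noncomputable def fullOptRisk {n p : ℕ} (X : Matrix (Fin n) (Fin p) ℝ) (f : Fin n → ℝ)
    (σ : ℝ) : ℝ :=
  optRisk X f σ (Finset.Icc 1 p)

/-- `m` is a size of an optimal single nested model. -/
def IsOptSize {n p : ℕ} (X : Matrix (Fin n) (Fin p) ℝ) (f : Fin n → ℝ) (σ : ℝ) (m : ℕ) : Prop :=
  m ∈ Finset.Icc 1 p ∧ ∀ k ∈ Finset.Icc 1 p, msRisk X f σ m ≤ msRisk X f σ k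

/-- The Mallows criterion `n⁻¹ ‖y - P_w y‖² + 2 n⁻¹ s ∑ k w_k`, where `s` is the value of the
variance estimator. -/
noncomputable def mmaCriterion {n p : ℕ} (X : Matrix (Fin n) (Fin p) ℝ) (K : Finset ℕ) (s : ℝ)
    (y : Fin n → ℝ) (w : ℕ → ℝ) : ℝ :=
  sqNorm (y - avgMatrix X K w *ᵥ y) / n + 2 * s / n * ∑ k ∈ K, (k : ℝ) * w k

/-- `w` is a Mallows model averaging (MMA) weight vector: it minimizes the Mallows criterion over
the weight set. -/
def IsMMAWeight {n p : ℕ} (X : Matrix (Fin n) (Fin p) ℝ) (K : Finset ℕ) (s : ℝ)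
    (y : Fin n → ℝ) (w : ℕ → ℝ) : Prop :=
  w ∈ weightSet K ∧ ∀ v ∈ weightSet K, mmaCriterion X K s y w ≤ mmaCriterion X K s y v

/-- `1 ∨ ⌊m / κ_l⌋`. -/
noncomputable def lowerSize (κl : ℝ) (m : ℕ) : ℕ := max 1 ⌊κl⁻¹ * m⌋₊

/-- `p ∧ ⌊κ_u m⌋`. -/
noncomputable def upperSize (p : ℕ) (κu : ℝ) (m : ℕ) : ℕ := min p ⌊κu * m⌋₊

/-- The candidate set centred at the size `m`: all nested models whose sizes lie between
`1 ∨ ⌊m / κ_l⌋` and `p ∧ ⌊κ_u m⌋`. -/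
noncomputable def msCandidates (p : ℕ) (κl κu : ℝ) (m : ℕ) : Finset ℕ :=
  Finset.Icc (lowerSize κl m) (upperSize p κu m)

/-- Slowly decaying coefficients; the sequence is `θ 1, θ 2, …`. -/
def SlowDecay (θ : ℕ → ℝ) : Prop :=
  ∃ κ δ ν : ℝ, 1 < κ ∧ 0 < δ ∧ δ ≤ ν ∧ ν < 1 ∧ κ * ν ^ 2 < 1 ∧
    ∀ᶠ l : ℕ in atTop, δ ≤ |θ ⌊κ * l⌋₊ / θ l| ∧ |θ ⌊κ * l⌋₊ / θ l| ≤ ν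

/-- Fast decaying coefficients; the sequence is `θ 1, θ 2, …`. -/
def FastDecay (θ : ℕ → ℝ) : Prop :=
  ∀ κ : ℝ, 1 < κ → Tendsto (fun l : ℕ => |θ ⌊κ * l⌋₊ / θ l|) atTop (𝓝 0)

/-- `Q_n ≤ [1 + o(1)] R_n` as `n → ∞`. -/
def AsympLe (Q R : ℕ → ℝ) : Prop :=
  ∃ r : ℕ → ℝ, Tendsto r atTop (𝓝 0) ∧ ∀ᶠ n in atTop, Q n ≤ (1 + r n) * R n

/-- For non-random weights the risk is the expected loss. -/
theorem integral_maLoss_eq_maRisk {n p : ℕ} {Ω : Type*} [MeasurableSpace Ω] (μ : Measure Ω)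
    [IsProbabilityMeasure μ] (X : Matrix (Fin n) (Fin p) ℝ) (f : Fin n → ℝ) (σ : ℝ)
    (ε : Fin n → Ω → ℝ) (hL : ∀ i, MemLp (ε i) 2 μ) (h0 : ∀ i, ∫ ω, ε i ω ∂μ = 0)
    (hcov : ∀ i j, ∫ ω, ε i ω * ε j ω ∂μ = if i = j then σ ^ 2 else 0)
    (K : Finset ℕ) (w : ℕ → ℝ) :
    ∫ ω, maLoss X f K w (fun i => f i + ε i ω) ∂μ = maRisk X f σ K w := by
  unfold maLoss maRisk
  generalize avgMatrix X K w = A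
  have hI : ∀ i, Integrable (ε i) μ := fun i => (hL i).integrable (by norm_num)
  have hII : ∀ i j, Integrable (fun ω => ε i ω * ε j ω) μ := fun i j =>
    (hL i).integrable_mul (hL j)
  have key : ∀ ω, sqNorm (A *ᵥ (fun i => f i + ε i ω) - f)
      = ∑ i, ((f i - (A *ᵥ f) i) ^ 2 - ∑ k, (2 * (f i - (A *ᵥ f) i) * A i k) * ε k ω
        + ∑ k, ∑ l, (A i k * A i l) * (ε k ω * ε l ω)) := by
    intro ω
    unfold sqNorm
    refine Finset.sum_congr rfl fun i _ => ?_
    have h1 : (A *ᵥ (fun i => f i + ε i ω) - f) i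
        = (A *ᵥ f) i - f i + ∑ k, A i k * ε k ω := by
      simp [Matrix.mulVec, dotProduct, mul_add, Finset.sum_add_distrib]; ring
    have h2 : ∑ k, ∑ l, (A i k * A i l) * (ε k ω * ε l ω) = (∑ k, A i k * ε k ω) ^ 2 := by
      rw [sq, Finset.sum_mul_sum]
      exact Finset.sum_congr rfl fun k _ => Finset.sum_congr rfl fun l _ => by ring
    have h3 : ∑ k, (2 * (f i - (A *ᵥ f) i) * A i k) * ε k ω
        = 2 * (f i - (A *ᵥ f) i) * ∑ k, A i k * ε k ω := by
      rw [Finset.mul_sum]; exact Finset.sum_congr rfl fun k _ => by ring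
    rw [h1, h2, h3]; ring
  rw [integral_div]
  simp_rw [key]
  rw [integral_finsetSum]
  · have : ∀ i, ∫ ω, ((f i - (A *ᵥ f) i) ^ 2 - ∑ k, (2 * (f i - (A *ᵥ f) i) * A i k) * ε k ω
        + ∑ k, ∑ l, (A i k * A i l) * (ε k ω * ε l ω)) ∂μ
        = (f i - (A *ᵥ f) i) ^ 2 + σ ^ 2 * ∑ k, A i k * A i k := by
      intro i
      rw [integral_add, integral_sub, integral_finsetSum, integral_finsetSum]
      · simp_rw [integral_const_mul, h0]
        have : ∀ k, ∫ ω, ∑ l, (A i k * A i l) * (ε k ω * ε l ω) ∂μ = A i k * A i k * σ ^ 2 := by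
          intro k
          rw [integral_finsetSum]
          · simp_rw [integral_const_mul, hcov]; simp
          · exact fun l _ => (hII k l).const_mul _
        simp_rw [this]
        simp [← Finset.sum_mul, mul_comm]
      · exact fun k _ => integrable_finsetSum _ fun l _ => (hII k l).const_mul _
      · exact fun k _ => (hI k).const_mul _
      · exact integrable_const _
      · exact integrable_finsetSum _ fun k _ => (hI k).const_mul _
      · exact (integrable_const _).sub (integrable_finsetSum _ fun k _ => (hI k).const_mul _)
      · exact integrable_finsetSum _ fun k _ => integrable_finsetSum _ fun l _ =>
          (hII k l).const_mul _
    simp_rw [this]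
    rw [Finset.sum_add_distrib, ← Finset.mul_sum]
    have ht : (Aᵀ * A).trace = ∑ i, ∑ k, A i k * A i k := by
      simp only [Matrix.trace, Matrix.diag, Matrix.mul_apply, Matrix.transpose_apply]
      exact Finset.sum_comm
    rw [ht]
    simp only [sqNorm, Pi.sub_apply]
    ring
  · exact fun i _ => ((integrable_const _).sub
      (integrable_finsetSum _ fun k _ => (hI k).const_mul _)).add
      (integrable_finsetSum _ fun k _ => integrable_finsetSum _ fun l _ => (hII k l).const_mul _)

end MallowsMA

/-! Every `P_k` is diagonal in one orthonormal system `ψ 0, …, ψ (p - 1)`, so averaging with weights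
`w` multiplies coordinate `j` by the tail weight `γ_j = ∑_{k > j} w_k`. Write `s = σ² / n`, and `t_j
= θ_{j+1}` since coordinates are counted from zero. The risk becomes `∑ ((1 - γ_j)² t_j² + s γ_j²)`.
Each term is at least the ideal cost `t_j² s / (t_j² + s)`, attained at `γ_j = t_j² / (t_j² + s)`.
These factors decrease in `j` because the coefficients are ordered, so weights realise them except
at `j = 0`, where `γ_0 = 1` is forced. Hence the optimal averaging risk is the sum of ideal costs up
to an error of at most `s` (`le_fullOptRisk`, `fullOptRisk_le`).

Slow decay. The window starts at a size `l` of order `m*`, which forces `γ_j = 1` for all `j < l`.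
For `l / 2 ≤ j < l` the coefficient satisfies `t_j² ≤ D s` (`exists_comparable`), so full weight
wastes a fixed fraction of `s` on each such coordinate. The total waste is of order `m* s`. By
`tail_sum_le` the optimal risk is at most of that order too.

Fast decay. Nearly all `t_j²` with `j < m*` are far above `s`, and the tail beyond `m*` is
negligible. So the optimal averaging risk and the risk of the single model `m*` are both `m* s (1 +
o(1))` (`exists_fast_decay_facts`). Comparing the Mallows criterion at its minimiser with the
largest model of the window bounds the loss on `[l, u)` by a multiple of the noise there plus `(u -
l)(σ² + |σ̂² - σ²|) / n` (`maLoss_mma_le`, `maRisk_mma_le`). For a fixed window of bounded width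
this has mean `o(m* s)`.

When the window comes from the same sample, expectations cannot be taken window by window. Two
uniform bounds replace them: `exists_window_bound`, from sixth moments, controls the noise in every
short window at once, and `exists_prefix_bound`, from exponential moments, compares the noise in
every initial segment with that of the first `m*` coordinates. A selected size below `m*` leaves
extra bias, which is charged to its excess risk; the expected excess risk is negligible by the
assumption on `m̂`. -/

namespace MallowsMA

/-! ### The orthonormal system behind the nested projections. -/

/-- `ψ 0, …, ψ (p - 1)` are orthonormal, and `P_k` is the orthogonal projection on the span of the
first `k` of them. -/
structure NestedBasis {n p : ℕ} (X : Matrix (Fin n) (Fin p) ℝ) (ψ : ℕ → Fin n → ℝ) : Prop where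
  orth : ∀ i < p, ∀ j < p, ψ i ⬝ᵥ ψ j = if i = j then 1 else 0
  hat : ∀ k ≤ p, hatMatrix X k = ∑ j ∈ Finset.range k, vecMulVec (ψ j) (ψ j)

theorem sqNorm_eq_dotProduct {n : ℕ} (v : Fin n → ℝ) : sqNorm v = v ⬝ᵥ v := by
  simp [sqNorm, dotProduct, sq]

theorem sqNorm_nonneg {n : ℕ} (v : Fin n → ℝ) : 0 ≤ sqNorm v :=
  Finset.sum_nonneg fun _ _ => sq_nonneg _

theorem hatMatrix_zero {n p : ℕ} (X : Matrix (Fin n) (Fin p) ℝ) : hatMatrix X 0 = 0 := by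
  have : IsEmpty {j : Fin p // (j : ℕ) < 0} := ⟨fun j => absurd j.2 (Nat.not_lt_zero _)⟩
  ext i j
  simp [hatMatrix, Matrix.mul_apply]

/-- No rank hypothesis is needed: for a singular Gram matrix `⁻¹` is zero by convention, and then so
is the hat matrix. -/
theorem hatMatrix_mul_self {n p : ℕ} (X : Matrix (Fin n) (Fin p) ℝ) (k : ℕ) :
    hatMatrix X k * hatMatrix X k = hatMatrix X k := by
  unfold hatMatrix
  set N := nestedDesign X k
  by_cases h : IsUnit (Nᵀ * N).det
  · calc N * (Nᵀ * N)⁻¹ * Nᵀ * (N * (Nᵀ * N)⁻¹ * Nᵀ)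
        = N * ((Nᵀ * N)⁻¹ * (Nᵀ * N)) * (Nᵀ * N)⁻¹ * Nᵀ := by simp only [Matrix.mul_assoc]
      _ = _ := by rw [Matrix.nonsing_inv_mul _ h, Matrix.mul_one]
  · rw [Matrix.nonsing_inv_apply_not_isUnit _ h]; simp

theorem hatMatrix_mulVec_self {n p : ℕ} (X : Matrix (Fin n) (Fin p) ℝ) (hX : X.rank = p)
    (β : Fin p → ℝ) : hatMatrix X p *ᵥ (X *ᵥ β) = X *ᵥ β := by
  let e : {j : Fin p // (j : ℕ) < p} ≃ Fin p := Equiv.subtypeUnivEquiv fun j => j.2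
  have hN : nestedDesign X p = X.submatrix id e := rfl
  have hdet : IsUnit (Xᵀ * X).det := by
    rw [← Matrix.isUnit_iff_isUnit_det, ← Matrix.mulVec_surjective_iff_isUnit]
    have : LinearMap.range (Xᵀ * X).mulVecLin = ⊤ := by
      apply Submodule.eq_top_of_finrank_eq
      have h := Matrix.rank_transpose_mul_self X
      rw [Matrix.rank, hX] at h
      rw [h, Module.finrank_fin_fun]
    exact LinearMap.range_eq_top.1 this
  have hG : (nestedDesign X p)ᵀ * nestedDesign X p = (Xᵀ * X).submatrix e e := by
    rw [hN]; ext i j; simp [Matrix.mul_apply]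
  have hdet' : IsUnit ((nestedDesign X p)ᵀ * nestedDesign X p).det := by
    rw [hG, Matrix.det_submatrix_equiv_self]; exact hdet
  have hXb : X *ᵥ β = nestedDesign X p *ᵥ (β ∘ e) := by
    ext i
    simp only [hN, Matrix.mulVec, dotProduct, Matrix.submatrix_apply, id, Function.comp]
    exact (Equiv.sum_comp e fun j => X i j * β j).symm
  rw [hXb, Matrix.mulVec_mulVec, hatMatrix, Matrix.mul_assoc, Matrix.mul_assoc,
    Matrix.nonsing_inv_mul _ hdet', Matrix.mul_one]

/-- Orthogonality is forced by idempotence. If `P` and `P + v vᵀ` are both idempotent and `v` is a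
unit vector, then `P v vᵀ + v vᵀ P = 0`. Testing this against `v` gives `vᵀ P v = 0`, and `vᵀ P v`
is the sum of the squared inner products of `v` with the earlier vectors. -/
theorem exists_nestedBasis {n p : ℕ} (X : Matrix (Fin n) (Fin p) ℝ) (φ : Fin p → Fin n → ℝ)
    (hφ : IsNestedEigenbasis X φ) :
    ∃ ψ : ℕ → Fin n → ℝ, NestedBasis X ψ ∧ ∀ j : Fin p, ψ j = φ j := by
  let ψ : ℕ → Fin n → ℝ := fun j => if h : j < p then φ ⟨j, h⟩ else 0
  have hψ : ∀ j : Fin p, ψ j = φ j := fun j => by simp [ψ]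
  have hat : ∀ k ≤ p, hatMatrix X k = ∑ j ∈ Finset.range k, vecMulVec (ψ j) (ψ j) := by
    intro k hk
    induction k with
    | zero => simpa using hatMatrix_zero X
    | succ k ih =>
      rw [Finset.sum_range_succ, ← ih (by omega)]
      have := (hφ ⟨k, hk⟩).2
      rw [← hψ] at this
      simp only at this
      rw [← this]; abel
  have hone : ∀ j < p, ψ j ⬝ᵥ ψ j = 1 := by
    intro j hj
    have := (hφ ⟨j, hj⟩).1
    rw [← hψ, sqNorm_eq_dotProduct] at this
    exact this
  have hlt : ∀ j < p, ∀ i < j, ψ i ⬝ᵥ ψ j = 0 := by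
    intro j hj
    set P := hatMatrix X j with hP
    set v := ψ j with hv
    have h1 : hatMatrix X (j + 1) = P + vecMulVec v v := by
      rw [hat _ hj, Finset.sum_range_succ, hP, hat _ hj.le]
    have h2 := hatMatrix_mul_self X (j + 1)
    have h3 := hatMatrix_mul_self X j
    rw [h1] at h2
    rw [← hP] at h3
    have h4 : P * vecMulVec v v + vecMulVec v v * P = 0 := by
      have hvv : vecMulVec v v * vecMulVec v v = vecMulVec v v := by
        rw [Matrix.vecMulVec_mul_vecMulVec, hone j hj]; simp
      rw [Matrix.add_mul, Matrix.mul_add, Matrix.mul_add, h3, hvv] at h2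
      have : P + (P * vecMulVec v v + vecMulVec v v * P) + vecMulVec v v = P + vecMulVec v v := by
        rw [← h2]; abel
      simpa using this
    have h5 : v ⬝ᵥ (P *ᵥ v) = 0 := by
      have := congrArg (fun M : Matrix (Fin n) (Fin n) ℝ => v ⬝ᵥ (M *ᵥ v)) h4
      simp only [Matrix.add_mulVec, ← Matrix.mulVec_mulVec, Matrix.vecMulVec_mulVec,
        dotProduct_add, Matrix.zero_mulVec, dotProduct_zero] at this
      rw [hone j hj] at this
      simp only [MulOpposite.op_one, one_smul] at this
      rw [dotProduct_smul, hone j hj] at this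
      simp only [MulOpposite.smul_eq_mul_unop, MulOpposite.unop_op, one_mul] at this
      linarith
    have h6 : v ⬝ᵥ (P *ᵥ v) = ∑ i ∈ Finset.range j, (ψ i ⬝ᵥ v) ^ 2 := by
      rw [hP, hat _ hj.le, Matrix.sum_mulVec, dotProduct_sum]
      refine Finset.sum_congr rfl fun i _ => ?_
      rw [Matrix.vecMulVec_mulVec]
      simp [dotProduct_comm v (ψ i), sq]
    rw [h6, Finset.sum_eq_zero_iff_of_nonneg fun _ _ => sq_nonneg _] at h5
    intro i hi
    exact pow_eq_zero_iff two_ne_zero |>.1 (h5 i (Finset.mem_range.2 hi))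
  refine ⟨ψ, ⟨fun i hi j hj => ?_, hat⟩, hψ⟩
  rcases lt_trichotomy i j with h | h | h
  · rw [if_neg h.ne, hlt j hj i h]
  · rw [if_pos h, h, hone j hj]
  · rw [if_neg h.ne', dotProduct_comm, hlt i hi j h]

/-! ### Loss, risk and Mallows criterion in diagonal form. -/

section Coordinates

variable {n p : ℕ} {X : Matrix (Fin n) (Fin p) ℝ} {ψ : ℕ → Fin n → ℝ}

theorem NestedBasis.dotProduct_sum_smul (h : NestedBasis X ψ) (c : ℕ → ℝ) {i : ℕ} (hi : i < p) :
    ψ i ⬝ᵥ (∑ j ∈ Finset.range p, c j • ψ j) = c i := by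
  rw [dotProduct_sum, Finset.sum_eq_single_of_mem i (Finset.mem_range.2 hi)]
  · simp [h.orth i hi i hi]
  · intro j hj hji
    simp [h.orth i hi j (Finset.mem_range.1 hj), hji.symm]

theorem NestedBasis.sqNorm_sub (h : NestedBasis X ψ) (v : Fin n → ℝ) (c : ℕ → ℝ) :
    sqNorm (v - ∑ j ∈ Finset.range p, c j • ψ j)
      = sqNorm v + ∑ j ∈ Finset.range p, (c j ^ 2 - 2 * c j * (ψ j ⬝ᵥ v)) := by
  set u := ∑ j ∈ Finset.range p, c j • ψ j with hu
  have h1 : u ⬝ᵥ u = ∑ j ∈ Finset.range p, c j ^ 2 := by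
    nth_rewrite 1 [hu]
    rw [sum_dotProduct]
    refine Finset.sum_congr rfl fun i hi => ?_
    rw [smul_dotProduct, h.dotProduct_sum_smul c (Finset.mem_range.1 hi), smul_eq_mul, sq]
  have h2 : u ⬝ᵥ v = ∑ j ∈ Finset.range p, c j * (ψ j ⬝ᵥ v) := by
    rw [hu, sum_dotProduct]
    exact Finset.sum_congr rfl fun i hi => by rw [smul_dotProduct, smul_eq_mul]
  rw [sqNorm_eq_dotProduct, sqNorm_eq_dotProduct, sub_dotProduct, dotProduct_sub, dotProduct_sub,
    dotProduct_comm v u, h1, h2, Finset.sum_sub_distrib]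
  simp_rw [mul_assoc]
  rw [← Finset.mul_sum]
  ring

theorem NestedBasis.sqNorm_sum (h : NestedBasis X ψ) (c : ℕ → ℝ) :
    sqNorm (∑ j ∈ Finset.range p, c j • ψ j) = ∑ j ∈ Finset.range p, c j ^ 2 := by
  have := h.sqNorm_sub 0 c
  simp only [zero_sub, dotProduct_zero, mul_zero, sub_zero] at this
  simpa [sqNorm] using this

/-- The shrinkage factor of the coordinate `j` in the averaged model. -/
def tailWeight (K : Finset ℕ) (w : ℕ → ℝ) (j : ℕ) : ℝ := ∑ k ∈ K with j < k, w k

/-- Exchanging the two sums turns weights on nested models into shrinkage factors on coordinates;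
used for matrices and for the penalty alike. -/
theorem sum_smul_sum_range {M : Type*} [AddCommGroup M] [Module ℝ M] {K : Finset ℕ} {p : ℕ}
    (hK : K ⊆ Finset.Icc 1 p) (w : ℕ → ℝ) (b : ℕ → M) :
    ∑ k ∈ K, w k • ∑ j ∈ Finset.range k, b j
      = ∑ j ∈ Finset.range p, tailWeight K w j • b j := by
  simp_rw [tailWeight, Finset.sum_smul, Finset.smul_sum, Finset.sum_filter]
  rw [Finset.sum_comm]
  refine Finset.sum_congr rfl fun k hk => ?_
  rw [← Finset.sum_filter]
  refine Finset.sum_congr ?_ fun _ _ => rfl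
  have := Finset.mem_Icc.1 (hK hk)
  ext j; simp; omega

theorem NestedBasis.avgMatrix_eq (h : NestedBasis X ψ) {K : Finset ℕ} (hK : K ⊆ Finset.Icc 1 p)
    (w : ℕ → ℝ) :
    avgMatrix X K w = ∑ j ∈ Finset.range p, tailWeight K w j • vecMulVec (ψ j) (ψ j) := by
  rw [avgMatrix, ← sum_smul_sum_range hK]
  exact Finset.sum_congr rfl fun k hk => by rw [h.hat k (Finset.mem_Icc.1 (hK hk)).2]

theorem NestedBasis.avgMatrix_mulVec (h : NestedBasis X ψ) {K : Finset ℕ}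
    (hK : K ⊆ Finset.Icc 1 p) (w : ℕ → ℝ) (v : Fin n → ℝ) :
    avgMatrix X K w *ᵥ v
      = ∑ j ∈ Finset.range p, (tailWeight K w j * (ψ j ⬝ᵥ v)) • ψ j := by
  rw [h.avgMatrix_eq hK, Matrix.sum_mulVec]
  refine Finset.sum_congr rfl fun j _ => ?_
  rw [Matrix.smul_mulVec, Matrix.vecMulVec_mulVec]
  ext i; simp; ring

theorem NestedBasis.trace_avgMatrix (h : NestedBasis X ψ) {K : Finset ℕ}
    (hK : K ⊆ Finset.Icc 1 p) (w : ℕ → ℝ) :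
    ((avgMatrix X K w)ᵀ * avgMatrix X K w).trace
      = ∑ j ∈ Finset.range p, tailWeight K w j ^ 2 := by
  rw [h.avgMatrix_eq hK, Matrix.transpose_sum, Matrix.sum_mul, Matrix.trace_sum]
  refine Finset.sum_congr rfl fun i hi => ?_
  rw [Matrix.mul_sum, Finset.sum_eq_single_of_mem i hi]
  · have := h.orth i (Finset.mem_range.1 hi) i (Finset.mem_range.1 hi)
    rw [Matrix.transpose_smul, Matrix.transpose_vecMulVec, Matrix.smul_mul, Matrix.mul_smul,
      Matrix.vecMulVec_mul_vecMulVec, this]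
    simp [Matrix.trace_vecMulVec, this, sq]
  · intro j hj hji
    rw [Matrix.transpose_smul, Matrix.transpose_vecMulVec, Matrix.smul_mul, Matrix.mul_smul,
      Matrix.vecMulVec_mul_vecMulVec, h.orth i (Finset.mem_range.1 hi) j (Finset.mem_range.1 hj),
      if_neg hji.symm]
    simp

/-- `f` lies in the column span and `t` are its normalized coordinates. -/
structure HasCoords {n : ℕ} (p : ℕ) (ψ : ℕ → Fin n → ℝ) (f : Fin n → ℝ) (t : ℕ → ℝ) : Prop where
  eq_sum : f = ∑ j ∈ Finset.range p, (ψ j ⬝ᵥ f) • ψ j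
  coef : ∀ j < p, ψ j ⬝ᵥ f = Real.sqrt n * t j

theorem NestedBasis.hasCoords (h : NestedBasis X ψ) (hn : 1 ≤ n) (hX : X.rank = p)
    (β : Fin p → ℝ) {f : Fin n → ℝ} (hf : f = X *ᵥ β) (t : ℕ → ℝ)
    (ht : ∀ j < p, (ψ j ⬝ᵥ f) / Real.sqrt n = t j) : HasCoords p ψ f t := by
  constructor
  · have h1 := hatMatrix_mulVec_self X hX β
    rw [← hf, h.hat p le_rfl, Matrix.sum_mulVec] at h1
    nth_rewrite 1 [← h1]
    refine Finset.sum_congr rfl fun j _ => ?_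
    rw [Matrix.vecMulVec_mulVec]; ext i; simp [mul_comm]
  · intro j hj
    have : (0 : ℝ) < Real.sqrt n := Real.sqrt_pos.2 (by exact_mod_cast hn)
    rw [← ht j hj]; field_simp

theorem NestedBasis.maLoss_eq (h : NestedBasis X ψ) (hn : 1 ≤ n) {f : Fin n → ℝ} {t : ℕ → ℝ}
    (hf : HasCoords p ψ f t) {K : Finset ℕ} (hK : K ⊆ Finset.Icc 1 p) (w : ℕ → ℝ)
    (ε : Fin n → ℝ) :
    maLoss X f K w (f + ε) = ∑ j ∈ Finset.range p,
      (tailWeight K w j * (t j + (ψ j ⬝ᵥ ε) / Real.sqrt n) - t j) ^ 2 := by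
  have hn' : (0 : ℝ) < n := by exact_mod_cast hn
  have hs : (0 : ℝ) < Real.sqrt n := Real.sqrt_pos.2 hn'
  have key : avgMatrix X K w *ᵥ (f + ε) - f = ∑ j ∈ Finset.range p,
      (tailWeight K w j * (ψ j ⬝ᵥ (f + ε)) - (ψ j ⬝ᵥ f)) • ψ j := by
    nth_rewrite 2 [hf.eq_sum]
    rw [h.avgMatrix_mulVec hK, ← Finset.sum_sub_distrib]
    exact Finset.sum_congr rfl fun j _ => by rw [sub_smul]
  rw [maLoss, key, h.sqNorm_sum, Finset.sum_div]
  refine Finset.sum_congr rfl fun j hj => ?_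
  rw [dotProduct_add, hf.coef j (Finset.mem_range.1 hj)]
  nth_rewrite 3 [← Real.sq_sqrt hn'.le]
  field_simp

theorem NestedBasis.maRisk_eq (h : NestedBasis X ψ) (hn : 1 ≤ n) {f : Fin n → ℝ} {t : ℕ → ℝ}
    (hf : HasCoords p ψ f t) (σ : ℝ) {K : Finset ℕ} (hK : K ⊆ Finset.Icc 1 p) (w : ℕ → ℝ) :
    maRisk X f σ K w = ∑ j ∈ Finset.range p,
      ((1 - tailWeight K w j) ^ 2 * t j ^ 2 + σ ^ 2 / n * tailWeight K w j ^ 2) := by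
  have hn' : (0 : ℝ) < n := by exact_mod_cast hn
  have key : f - avgMatrix X K w *ᵥ f = ∑ j ∈ Finset.range p,
      ((1 - tailWeight K w j) * (ψ j ⬝ᵥ f)) • ψ j := by
    nth_rewrite 1 [hf.eq_sum]
    rw [h.avgMatrix_mulVec hK, ← Finset.sum_sub_distrib]
    exact Finset.sum_congr rfl fun j _ => by rw [← sub_smul]; ring_nf
  rw [maRisk, key, h.sqNorm_sum, h.trace_avgMatrix hK, Finset.sum_div, Finset.sum_add_distrib,
    Finset.mul_sum]
  congr 1
  refine Finset.sum_congr rfl fun j hj => ?_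
  rw [hf.coef j (Finset.mem_range.1 hj), mul_pow, mul_pow, Real.sq_sqrt hn'.le]
  field_simp

/-- The square is completed in each coordinate so that the first bracket does not involve `w` and
cancels in every comparison of two weight vectors. -/
theorem NestedBasis.mmaCriterion_eq (h : NestedBasis X ψ) (hn : 1 ≤ n) {f : Fin n → ℝ}
    {t : ℕ → ℝ} (hf : HasCoords p ψ f t) {K : Finset ℕ} (hK : K ⊆ Finset.Icc 1 p) (s : ℝ)
    (w : ℕ → ℝ) (ε : Fin n → ℝ) :
    mmaCriterion X K s (f + ε) w
      = (sqNorm (f + ε) / n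
          - ∑ j ∈ Finset.range p, (t j + (ψ j ⬝ᵥ ε) / Real.sqrt n) ^ 2)
        + ∑ j ∈ Finset.range p,
          ((1 - tailWeight K w j) ^ 2 * (t j + (ψ j ⬝ᵥ ε) / Real.sqrt n) ^ 2
            + 2 * s / n * tailWeight K w j) := by
  have hn' : (0 : ℝ) < n := by exact_mod_cast hn
  have hs : (0 : ℝ) < Real.sqrt n := Real.sqrt_pos.2 hn'
  have h1 : ∑ k ∈ K, (k : ℝ) * w k = ∑ j ∈ Finset.range p, tailWeight K w j := by
    have := sum_smul_sum_range hK w (fun _ => (1 : ℝ))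
    simpa [mul_comm] using this
  rw [mmaCriterion, h.avgMatrix_mulVec hK, h.sqNorm_sub, h1, add_div, Finset.mul_sum,
    Finset.sum_add_distrib, Finset.sum_div]
  have h2 : ∀ j ∈ Finset.range p,
      ((tailWeight K w j * (ψ j ⬝ᵥ (f + ε))) ^ 2
        - 2 * (tailWeight K w j * (ψ j ⬝ᵥ (f + ε))) * (ψ j ⬝ᵥ (f + ε))) / n
      = (1 - tailWeight K w j) ^ 2 * (t j + (ψ j ⬝ᵥ ε) / Real.sqrt n) ^ 2
        - (t j + (ψ j ⬝ᵥ ε) / Real.sqrt n) ^ 2 := by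
    intro j hj
    have : ψ j ⬝ᵥ (f + ε) = Real.sqrt n * (t j + (ψ j ⬝ᵥ ε) / Real.sqrt n) := by
      rw [dotProduct_add, hf.coef j (Finset.mem_range.1 hj)]; field_simp
    rw [this]
    set z := t j + (ψ j ⬝ᵥ ε) / Real.sqrt n
    rw [div_eq_iff hn'.ne']
    linear_combination (tailWeight K w j ^ 2 * z ^ 2 - 2 * tailWeight K w j * z ^ 2)
      * Real.sq_sqrt hn'.le
  rw [Finset.sum_congr rfl h2, Finset.sum_sub_distrib]
  ring

end Coordinates

/-! ### Shrinkage factors of simplex weights. -/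

section Weights

variable {K : Finset ℕ} {w : ℕ → ℝ}

theorem tailWeight_nonneg (hw : w ∈ weightSet K) (j : ℕ) : 0 ≤ tailWeight K w j :=
  Finset.sum_nonneg fun k hk => (hw.1 k (Finset.mem_filter.1 hk).1).1

theorem tailWeight_le_one (hw : w ∈ weightSet K) (j : ℕ) : tailWeight K w j ≤ 1 := by
  rw [← hw.2.2]
  exact Finset.sum_le_sum_of_subset_of_nonneg (Finset.filter_subset _ _)
    fun k hk _ => (hw.1 k hk).1

theorem tailWeight_eq_one (hw : w ∈ weightSet K) {j : ℕ} (hj : ∀ k ∈ K, j < k) :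
    tailWeight K w j = 1 := by
  rw [tailWeight, Finset.filter_true_of_mem hj, hw.2.2]

theorem tailWeight_eq_zero (w : ℕ → ℝ) {j : ℕ} (hj : ∀ k ∈ K, k ≤ j) : tailWeight K w j = 0 := by
  rw [tailWeight, Finset.filter_false_of_mem fun k hk => not_lt.2 (hj k hk), Finset.sum_empty]

theorem single_mem_weightSet {m : ℕ} (hm : m ∈ K) : (Pi.single m 1 : ℕ → ℝ) ∈ weightSet K := by
  refine ⟨fun k _ => ?_, fun k hk => ?_, ?_⟩
  · by_cases h : k = m
    · subst h; simp
    · simp [Pi.single_eq_of_ne h]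
  · exact Pi.single_eq_of_ne (fun h => hk (by rwa [h])) _
  · simp [hm]

theorem tailWeight_single {m : ℕ} (hm : m ∈ K) (j : ℕ) :
    tailWeight K (Pi.single m 1) j = if j < m then 1 else 0 := by
  simp [tailWeight, hm]

/-- Weights with prescribed shrinkage factors. -/
theorem exists_weight_of_antitone {p : ℕ} (G : ℕ → ℝ) (hG : Antitone G) (h0 : G 0 = 1)
    (hp : G p = 0) :
    ∃ w ∈ weightSet (Finset.Icc 1 p), ∀ j < p, tailWeight (Finset.Icc 1 p) w j = G j := by
  let w : ℕ → ℝ := fun k => if k ∈ Finset.Icc 1 p then G (k - 1) - G k else 0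
  have htail : ∀ j ≤ p, tailWeight (Finset.Icc 1 p) w j = G j := by
    intro j hj
    have h1 : (Finset.Icc 1 p).filter (fun k => j < k) = Finset.Ico (j + 1) (p + 1) := by
      ext k; simp; omega
    rw [tailWeight, h1, ← Finset.sum_Ico_add' w j p 1]
    have h2 : ∀ k ∈ Finset.Ico j p, w (k + 1) = G k - G (k + 1) := by
      intro k hk
      have := Finset.mem_Ico.1 hk
      simp only [w]
      rw [if_pos (Finset.mem_Icc.2 (by omega))]; simp
    rw [Finset.sum_congr rfl h2]
    have := Finset.sum_Ico_sub G hj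
    rw [hp] at this
    rw [← neg_inj, ← Finset.sum_neg_distrib]
    simp only [neg_sub]
    rw [this]; ring
  have hsum : ∑ k ∈ Finset.Icc 1 p, w k = 1 := by
    have := htail 0 (Nat.zero_le _)
    rw [h0, tailWeight, Finset.filter_true_of_mem] at this
    · exact this
    · intro k hk; have := Finset.mem_Icc.1 hk; omega
  have hnn : ∀ k ∈ Finset.Icc 1 p, 0 ≤ w k := by
    intro k hk
    simp only [w, if_pos hk]
    exact sub_nonneg.2 (hG (Nat.sub_le _ _))
  refine ⟨w, ⟨fun k hk => ⟨hnn k hk, ?_⟩, fun k hk => if_neg hk, hsum⟩,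
    fun j hj => htail j hj.le⟩
  rw [← hsum]
  exact Finset.single_le_sum hnn hk

end Weights

theorem sum_range_split {a b p : ℕ} (h1 : a ≤ b) (h2 : b ≤ p) (F : ℕ → ℝ) :
    ∑ j ∈ Finset.range p, F j = ∑ j ∈ Finset.range a, F j + ∑ j ∈ Finset.Ico a b, F j
      + ∑ j ∈ Finset.Ico b p, F j := by
  rw [Finset.range_eq_Ico, Finset.range_eq_Ico, Finset.sum_Ico_consecutive F (Nat.zero_le _) h1,
    Finset.sum_Ico_consecutive F (Nat.zero_le _) h2]

/-- The right side exceeds the left by `(a - g (a + s))² / (a + s)`, which vanishes at the ideal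
factor `g = a / (a + s)`. -/
theorem shrinkage_lower {a s : ℝ} (ha : 0 ≤ a) (hs : 0 < s) (g : ℝ) :
    a * s / (a + s) ≤ (1 - g) ^ 2 * a + s * g ^ 2 := by
  rw [div_le_iff₀ (by positivity)]
  nlinarith [sq_nonneg (a - g * (a + s))]

/-! ### Risk bounds: ideal shrinkage, forced weights, and the Mallows minimiser. -/

section Risk

variable {n p : ℕ} {X : Matrix (Fin n) (Fin p) ℝ} {ψ : ℕ → Fin n → ℝ} {f : Fin n → ℝ}
  {t : ℕ → ℝ} {σ : ℝ}

theorem maRisk_nonneg (X : Matrix (Fin n) (Fin p) ℝ) (f : Fin n → ℝ) (σ : ℝ) (K : Finset ℕ)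
    (w : ℕ → ℝ) : 0 ≤ maRisk X f σ K w := by
  refine add_nonneg (div_nonneg (sqNorm_nonneg _) (Nat.cast_nonneg _))
    (mul_nonneg (by positivity) ?_)
  simp only [Matrix.trace, Matrix.diag, Matrix.mul_apply, Matrix.transpose_apply]
  exact Finset.sum_nonneg fun _ _ => Finset.sum_nonneg fun _ _ => mul_self_nonneg _

theorem maLoss_nonneg (X : Matrix (Fin n) (Fin p) ℝ) (f : Fin n → ℝ) (K : Finset ℕ)
    (w : ℕ → ℝ) (y : Fin n → ℝ) : 0 ≤ maLoss X f K w y :=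
  div_nonneg (sqNorm_nonneg _) (Nat.cast_nonneg _)

theorem bddBelow_maRisk (X : Matrix (Fin n) (Fin p) ℝ) (f : Fin n → ℝ) (σ : ℝ) (K : Finset ℕ) :
    BddBelow (maRisk X f σ K '' weightSet K) := by
  refine ⟨0, ?_⟩
  rintro _ ⟨w, -, rfl⟩
  exact maRisk_nonneg _ _ _ _ _

theorem NestedBasis.msRisk_eq (h : NestedBasis X ψ) (hn : 1 ≤ n) (hf : HasCoords p ψ f t) (σ : ℝ)
    {m : ℕ} (hm : m ∈ Finset.Icc 1 p) :
    msRisk X f σ m = m * (σ ^ 2 / n) + ∑ j ∈ Finset.Ico m p, t j ^ 2 := by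
  have hm' := Finset.mem_Icc.1 hm
  rw [msRisk, h.maRisk_eq hn hf σ (Finset.singleton_subset_iff.2 hm),
    sum_range_split le_rfl hm'.2]
  simp only [tailWeight_single (Finset.mem_singleton_self m)]
  have h1 : ∀ j ∈ Finset.range m, ((1 - (if j < m then (1 : ℝ) else 0)) ^ 2 * t j ^ 2
      + σ ^ 2 / n * (if j < m then (1 : ℝ) else 0) ^ 2) = σ ^ 2 / n := by
    intro j hj; simp [Finset.mem_range.1 hj]
  have h2 : ∀ j ∈ Finset.Ico m p, ((1 - (if j < m then (1 : ℝ) else 0)) ^ 2 * t j ^ 2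
      + σ ^ 2 / n * (if j < m then (1 : ℝ) else 0) ^ 2) = t j ^ 2 := by
    intro j hj; simp [not_lt.2 (Finset.mem_Ico.1 hj).1]
  rw [Finset.sum_congr rfl h1, Finset.sum_congr rfl h2]
  simp

theorem NestedBasis.fullOptRisk_le_msRisk (h : NestedBasis X ψ) (hn : 1 ≤ n)
    (hf : HasCoords p ψ f t) (σ : ℝ) {m : ℕ} (hm : m ∈ Finset.Icc 1 p) :
    fullOptRisk X f σ ≤ msRisk X f σ m := by
  have h1 : msRisk X f σ m = maRisk X f σ (Finset.Icc 1 p) (Pi.single m 1) := by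
    rw [msRisk, h.maRisk_eq hn hf σ (Finset.singleton_subset_iff.2 hm),
      h.maRisk_eq hn hf σ (Finset.Subset.refl _)]
    simp only [tailWeight_single hm, tailWeight_single (Finset.mem_singleton_self m)]
  rw [h1]
  exact csInf_le (bddBelow_maRisk _ _ _ _) ⟨_, single_mem_weightSet hm, rfl⟩

theorem NestedBasis.le_fullOptRisk (h : NestedBasis X ψ) (hn : 1 ≤ n) (hp : 1 ≤ p)
    (hf : HasCoords p ψ f t) (hσ : 0 < σ) :
    ∑ j ∈ Finset.range p, t j ^ 2 * (σ ^ 2 / n) / (t j ^ 2 + σ ^ 2 / n) ≤ fullOptRisk X f σ := by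
  have hn' : (0 : ℝ) < n := by exact_mod_cast hn
  refine le_csInf ⟨_, _, single_mem_weightSet (Finset.mem_Icc.2 ⟨le_rfl, hp⟩), rfl⟩ ?_
  rintro _ ⟨w, -, rfl⟩
  rw [h.maRisk_eq hn hf σ (Finset.Subset.refl _)]
  exact Finset.sum_le_sum fun j _ => shrinkage_lower (sq_nonneg _) (by positivity) _

theorem NestedBasis.fullOptRisk_le (h : NestedBasis X ψ) (hn : 1 ≤ n) (hp : 1 ≤ p)
    (hf : HasCoords p ψ f t) (hσ : 0 < σ) (ht : Antitone fun j => t j ^ 2) :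
    fullOptRisk X f σ ≤ σ ^ 2 / n
      + ∑ j ∈ Finset.range p, t j ^ 2 * (σ ^ 2 / n) / (t j ^ 2 + σ ^ 2 / n) := by
  have hn' : (0 : ℝ) < n := by exact_mod_cast hn
  set s := σ ^ 2 / n with hs
  have hs0 : 0 < s := by positivity
  -- The ideal factors, except that coordinate `0` belongs to every candidate and must have factor
  -- `1`. This exception costs at most the extra `s`.
  let G : ℕ → ℝ := fun j => if j = 0 then 1 else if j < p then t j ^ 2 / (t j ^ 2 + s) else 0
  have hle : ∀ j, t j ^ 2 / (t j ^ 2 + s) ≤ 1 := fun j => by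
    rw [div_le_one (by positivity)]; linarith
  have hG : Antitone G := by
    refine antitone_nat_of_succ_le fun j => ?_
    simp only [G, Nat.succ_ne_zero, if_false]
    by_cases h1 : j + 1 < p
    · rw [if_pos h1]
      by_cases h0 : j = 0
      · rw [if_pos h0]; exact hle _
      · rw [if_neg h0, if_pos (by omega)]
        have := ht (Nat.le_succ j)
        simp only at this
        rw [div_le_div_iff₀ (by positivity) (by positivity)]
        nlinarith
    · rw [if_neg h1]
      split_ifs
      · norm_num
      · positivity
      · rfl
  obtain ⟨w, hw, hwG⟩ := exists_weight_of_antitone G hG (by simp [G])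
    (by simp [G]; omega : G p = 0)
  refine (csInf_le (bddBelow_maRisk _ _ _ _) ⟨w, hw, rfl⟩).trans ?_
  rw [h.maRisk_eq hn hf σ (Finset.Subset.refl _)]
  have key : ∀ j ∈ Finset.range p, (1 - tailWeight (Finset.Icc 1 p) w j) ^ 2 * t j ^ 2
      + s * tailWeight (Finset.Icc 1 p) w j ^ 2
      ≤ (if j = 0 then s else 0) + t j ^ 2 * s / (t j ^ 2 + s) := by
    intro j hj
    rw [hwG j (Finset.mem_range.1 hj)]
    simp only [G]
    by_cases h0 : j = 0
    · simp only [if_pos h0]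
      have : 0 ≤ t j ^ 2 * s / (t j ^ 2 + s) := by positivity
      nlinarith
    · simp only [if_neg h0, if_pos (Finset.mem_range.1 hj), zero_add]
      have h3 : t j ^ 2 + s ≠ 0 := by positivity
      apply le_of_eq
      field_simp
      ring
  refine (Finset.sum_le_sum key).trans ?_
  rw [Finset.sum_add_distrib]
  simp only [Finset.sum_ite_eq', Finset.mem_range, add_le_add_iff_right]
  split_ifs
  · exact le_rfl
  · exact hs0.le

/-- All candidates contain the first `l` coordinates, so these have factor `1` and cost `s` each,
however small their coefficients. The remaining coordinates cost at least the ideal amount. -/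
theorem NestedBasis.le_maRisk_Icc (h : NestedBasis X ψ) (hn : 1 ≤ n) (hf : HasCoords p ψ f t)
    (hσ : 0 < σ) {l u : ℕ} (hl : 1 ≤ l) (hlu : l ≤ u) (hu : u ≤ p) {w : ℕ → ℝ}
    (hw : w ∈ weightSet (Finset.Icc l u)) :
    l * (σ ^ 2 / n) + ∑ j ∈ Finset.Ico l p, t j ^ 2 * (σ ^ 2 / n) / (t j ^ 2 + σ ^ 2 / n)
      ≤ maRisk X f σ (Finset.Icc l u) w := by
  have hn' : (0 : ℝ) < n := by exact_mod_cast hn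
  rw [h.maRisk_eq hn hf σ (Finset.Icc_subset_Icc hl hu), sum_range_split le_rfl (hlu.trans hu)]
  simp only [Finset.Ico_self, Finset.sum_empty, add_zero]
  refine add_le_add (le_of_eq ?_)
    (Finset.sum_le_sum fun j _ => shrinkage_lower (sq_nonneg _) (by positivity) _)
  rw [Finset.sum_congr rfl (g := fun _ => σ ^ 2 / n)]
  · simp
  · intro j hj
    rw [tailWeight_eq_one hw]
    · ring
    · intro k hk
      exact (Finset.mem_range.1 hj).trans_le (Finset.mem_Icc.1 hk).1

/-- The bias left in the window by the MMA weights. -/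
theorem NestedBasis.mma_window (h : NestedBasis X ψ) (hn : 1 ≤ n) (hf : HasCoords p ψ f t)
    {l u : ℕ} (hl : 1 ≤ l) (hlu : l ≤ u) (hu : u ≤ p) {w : ℕ → ℝ} {v σ : ℝ}
    {ε : Fin n → ℝ} (hw : IsMMAWeight X (Finset.Icc l u) v (f + ε) w) :
    ∑ j ∈ Finset.Ico l u, (1 - tailWeight (Finset.Icc l u) w j) ^ 2 * t j ^ 2
      ≤ 2 * ∑ j ∈ Finset.Ico l u, (ψ j ⬝ᵥ ε) ^ 2 / n
        + 4 * ((σ ^ 2 + |v - σ ^ 2|) / n) * ((u : ℝ) - l) := by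
  have hn' : (0 : ℝ) < n := by exact_mod_cast hn
  set K := Finset.Icc l u
  have hK : K ⊆ Finset.Icc 1 p := Finset.Icc_subset_Icc hl hu
  have huK : u ∈ K := Finset.mem_Icc.2 ⟨hlu, le_rfl⟩
  -- The competitor is the largest model of the window: it has no bias on `[l, u)`, and outside the
  -- window all candidate weights have the same factors, so only the window terms survive.
  have h1 := hw.2 _ (single_mem_weightSet huK)
  rw [h.mmaCriterion_eq hn hf hK, h.mmaCriterion_eq hn hf hK, add_le_add_iff_left,
    sum_range_split hlu hu, sum_range_split hlu hu] at h1
  have hA : ∀ w' ∈ weightSet K, ∀ j ∈ Finset.range l, tailWeight K w' j = 1 :=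
    fun w' hw' j hj => tailWeight_eq_one hw' fun k hk =>
      (Finset.mem_range.1 hj).trans_le (Finset.mem_Icc.1 hk).1
  have hB : ∀ w' : ℕ → ℝ, ∀ j ∈ Finset.Ico u p, tailWeight K w' j = 0 :=
    fun w' j hj => tailWeight_eq_zero w' fun k hk =>
      (Finset.mem_Icc.1 hk).2.trans (Finset.mem_Ico.1 hj).1
  rw [Finset.sum_congr rfl fun j hj => by rw [hA w hw.1 j hj],
    Finset.sum_congr (s₁ := Finset.Ico u p) rfl fun j hj => by rw [hB w j hj],
    Finset.sum_congr (s₁ := Finset.range l) (f := fun j =>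
      (1 - tailWeight K (Pi.single u 1) j) ^ 2 * (t j + (ψ j ⬝ᵥ ε) / Real.sqrt n) ^ 2
            + 2 * v / n * tailWeight K (Pi.single u 1) j) rfl
      fun j hj => by rw [hA _ (single_mem_weightSet huK) j hj],
    Finset.sum_congr (s₁ := Finset.Ico u p) (f := fun j =>
      (1 - tailWeight K (Pi.single u 1) j) ^ 2 * (t j + (ψ j ⬝ᵥ ε) / Real.sqrt n) ^ 2
            + 2 * v / n * tailWeight K (Pi.single u 1) j) rfl fun j hj => by rw [hB _ j hj],
    add_le_add_iff_right, add_le_add_iff_left] at h1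
  have hcrit : ∑ j ∈ Finset.Ico l u,
      (1 - tailWeight K w j) ^ 2 * (t j + (ψ j ⬝ᵥ ε) / Real.sqrt n) ^ 2
      ≤ 2 * ((σ ^ 2 + |v - σ ^ 2|) / n) * ((u : ℝ) - l) := by
    have h2 : ∀ j ∈ Finset.Ico l u,
        (1 - tailWeight K (Pi.single u 1) j) ^ 2 * (t j + (ψ j ⬝ᵥ ε) / Real.sqrt n) ^ 2
            + 2 * v / n * tailWeight K (Pi.single u 1) j = 2 * v / n := by
      intro j hj
      rw [tailWeight_single huK, if_pos (Finset.mem_Ico.1 hj).2]; ring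
    rw [Finset.sum_congr rfl h2] at h1
    have h3 : ∀ j ∈ Finset.Ico l u, 2 * v / n * (1 - tailWeight K w j)
        ≤ 2 * ((σ ^ 2 + |v - σ ^ 2|) / n) := by
      intro j _
      have hg0 := tailWeight_nonneg hw.1 j
      have hg1 := tailWeight_le_one hw.1 j
      have hv : v ≤ σ ^ 2 + |v - σ ^ 2| := by linarith [le_abs_self (v - σ ^ 2)]
      have hb : 0 ≤ σ ^ 2 + |v - σ ^ 2| := by positivity
      have : v * (1 - tailWeight K w j) ≤ σ ^ 2 + |v - σ ^ 2| := by nlinarith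
      calc 2 * v / n * (1 - tailWeight K w j) = 2 * (v * (1 - tailWeight K w j) / n) := by ring
        _ ≤ _ := by gcongr
    have h4 := Finset.sum_le_sum h3
    simp only [Finset.sum_const, Nat.card_Ico, nsmul_eq_mul, Nat.cast_sub hlu] at h4 h1
    simp only [mul_sub, mul_one, Finset.sum_sub_distrib, Finset.sum_const, Nat.card_Ico,
      nsmul_eq_mul, Nat.cast_sub hlu] at h4
    rw [Finset.sum_add_distrib] at h1
    linarith
  have h5 : ∀ j ∈ Finset.Ico l u, (1 - tailWeight K w j) ^ 2 * t j ^ 2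
      ≤ 2 * ((1 - tailWeight K w j) ^ 2 * (t j + (ψ j ⬝ᵥ ε) / Real.sqrt n) ^ 2)
        + 2 * ((ψ j ⬝ᵥ ε) ^ 2 / n) := by
    intro j _
    have hg0 := tailWeight_nonneg hw.1 j
    have hg1 := tailWeight_le_one hw.1 j
    have he : (ψ j ⬝ᵥ ε) ^ 2 / n = ((ψ j ⬝ᵥ ε) / Real.sqrt n) ^ 2 := by
      rw [div_pow, Real.sq_sqrt hn'.le]
    rw [he]
    set e := (ψ j ⬝ᵥ ε) / Real.sqrt n
    have hg : (1 - tailWeight K w j) ^ 2 ≤ 1 := by nlinarith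
    -- The criterion controls the observed coefficient `t j + e`; this trades it for the true one at
    -- the price of the noise.
    have h6 : t j ^ 2 ≤ 2 * (t j + e) ^ 2 + 2 * e ^ 2 := by nlinarith [sq_nonneg (t j + 2 * e)]
    nlinarith [sq_nonneg (1 - tailWeight K w j), sq_nonneg e]
  have h6 := Finset.sum_le_sum h5
  rw [Finset.sum_add_distrib, ← Finset.mul_sum, ← Finset.mul_sum] at h6
  linarith

/-- Factor `1` leaves pure noise below `l` and factor `0` leaves pure bias above `u`. In the window
the loss is at most twice the noise plus twice the bias bounded by `mma_window`, whence the
constants `6 = 2 + 2 · 2` and `8 = 2 · 4`. -/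
theorem NestedBasis.maLoss_mma_le (h : NestedBasis X ψ) (hn : 1 ≤ n) (hf : HasCoords p ψ f t)
    {l u : ℕ} (hl : 1 ≤ l) (hlu : l ≤ u) (hu : u ≤ p) {w : ℕ → ℝ} {v : ℝ} (σ : ℝ)
    {ε : Fin n → ℝ} (hw : IsMMAWeight X (Finset.Icc l u) v (f + ε) w) :
    maLoss X f (Finset.Icc l u) w (f + ε)
      ≤ ∑ j ∈ Finset.range l, (ψ j ⬝ᵥ ε) ^ 2 / n + ∑ j ∈ Finset.Ico u p, t j ^ 2
        + 6 * ∑ j ∈ Finset.Ico l u, (ψ j ⬝ᵥ ε) ^ 2 / n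
        + 8 * ((σ ^ 2 + |v - σ ^ 2|) / n) * ((u : ℝ) - l) := by
  have hn' : (0 : ℝ) < n := by exact_mod_cast hn
  have hwin := h.mma_window hn hf hl hlu hu hw (σ := σ)
  rw [h.maLoss_eq hn hf (Finset.Icc_subset_Icc hl hu), sum_range_split hlu hu]
  set K := Finset.Icc l u
  have he : ∀ j, (ψ j ⬝ᵥ ε) ^ 2 / n = ((ψ j ⬝ᵥ ε) / Real.sqrt n) ^ 2 := fun j => by
    rw [div_pow, Real.sq_sqrt hn'.le]
  have hA : ∀ j ∈ Finset.range l,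
      (tailWeight K w j * (t j + (ψ j ⬝ᵥ ε) / Real.sqrt n) - t j) ^ 2 = (ψ j ⬝ᵥ ε) ^ 2 / n := by
    intro j hj
    rw [tailWeight_eq_one hw.1 fun k hk =>
      (Finset.mem_range.1 hj).trans_le (Finset.mem_Icc.1 hk).1, he]
    ring
  have hB : ∀ j ∈ Finset.Ico u p,
      (tailWeight K w j * (t j + (ψ j ⬝ᵥ ε) / Real.sqrt n) - t j) ^ 2 = t j ^ 2 := by
    intro j hj
    rw [tailWeight_eq_zero w fun k hk =>
      (Finset.mem_Icc.1 hk).2.trans (Finset.mem_Ico.1 hj).1]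
    ring
  have hC : ∀ j ∈ Finset.Ico l u,
      (tailWeight K w j * (t j + (ψ j ⬝ᵥ ε) / Real.sqrt n) - t j) ^ 2
        ≤ 2 * ((ψ j ⬝ᵥ ε) ^ 2 / n) + 2 * ((1 - tailWeight K w j) ^ 2 * t j ^ 2) := by
    intro j _
    have hg0 := tailWeight_nonneg hw.1 j
    have hg1 := tailWeight_le_one hw.1 j
    rw [he]
    set e := (ψ j ⬝ᵥ ε) / Real.sqrt n
    set g := tailWeight K w j
    have h1 : (g * (t j + e) - t j) ^ 2 ≤ 2 * (g * e) ^ 2 + 2 * ((1 - g) * t j) ^ 2 := by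
      nlinarith [sq_nonneg (g * e + (1 - g) * t j)]
    have h2 : (g * e) ^ 2 ≤ e ^ 2 := by
      have : g ^ 2 ≤ 1 := by nlinarith
      rw [mul_pow]; nlinarith [sq_nonneg e]
    nlinarith
  have hC' := Finset.sum_le_sum hC
  rw [Finset.sum_add_distrib, ← Finset.mul_sum, ← Finset.mul_sum] at hC'
  rw [Finset.sum_congr rfl hA, Finset.sum_congr rfl hB]
  linarith

theorem NestedBasis.maRisk_mma_le (h : NestedBasis X ψ) (hn : 1 ≤ n) (hf : HasCoords p ψ f t)
    {l u : ℕ} (hl : 1 ≤ l) (hlu : l ≤ u) (hu : u ≤ p) {w : ℕ → ℝ} {v : ℝ} (σ : ℝ)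
    {ε : Fin n → ℝ} (hw : IsMMAWeight X (Finset.Icc l u) v (f + ε) w) :
    maRisk X f σ (Finset.Icc l u) w
      ≤ l * (σ ^ 2 / n) + ∑ j ∈ Finset.Ico u p, t j ^ 2
        + 2 * ∑ j ∈ Finset.Ico l u, (ψ j ⬝ᵥ ε) ^ 2 / n
        + 5 * ((σ ^ 2 + |v - σ ^ 2|) / n) * ((u : ℝ) - l) := by
  have hn' : (0 : ℝ) < n := by exact_mod_cast hn
  have hwin := h.mma_window hn hf hl hlu hu hw (σ := σ)
  rw [h.maRisk_eq hn hf σ (Finset.Icc_subset_Icc hl hu), sum_range_split hlu hu]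
  set K := Finset.Icc l u
  have hA : ∀ j ∈ Finset.range l, (1 - tailWeight K w j) ^ 2 * t j ^ 2
      + σ ^ 2 / n * tailWeight K w j ^ 2 = σ ^ 2 / n := by
    intro j hj
    rw [tailWeight_eq_one hw.1 fun k hk =>
      (Finset.mem_range.1 hj).trans_le (Finset.mem_Icc.1 hk).1]
    ring
  have hB : ∀ j ∈ Finset.Ico u p, (1 - tailWeight K w j) ^ 2 * t j ^ 2
      + σ ^ 2 / n * tailWeight K w j ^ 2 = t j ^ 2 := by
    intro j hj
    rw [tailWeight_eq_zero w fun k hk =>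
      (Finset.mem_Icc.1 hk).2.trans (Finset.mem_Ico.1 hj).1]
    ring
  have hC : ∀ j ∈ Finset.Ico l u, (1 - tailWeight K w j) ^ 2 * t j ^ 2
      + σ ^ 2 / n * tailWeight K w j ^ 2
        ≤ (1 - tailWeight K w j) ^ 2 * t j ^ 2 + (σ ^ 2 + |v - σ ^ 2|) / n := by
    intro j _
    have hg0 := tailWeight_nonneg hw.1 j
    have hg1 := tailWeight_le_one hw.1 j
    have h1 : tailWeight K w j ^ 2 ≤ 1 := by nlinarith
    have h2 : σ ^ 2 / n ≤ (σ ^ 2 + |v - σ ^ 2|) / n := by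
      gcongr; linarith [abs_nonneg (v - σ ^ 2)]
    have h3 : 0 ≤ σ ^ 2 / n := by positivity
    nlinarith
  have hC' := Finset.sum_le_sum hC
  rw [Finset.sum_congr rfl hA, Finset.sum_congr rfl hB]
  simp only [Finset.sum_add_distrib, Finset.sum_const, Nat.card_Ico, nsmul_eq_mul,
    Nat.cast_sub hlu, Finset.card_range] at hC' ⊢
  linarith

end Risk

/-! ### Tails and ratios of ordered sequences under slow and fast decay. -/

section Decay

variable {A : ℕ → ℝ}

theorem le_of_ordered (hA : ∀ j, 1 ≤ j → 0 < A j ∧ A (j + 1) ≤ A j) {i j : ℕ} (hi : 1 ≤ i)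
    (hij : i ≤ j) : A j ≤ A i := by
  induction j, hij using Nat.le_induction with
  | base => exact le_rfl
  | succ j hj ih => exact (hA j (hi.trans hj)).2.trans ih

/-- The sum is cut into blocks `[a, ⌊κ a⌋)`. Each block is at most its length times its first term,
and passing to the next block multiplies this bound by at most `κ q < 1`, so the blocks are
dominated by a geometric series. -/
theorem tail_sum_le (hA : ∀ j, 1 ≤ j → 0 < A j ∧ A (j + 1) ≤ A j) {κ q : ℝ} (hκ : 1 < κ)
    (hq : 0 ≤ q) (hκq : κ * q < 1) {L : ℕ} (hL1 : 1 ≤ L) (hL : 1 ≤ (κ - 1) * L)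
    (hdec : ∀ l, L ≤ l → A ⌊κ * l⌋₊ ≤ q * A l) (b a : ℕ) (ha : L ≤ a) :
    ∑ j ∈ Finset.Ico a b, A j ≤ (κ - 1) / (1 - κ * q) * a * A a := by
  induction hd : b - a using Nat.strong_induction_on generalizing a with
  | _ d ih =>
  have ha1 : 1 ≤ a := hL1.trans ha
  have haL : (L : ℝ) ≤ a := by exact_mod_cast ha
  have hA0 : 0 < A a := (hA a ha1).1
  have hden : 0 < 1 - κ * q := by linarith
  set B := (κ - 1) / (1 - κ * q) with hB
  have hB' : B * (1 - κ * q) = κ - 1 := by rw [hB]; field_simp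
  have hB0 : 0 < B := div_pos (by linarith) hden
  have hκa0 : 0 ≤ κ * a := by positivity
  set c := ⌊κ * a⌋₊ with hc
  have hcle : (c : ℝ) ≤ κ * a := Nat.floor_le hκa0
  have hac : a + 1 ≤ c := by
    apply Nat.le_floor
    push_cast
    nlinarith
  have hblock : ∀ e, e ≤ c → ∑ j ∈ Finset.Ico a e, A j ≤ (κ - 1) * a * A a := by
    intro e he
    rcases le_or_gt e a with h | h
    · rw [Finset.Ico_eq_empty_of_le h, Finset.sum_empty]
      have : 0 ≤ κ - 1 := by linarith
      positivity
    · have h1 : ∑ j ∈ Finset.Ico a e, A j ≤ ∑ _j ∈ Finset.Ico a e, A a :=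
        Finset.sum_le_sum fun j hj => le_of_ordered hA ha1 (Finset.mem_Ico.1 hj).1
      refine h1.trans ?_
      rw [Finset.sum_const, Nat.card_Ico, nsmul_eq_mul, Nat.cast_sub h.le]
      have : (e : ℝ) ≤ c := by exact_mod_cast he
      gcongr
      linarith
  rcases le_or_gt b c with hbc | hbc
  · refine (hblock b hbc).trans ?_
    have : κ - 1 ≤ B := by rw [← hB']; nlinarith [mul_nonneg (by linarith : (0:ℝ) ≤ κ) hq]
    gcongr
  · rw [← Finset.sum_Ico_consecutive A (by omega : a ≤ c) hbc.le]
    have h1 := hblock c le_rfl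
    have h2 := ih (b - c) (by omega) c (by omega) rfl
    have h3 := hdec a ha
    have h4 : B * c * A c ≤ B * (κ * a) * (q * A a) := by
      have : 0 ≤ A c := (hA c (by omega)).1.le
      gcongr
    have h5 : (κ - 1) * a * A a + B * (κ * a) * (q * A a) = B * a * A a := by
      rw [← hB']; ring
    linarith

theorem FastDecay.eventually_sq_le {θ : ℕ → ℝ} (h : FastDecay θ)
    (hθ : ∀ j, 1 ≤ j → 0 < θ j ^ 2) {κ q : ℝ} (hκ : 1 < κ) (hq : 0 < q) :
    ∀ᶠ l : ℕ in atTop, θ ⌊κ * l⌋₊ ^ 2 ≤ q * θ l ^ 2 := by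
  have h1 := (h κ hκ).eventually_le_const (Real.sqrt_pos.2 hq)
  filter_upwards [h1, eventually_ge_atTop 1] with l hl hl1
  have h2 : |θ ⌊κ * l⌋₊ / θ l| ^ 2 ≤ q := by
    rw [← Real.sq_sqrt hq.le]
    exact pow_le_pow_left₀ (abs_nonneg _) hl 2
  rwa [sq_abs, div_pow, div_le_iff₀ (hθ l hl1)] at h2

/-- Most of the leading coefficients are much larger than the last one. -/
theorem exists_many_large (hA : ∀ j, 1 ≤ j → 0 < A j ∧ A (j + 1) ≤ A j)
    (hfast : ∀ κ q : ℝ, 1 < κ → 0 < q → ∀ᶠ l : ℕ in atTop, A ⌊κ * l⌋₊ ≤ q * A l)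
    {δ G : ℝ} (hδ : 0 < δ) (hδ1 : δ < 1) (hG : 0 < G) :
    ∃ M : ℕ, ∀ m, M ≤ m → ∃ k ≤ m, (m : ℝ) - k ≤ δ * m ∧
      ∀ s ≤ A m, ∀ j, 1 ≤ j → j ≤ k → G * s ≤ A j := by
  -- With this `κ`, every `j ≤ (1 - δ / 2) m` has `κ j ≤ m`, so `A m` lies at least one decay step
  -- below `A j`. The other half of `δ` absorbs the floor.
  set κ := (1 - δ / 2)⁻¹ with hκ
  have h0 : 0 < 1 - δ / 2 := by linarith
  have hκ1 : 1 < κ := one_lt_inv₀ h0 |>.2 (by linarith)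
  obtain ⟨L, hL⟩ := eventually_atTop.1 (hfast κ G⁻¹ hκ1 (by positivity))
  obtain ⟨M, hM⟩ := exists_nat_ge (κ * (L + 1) + 2 / δ)
  refine ⟨M, fun m hm => ⟨⌊(1 - δ / 2) * m⌋₊, ?_, ?_, ?_⟩⟩
  · apply Nat.floor_le_of_le
    nlinarith [Nat.cast_nonneg (α := ℝ) m]
  · have h1 := Nat.lt_floor_add_one ((1 - δ / 2) * m)
    have h2 : 2 / δ ≤ m := by
      have : (M : ℝ) ≤ m := by exact_mod_cast hm
      have : 0 ≤ κ * (L + 1) := by positivity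
      linarith
    rw [div_le_iff₀ hδ] at h2
    linarith
  · intro s hs j hj hjk
    have hjk' : (j : ℝ) ≤ (1 - δ / 2) * m := (Nat.le_floor_iff (by positivity)).1 hjk
    -- The decay is known only from `L` on; smaller indices are compared with `L + 1` by
    -- monotonicity.
    set j' := max j (L + 1) with hj'
    have h1 : A j' ≤ A j := le_of_ordered hA hj (le_max_left _ _)
    have h2 := hL j' (by omega)
    have hκj : κ * j' ≤ m := by
      rcases le_total j (L + 1) with h | h
      · rw [hj', max_eq_right h]
        have : (M : ℝ) ≤ m := by exact_mod_cast hm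
        have : 0 < 2 / δ := by positivity
        push_cast; linarith
      · rw [hj', max_eq_left h, hκ, inv_mul_le_iff₀ h0]; exact hjk'
    have hj1 : 1 ≤ j' := by omega
    have h3 : A m ≤ A ⌊κ * j'⌋₊ := by
      refine le_of_ordered hA ?_ ?_
      · apply Nat.le_floor
        have : (1 : ℝ) ≤ j' := by exact_mod_cast hj1
        push_cast; nlinarith
      · exact Nat.floor_le_of_le hκj
    have h4 : s ≤ G⁻¹ * A j := by
      have : G⁻¹ * A j' ≤ G⁻¹ * A j := by gcongr
      linarith
    rwa [← div_eq_inv_mul, le_div_iff₀ hG, mul_comm] at h4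

/-- The tail beyond the noise level is negligible. -/
theorem exists_tail_small (hA : ∀ j, 1 ≤ j → 0 < A j ∧ A (j + 1) ≤ A j)
    (hfast : ∀ κ q : ℝ, 1 < κ → 0 < q → ∀ᶠ l : ℕ in atTop, A ⌊κ * l⌋₊ ≤ q * A l)
    {δ : ℝ} (hδ : 0 < δ) :
    ∃ M : ℕ, ∀ m, M ≤ m → ∀ p (s : ℝ), 0 ≤ s → (m < p → A (m + 1) ≤ s) →
      ∑ j ∈ Finset.Ico (m + 1) (p + 1), A j ≤ δ * (m * s) := by
  -- With `κ q = 1 / 2` the constant of `tail_sum_le` is `δ / 2`; the bound `m + 1 ≤ 2 m` uses up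
  -- the remaining factor `2`.
  set κ := 1 + δ / 4 with hκ
  have hκ1 : 1 < κ := by linarith
  set q := (2 * κ)⁻¹ with hq
  have hκ0 : 0 < κ := by linarith
  have hq0 : 0 < q := by positivity
  have hκq : κ * q = 1 / 2 := by rw [hq]; field_simp
  obtain ⟨L, hL⟩ := eventually_atTop.1 (hfast κ q hκ1 hq0)
  obtain ⟨M, hM⟩ := exists_nat_ge (4 / δ)
  refine ⟨max (max L 1) M, fun m hm p s hs hmp => ?_⟩
  rcases le_or_gt p m with h | h
  · rw [Finset.Ico_eq_empty_of_le (by omega), Finset.sum_empty]; positivity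
  have h4 : 1 ≤ (κ - 1) * (max (max L 1) M : ℕ) := by
    have h5 : (M : ℝ) ≤ (max (max L 1) M : ℕ) := by exact_mod_cast le_max_right _ _
    have h6 := hM.trans h5
    rw [div_le_iff₀ hδ] at h6
    rw [hκ]; linarith
  have h1 := tail_sum_le hA hκ1 hq0.le (by rw [hκq]; norm_num) (L := max (max L 1) M)
    (by omega) h4 (fun l hl => hL l (by omega)) (p + 1) (m + 1) (by omega)
  have h2 := hmp h
  have hm1 : (1 : ℝ) ≤ m := by exact_mod_cast (by omega : 1 ≤ m)
  have h3 : (κ - 1) / (1 - κ * q) = δ / 2 := by rw [hκq, hκ]; ring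
  rw [h3] at h1
  refine h1.trans ?_
  push_cast
  calc δ / 2 * ((m : ℝ) + 1) * A (m + 1) ≤ δ / 2 * (m + m) * s := by
        have := (hA (m + 1) (by omega)).1.le
        gcongr
    _ = _ := by ring

/-- Each step `l ↦ ⌊κ l⌋` loses at most the factor `q`, and a number of steps depending only on `C`
and `κ` leads from `j` past `C j`. -/
theorem exists_comparable (hA : ∀ j, 1 ≤ j → 0 < A j ∧ A (j + 1) ≤ A j) {κ q : ℝ} (hκ : 1 < κ)
    (hq : 0 < q) (hslow : ∀ᶠ l : ℕ in atTop, q * A l ≤ A ⌊κ * l⌋₊) (C : ℝ) :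
    ∃ D : ℝ, 0 < D ∧ ∃ L : ℕ, ∀ j, L ≤ j → ∀ m : ℕ, 1 ≤ m → (m : ℝ) ≤ C * j → A j ≤ D * A m := by
  -- A ratio strictly between `1` and `κ`, so that `κ' l ≤ ⌊κ l⌋` for large `l` and the floors do
  -- not accumulate.
  set κ' := (1 + κ) / 2 with hκ'
  obtain ⟨L₀, hL₀⟩ := eventually_atTop.1 hslow
  obtain ⟨M, hM⟩ := exists_nat_ge (2 / (κ - 1))
  set L := max (max L₀ 1) M with hL
  have hstep : ∀ l : ℕ, L ≤ l → κ' * l ≤ (⌊κ * l⌋₊ : ℝ) := by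
    intro l hl
    have h1 := Nat.lt_floor_add_one (κ * l)
    have h2 : (M : ℝ) ≤ l := by exact_mod_cast (by omega : M ≤ l)
    have h3 := hM.trans h2
    rw [div_le_iff₀ (by linarith)] at h3
    rw [hκ']; linarith
  have hiter : ∀ N j : ℕ, L ≤ j → ∃ j', j ≤ j' ∧ κ' ^ N * j ≤ j' ∧ q ^ N * A j ≤ A j' := by
    intro N j hj
    induction N with
    | zero => exact ⟨j, le_rfl, by simp, by simp⟩
    | succ N ih =>
      obtain ⟨j', h1, h2, h3⟩ := ih
      have h4 := hstep j' (hj.trans h1)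
      have h5 : κ' ^ (N + 1) * j ≤ ⌊κ * j'⌋₊ := by
        refine le_trans ?_ h4
        rw [pow_succ, mul_comm _ κ', mul_assoc]
        gcongr
      refine ⟨⌊κ * j'⌋₊, ?_, h5, ?_⟩
      · have : (j' : ℝ) ≤ (⌊κ * j'⌋₊ : ℝ) := by
          refine le_trans ?_ h4
          have : (1 : ℝ) ≤ κ' := by rw [hκ']; linarith
          nlinarith [Nat.cast_nonneg (α := ℝ) j']
        exact h1.trans (by exact_mod_cast this)
      · refine le_trans ?_ (hL₀ j' (by omega))
        rw [pow_succ, mul_comm _ q, mul_assoc]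
        gcongr
  obtain ⟨N, hN⟩ := pow_unbounded_of_one_lt C (by rw [hκ']; linarith : 1 < κ')
  refine ⟨(q ^ N)⁻¹, by positivity, L, fun j hj m hm hmj => ?_⟩
  obtain ⟨j', h1, h2, h3⟩ := hiter N j hj
  have h4 : m ≤ j' := by
    have : (m : ℝ) ≤ j' := by
      refine hmj.trans (le_trans ?_ h2)
      gcongr
    exact_mod_cast this
  have h5 := le_of_ordered hA hm h4
  rw [← div_eq_inv_mul, le_div_iff₀ (by positivity), mul_comm]
  linarith

end Decay

/-! ### The optimal size is where the squared coefficients cross the noise level. -/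

section OptSize

variable {n p : ℕ} {X : Matrix (Fin n) (Fin p) ℝ} {ψ : ℕ → Fin n → ℝ} {f : Fin n → ℝ}
  {t : ℕ → ℝ} {σ : ℝ} {m : ℕ}

/-- Adding the next coordinate changes the risk by `σ² / n - t m ^ 2`, which optimality forbids to
be negative. -/
theorem NestedBasis.sq_le_of_isOptSize (h : NestedBasis X ψ) (hn : 1 ≤ n)
    (hf : HasCoords p ψ f t) (hm : IsOptSize X f σ m) (hmp : m < p) : t m ^ 2 ≤ σ ^ 2 / n := by
  have h1 := hm.2 (m + 1) (Finset.mem_Icc.2 (by omega))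
  rw [h.msRisk_eq hn hf σ hm.1, h.msRisk_eq hn hf σ (Finset.mem_Icc.2 (by omega)),
    Finset.sum_eq_sum_Ico_succ_bot hmp] at h1
  push_cast at h1
  linarith

theorem NestedBasis.le_sq_of_isOptSize (h : NestedBasis X ψ) (hn : 1 ≤ n)
    (hf : HasCoords p ψ f t) (hm : IsOptSize X f σ (m + 1)) (hm1 : 1 ≤ m) :
    σ ^ 2 / n ≤ t m ^ 2 := by
  have hmp := (Finset.mem_Icc.1 hm.1).2
  have h1 := hm.2 m (Finset.mem_Icc.2 (by omega))
  rw [h.msRisk_eq hn hf σ hm.1, h.msRisk_eq hn hf σ (Finset.mem_Icc.2 (by omega)),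
    Finset.sum_eq_sum_Ico_succ_bot (show m < p by omega)] at h1
  push_cast at h1
  linarith

end OptSize

/-! ### Candidate windows, integrability of the risk, and the slow decay bound. -/

theorem candidates_bounds {p m : ℕ} {κl κu : ℝ} (hκl : 1 < κl) (hκu : 1 < κu)
    (hm : m ∈ Finset.Icc 1 p) :
    1 ≤ lowerSize κl m ∧ lowerSize κl m ≤ m ∧ m ≤ upperSize p κu m ∧ upperSize p κu m ≤ p := by
  have hm' := Finset.mem_Icc.1 hm
  refine ⟨le_max_left _ _, max_le hm'.1 ?_, le_min hm'.2 ?_, min_le_left _ _⟩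
  · apply Nat.floor_le_of_le
    have : κl⁻¹ ≤ 1 := inv_le_one_of_one_le₀ hκl.le
    nlinarith [Nat.cast_nonneg (α := ℝ) m]
  · apply Nat.le_floor
    nlinarith [Nat.cast_nonneg (α := ℝ) m]

theorem measurable_tailWeight (K : Finset ℕ) (j : ℕ) :
    Measurable fun w : ℕ → ℝ => tailWeight K w j :=
  Finset.measurable_fun_sum _ fun k _ => measurable_pi_apply k

/-- Needed for the lower bound only: the integral of a non-integrable risk would be `0` by
convention, and a pointwise lower bound would then say nothing. -/
theorem NestedBasis.integrable_maRisk {n p : ℕ} {X : Matrix (Fin n) (Fin p) ℝ}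
    {ψ : ℕ → Fin n → ℝ} {f : Fin n → ℝ} {t : ℕ → ℝ} (h : NestedBasis X ψ) (hn : 1 ≤ n)
    (hf : HasCoords p ψ f t) (σ : ℝ) {K : Finset ℕ} (hK : K ⊆ Finset.Icc 1 p)
    {Ω : Type*} [MeasurableSpace Ω] (μ : Measure Ω) [IsProbabilityMeasure μ] {w : Ω → ℕ → ℝ}
    (hwm : Measurable w) (hw : ∀ ω, w ω ∈ weightSet K) :
    Integrable (fun ω => maRisk X f σ K (w ω)) μ := by
  have hmeas : ∀ j, Measurable fun ω => tailWeight K (w ω) j := fun j =>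
    (measurable_tailWeight K j).comp hwm
  refine Integrable.of_bound (C := ∑ j ∈ Finset.range p, (t j ^ 2 + σ ^ 2 / n)) ?_ ?_
  · simp_rw [h.maRisk_eq hn hf σ hK]
    exact (by fun_prop : Measurable _).aestronglyMeasurable
  · refine Eventually.of_forall fun ω => ?_
    rw [Real.norm_of_nonneg (maRisk_nonneg _ _ _ _ _), h.maRisk_eq hn hf σ hK]
    refine Finset.sum_le_sum fun j _ => ?_
    have h0 := tailWeight_nonneg (hw ω) j
    have h1 := tailWeight_le_one (hw ω) j
    have h2 : (1 - tailWeight K (w ω) j) ^ 2 ≤ 1 := by nlinarith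
    have h3 : tailWeight K (w ω) j ^ 2 ≤ 1 := by nlinarith
    have h4 : 0 ≤ σ ^ 2 / n := by positivity
    nlinarith [sq_nonneg (t j)]

-- The weights enter only through their membership in the simplex: the bound holds for every weight
-- vector on the window, since the loss comes from the smallest candidate being too large.
set_option maxHeartbeats 1000000 in
theorem slow_decay_lower_bound
    {Ω : Type*} [MeasurableSpace Ω] (μ : Measure Ω) [IsProbabilityMeasure μ]
    (p : ℕ → ℕ) (hp_pos : ∀ n, 1 ≤ n → 1 ≤ p n)
    (X : (n : ℕ) → Matrix (Fin n) (Fin (p n)) ℝ) (f : (n : ℕ) → Fin n → ℝ)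
    (σ : ℝ) (hσ : 0 < σ) (θ : ℕ → ℝ) (hθ_ord : ∀ j, 1 ≤ j → 0 < |θ j| ∧ |θ (j + 1)| ≤ |θ j|)
    (ψ : (n : ℕ) → ℕ → Fin n → ℝ) (hψ : ∀ n, NestedBasis (X n) (ψ n))
    (hf : ∀ n, 1 ≤ n → HasCoords (p n) (ψ n) (f n) fun j => θ (j + 1))
    (mstar : ℕ → ℕ) (hmstar : ∀ n, 1 ≤ n → IsOptSize (X n) (f n) σ (mstar n))
    (κl κu : ℕ → ℝ) (hκl : ∀ n, 1 < κl n) (hκu : ∀ n, 1 < κu n)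
    (C : ℝ) (hC : ∀ n, κl n ≤ C)
    (w : (n : ℕ) → Ω → ℕ → ℝ) (hwm : ∀ n, Measurable (w n))
    (hw : ∀ n, 1 ≤ n → ∀ ω,
      w n ω ∈ weightSet (msCandidates (p n) (κl n) (κu n) (mstar n)))
    (hslow : SlowDecay θ) (hlast : ∀ᶠ n : ℕ in atTop, θ (p n + 1) ^ 2 ≤ σ ^ 2 / n) :
    ∃ c : ℝ, 0 < c ∧ ∀ᶠ n : ℕ in atTop,
      c * fullOptRisk (X n) (f n) σ ≤
        (∫ ω, maRisk (X n) (f n) σ (msCandidates (p n) (κl n) (κu n) (mstar n)) (w n ω) ∂μ)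
          - fullOptRisk (X n) (f n) σ := by
  have hA : ∀ j, 1 ≤ j → 0 < θ j ^ 2 ∧ θ (j + 1) ^ 2 ≤ θ j ^ 2 := fun j hj => by
    obtain ⟨h1, h2⟩ := hθ_ord j hj
    exact ⟨by rw [← sq_abs]; positivity, sq_le_sq.2 h2⟩
  obtain ⟨κ, δ, ν, hκ, hδ, hδν, hν, hκν, hdec⟩ := hslow
  have hν0 : 0 < ν := hδ.trans_le hδν
  have hdec' : ∀ᶠ l : ℕ in atTop, δ ^ 2 * θ l ^ 2 ≤ θ ⌊κ * l⌋₊ ^ 2 ∧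
      θ ⌊κ * l⌋₊ ^ 2 ≤ ν ^ 2 * θ l ^ 2 := by
    filter_upwards [hdec, eventually_ge_atTop 1] with l hl hl1
    have hpos := (hA l hl1).1
    have e : |θ ⌊κ * l⌋₊ / θ l| ^ 2 = θ ⌊κ * l⌋₊ ^ 2 / θ l ^ 2 := by rw [sq_abs, div_pow]
    have h1 := pow_le_pow_left₀ hδ.le hl.1 2
    have h2 := pow_le_pow_left₀ (abs_nonneg _) hl.2 2
    rw [e] at h1 h2
    exact ⟨(le_div_iff₀ hpos).1 h1, (div_le_iff₀ hpos).1 h2⟩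
  have hC1 : 1 < C := (hκl 0).trans_le (hC 0)
  obtain ⟨D, hD, L₁, hcomp⟩ := exists_comparable (A := fun j => θ j ^ 2) hA hκ (pow_pos hδ 2)
    (hdec'.mono fun _ h => h.1) (8 * C)
  obtain ⟨L₂, hL₂⟩ := eventually_atTop.1 hdec'
  obtain ⟨L₃, hL₃⟩ := exists_nat_ge (1 / (κ - 1))
  set B := (κ - 1) / (1 - κ * ν ^ 2) with hB
  have hB0 : 0 < B := div_pos (by linarith) (by linarith)
  have htail : ∀ b a : ℕ, max (max L₂ 1) L₃ ≤ a →
      ∑ j ∈ Finset.Ico a b, θ j ^ 2 ≤ B * a * θ a ^ 2 := by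
    refine tail_sum_le hA hκ (sq_nonneg ν) hκν (by omega) ?_ (fun l hl => (hL₂ l (by omega)).2)
    have h1 : (L₃ : ℝ) ≤ (max (max L₂ 1) L₃ : ℕ) := by exact_mod_cast le_max_right _ _
    have h2 := hL₃.trans h1
    rwa [div_le_iff₀ (by linarith), mul_comm] at h2
  have hs0 : Tendsto (fun n : ℕ => σ ^ 2 / n) atTop (𝓝 0) :=
    tendsto_const_div_atTop_nhds_zero_nat _
  -- For `mstar n < p n` this is optimality; for `mstar n = p n` it is the assumption on the first
  -- coefficient left out of the design.
  have hmid : ∀ᶠ n : ℕ in atTop, 1 ≤ n ∧ θ (mstar n + 1) ^ 2 ≤ σ ^ 2 / n := by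
    filter_upwards [hlast, eventually_ge_atTop 1] with n hn hn1
    refine ⟨hn1, ?_⟩
    rcases eq_or_lt_of_le (Finset.mem_Icc.1 (hmstar n hn1).1).2 with h | h
    · rw [h]; exact hn
    · have h1 := (hψ n).sq_le_of_isOptSize hn1 (hf n hn1) (hmstar n hn1) h
      exact h1
  -- A bounded optimal size would keep the next squared coefficient above a positive constant, while
  -- the noise level tends to zero.
  have hminf : ∀ M : ℕ, ∀ᶠ n : ℕ in atTop, M ≤ mstar n := by
    intro M
    filter_upwards [hmid, hs0.eventually_lt_const (hA (M + 1) (by omega)).1] with n h1 h2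
    by_contra hlt
    have := le_of_ordered (A := fun j => θ j ^ 2) hA (by omega : 1 ≤ mstar n + 1)
      (by omega : mstar n + 1 ≤ M + 1)
    linarith [h1.2]
  -- The first term pushes indices of size `m / (4 C)` past `L₁`; the second makes the additive
  -- error `s` of `fullOptRisk_le` at most half of the waste.
  obtain ⟨M₁, hM₁⟩ := exists_nat_ge (4 * C * L₁ + 8 * C * (D + 1))
  set c := 1 / (8 * C * (D + 1)) / (1 + 2 * B) with hc
  refine ⟨c, by positivity, ?_⟩
  filter_upwards [hmid, hminf (max M₁ (max (max L₂ 1) L₃))] with n hn hmn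
  obtain ⟨hn1, hnext⟩ := hn
  have hn' : (0 : ℝ) < n := by exact_mod_cast hn1
  set m := mstar n with hm
  set s := σ ^ 2 / (n : ℝ) with hs
  have hspos : 0 < s := by positivity
  have hmopt := hmstar n hn1
  have hmIcc := Finset.mem_Icc.1 hmopt.1
  obtain ⟨hl1, hlm, hmu, hup⟩ := candidates_bounds (hκl n) (hκu n) hmopt.1
  have hmM : 4 * C * L₁ + 8 * C * (D + 1) ≤ (m : ℝ) :=
    hM₁.trans (by exact_mod_cast (by omega : M₁ ≤ m))
  have hm1 : (1 : ℝ) ≤ m := by exact_mod_cast hmIcc.1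
  set l := lowerSize (κl n) m with hl
  set u := upperSize (p n) (κu n) m with hu
  have hupper : fullOptRisk (X n) (f n) σ ≤ (1 + 2 * B) * (m * s) := by
    refine ((hψ n).fullOptRisk_le_msRisk hn1 (hf n hn1) σ hmopt.1).trans ?_
    rw [(hψ n).msRisk_eq hn1 (hf n hn1) σ hmopt.1,
      Finset.sum_Ico_add' (fun j => θ j ^ 2) m (p n) 1]
    have h1 := htail (p n + 1) (m + 1) (by omega)
    have h2 : B * ((m + 1 : ℕ) : ℝ) * θ (m + 1) ^ 2 ≤ B * (2 * m) * s := by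
      push_cast
      gcongr
      linarith
    rw [← hs]
    linarith
  have hlow : ∀ ω, m * s / (8 * C * (D + 1)) + fullOptRisk (X n) (f n) σ
      ≤ maRisk (X n) (f n) σ (msCandidates (p n) (κl n) (κu n) m) (w n ω) := by
    intro ω
    have h1 := (hψ n).le_maRisk_Icc hn1 (hf n hn1) hσ hl1 (hlm.trans hmu) hup (hw n hn1 ω)
    have h2 := (hψ n).fullOptRisk_le hn1 (hp_pos n hn1) (hf n hn1) hσ
      (antitone_nat_of_succ_le fun j => (hA (j + 1) (by omega)).2)
    rw [← hs] at h1 h2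
    rw [sum_range_split le_rfl (hlm.trans hmIcc.2)] at h2
    simp only [Finset.Ico_self, Finset.sum_empty, add_zero] at h2
    have hlC : (m : ℝ) / C - 1 ≤ l := by
      have h3 : (m : ℝ) / C ≤ (κl n)⁻¹ * m := by
        rw [div_eq_inv_mul]
        have := hκl n
        have := hC n
        gcongr
      have h4 := Nat.lt_floor_add_one ((κl n)⁻¹ * m)
      have h5 : ((⌊(κl n)⁻¹ * m⌋₊ : ℕ) : ℝ) ≤ l := by
        exact_mod_cast le_max_right _ _
      linarith
    have hlC2 : (m : ℝ) / (2 * C) ≤ l := by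
      have h3 : 1 ≤ (m : ℝ) / (2 * C) := by
        rw [le_div_iff₀ (by linarith)]
        have : 0 ≤ 4 * C * (L₁ : ℝ) := by positivity
        nlinarith
      have h4 : (m : ℝ) / C = 2 * ((m : ℝ) / (2 * C)) := by field_simp
      linarith
    -- Only the upper half of the forced coordinates is used: there the indices are comparable with
    -- `m`, so the squared coefficients are at most `D s`.
    set k := l / 2 with hk
    have hk1 : (2 : ℝ) * k ≤ l := by exact_mod_cast (by omega : 2 * k ≤ l)
    have hk2 : (l : ℝ) ≤ 2 * (k + 1) := by exact_mod_cast (by omega : l ≤ 2 * (k + 1))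
    have hlarge : ∀ j ∈ Finset.Ico k l, θ (j + 1) ^ 2 ≤ D * s := by
      intro j hj
      have hj' := Finset.mem_Ico.1 hj
      have h3 : (m : ℝ) / (4 * C) ≤ ((j + 1 : ℕ) : ℝ) := by
        have : (k : ℝ) ≤ j := by exact_mod_cast hj'.1
        have h4 : (m : ℝ) / (4 * C) = (m : ℝ) / (2 * C) / 2 := by field_simp; norm_num
        push_cast; linarith
      have hL₁ : (L₁ : ℝ) ≤ ((j + 1 : ℕ) : ℝ) := by
        refine le_trans ?_ h3
        rw [le_div_iff₀ (by positivity)]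
        have : 0 ≤ 8 * C * (D + 1) := by positivity
        linarith
      have h5 := hcomp (j + 1) (by exact_mod_cast hL₁) (m + 1) (by omega) (by
        rw [div_le_iff₀ (by positivity)] at h3
        push_cast at h3 ⊢
        linarith)
      refine h5.trans ?_
      gcongr
    have hgap : (l : ℝ) / 2 * (s / (D + 1)) ≤ ∑ j ∈ Finset.range l,
        (s - θ (j + 1) ^ 2 * s / (θ (j + 1) ^ 2 + s)) := by
      have hterm : ∀ j, s - θ (j + 1) ^ 2 * s / (θ (j + 1) ^ 2 + s)
          = s ^ 2 / (θ (j + 1) ^ 2 + s) := by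
        intro j
        have : θ (j + 1) ^ 2 + s ≠ 0 := by positivity
        field_simp; ring
      simp_rw [hterm]
      rw [sum_range_split (show k ≤ l by omega) le_rfl]
      simp only [Finset.Ico_self, Finset.sum_empty, add_zero]
      have h3 : 0 ≤ ∑ j ∈ Finset.range k, s ^ 2 / (θ (j + 1) ^ 2 + s) :=
        Finset.sum_nonneg fun j _ => by positivity
      have h4 : ∑ _j ∈ Finset.Ico k l, s / (D + 1)
          ≤ ∑ j ∈ Finset.Ico k l, s ^ 2 / (θ (j + 1) ^ 2 + s) := by
        refine Finset.sum_le_sum fun j hj => ?_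
        have := hlarge j hj
        rw [div_le_div_iff₀ (by positivity) (by positivity)]
        nlinarith
      rw [Finset.sum_const, Nat.card_Ico, nsmul_eq_mul, Nat.cast_sub (by omega)] at h4
      have h5 : (l : ℝ) / 2 * (s / (D + 1)) ≤ ((l : ℝ) - k) * (s / (D + 1)) := by
        gcongr; linarith
      linarith
    rw [Finset.sum_sub_distrib, Finset.sum_const, Finset.card_range, nsmul_eq_mul] at hgap
    have h6 : m * s / (8 * C * (D + 1)) + s ≤ (l : ℝ) / 2 * (s / (D + 1)) := by
      have h7 : s ≤ m * s / (8 * C * (D + 1)) := by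
        rw [le_div_iff₀ (by positivity)]
        have : 0 ≤ 4 * C * (L₁ : ℝ) := by positivity
        nlinarith
      have h8 : 2 * (m * s / (8 * C * (D + 1))) = (m / (2 * C)) / 2 * (s / (D + 1)) := by
        rw [div_div, div_mul_div_comm, ← mul_div_assoc,
          div_eq_div_iff (by positivity) (by positivity)]
        ring
      have h9 : (m / (2 * C)) / 2 * (s / (D + 1)) ≤ (l : ℝ) / 2 * (s / (D + 1)) := by
        gcongr
      linarith
    change _ ≤ maRisk (X n) (f n) σ (Finset.Icc l u) (w n ω)
    linarith
  have hint := (hψ n).integrable_maRisk hn1 (hf n hn1) σ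
    (Finset.Icc_subset_Icc hl1 hup) μ (hwm n) (hw n hn1)
  have h1 := integral_mono (integrable_const _) hint hlow
  simp only [integral_const, probReal_univ, one_smul] at h1
  have h2 : c * fullOptRisk (X n) (f n) σ ≤ m * s / (8 * C * (D + 1)) := by
    calc c * fullOptRisk (X n) (f n) σ ≤ c * ((1 + 2 * B) * (m * s)) := by gcongr
      _ = _ := by
        rw [hc, div_mul_eq_mul_div, ← mul_assoc, mul_comm (1 / _) (1 + 2 * B), mul_assoc,
          mul_div_cancel_left₀ _ (by positivity : (1 + 2 * B) ≠ 0)]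
        ring
  exact le_sub_iff_add_le.2 ((add_le_add_left h2 _).trans h1)

/-! ### Moments and uniform deviation bounds for the projected noise. -/

/-- Independent centred sub-Gaussian errors with variance `σ²`. -/
structure IsNoise {n : ℕ} {Ω : Type*} [MeasurableSpace Ω] (μ : Measure Ω) (σ : ℝ) (η : ℝ≥0)
    (ε : Fin n → Ω → ℝ) : Prop where
  meas : ∀ i, Measurable (ε i)
  indep : iIndepFun ε μ
  mean : ∀ i, ∫ ω, ε i ω ∂μ = 0
  var : ∀ i, ∫ ω, ε i ω ^ 2 ∂μ = σ ^ 2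
  subG : ∀ i, HasSubgaussianMGF (ε i) η μ

/-- The linear form `vᵀ ε` of the errors. -/
def linForm {n : ℕ} {Ω : Type*} (ε : Fin n → Ω → ℝ) (v : Fin n → ℝ) (ω : Ω) : ℝ :=
  v ⬝ᵥ fun i => ε i ω

section Noise

variable {n : ℕ} {Ω : Type*} [MeasurableSpace Ω] {μ : Measure Ω}
  {σ : ℝ} {η : ℝ≥0} {ε : Fin n → Ω → ℝ}

theorem IsNoise.measurable_linForm (h : IsNoise μ σ η ε) (v : Fin n → ℝ) :
    Measurable (linForm ε v) := by
  have := h.meas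
  unfold linForm dotProduct
  fun_prop

theorem IsNoise.hasSubgaussianMGF_linForm (h : IsNoise μ σ η ε) (v : Fin n → ℝ) :
    HasSubgaussianMGF (linForm ε v) (∑ i, ‖v i‖₊ ^ 2 * η) μ := by
  have hind : iIndepFun (fun i ω => v i * ε i ω) μ :=
    h.indep.comp (fun i x => v i * x) fun i => measurable_const_mul _
  exact HasSubgaussianMGF.sum_of_iIndepFun (s := Finset.univ) hind
    fun i _ => by
      convert (h.subG i).const_mul (v i)
      ext; simp; rfl

theorem IsNoise.integrable_exp_linForm (h : IsNoise μ σ η ε) (v : Fin n → ℝ) :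
    Integrable (fun ω => Real.exp (linForm ε v ω)) μ := by
  simpa using (h.hasSubgaussianMGF_linForm v).integrable_exp_mul 1

theorem IsNoise.integral_exp_linForm_le (h : IsNoise μ σ η ε) (v : Fin n → ℝ) :
    ∫ ω, Real.exp (linForm ε v ω) ∂μ ≤ Real.exp (η * sqNorm v / 2) := by
  have h1 := (h.hasSubgaussianMGF_linForm v).mgf_le 1
  simp only [mgf, one_mul, one_pow, mul_one, NNReal.coe_sum, NNReal.coe_mul, NNReal.coe_pow,
    coe_nnnorm, Real.norm_eq_abs, sq_abs, ← Finset.sum_mul] at h1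
  rwa [sqNorm, mul_comm (η : ℝ)]

theorem IsNoise.integral_linForm_sq [IsProbabilityMeasure μ] (h : IsNoise μ σ η ε) (v : Fin n → ℝ) :
    ∫ ω, linForm ε v ω ^ 2 ∂μ = σ ^ 2 * sqNorm v := by
  have hL : ∀ i, MemLp (ε i) 2 μ := fun i => (h.subG i).memLp 2
  have hfun : linForm ε v = ∑ i, fun ω => v i * ε i ω := by
    ext ω; simp [linForm, dotProduct]
  have hmean : ∫ ω, linForm ε v ω ∂μ = 0 := by
    simp only [linForm, dotProduct]
    rw [integral_finsetSum _ fun i _ => ((hL i).integrable (by norm_num)).const_mul _]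
    simp [integral_const_mul, h.mean]
  rw [← variance_of_integral_eq_zero (h.measurable_linForm v).aemeasurable hmean, hfun,
    IndepFun.variance_sum (fun i _ => (hL i).const_mul (v i))]
  · simp_rw [variance_const_mul]
    rw [sqNorm, Finset.mul_sum]
    refine Finset.sum_congr rfl fun i _ => ?_
    rw [variance_of_integral_eq_zero (h.meas i).aemeasurable (h.mean i), h.var i, mul_comm]
  · intro i _ j _ hij
    exact (h.indep.indepFun hij).comp (measurable_const_mul (v i)) (measurable_const_mul (v j))

theorem IsNoise.integrable_linForm_pow (h : IsNoise μ σ η ε) (v : Fin n → ℝ) {k : ℕ}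
    (hk : k ≠ 0) : Integrable (fun ω => linForm ε v ω ^ k) μ := by
  have h1 := (h.hasSubgaussianMGF_linForm v).memLp k
  have h2 : MemLp (linForm ε v) (k : ENNReal) μ := by simpa using h1
  have h3 := h2.integrable_norm_pow hk
  refine h3.mono' (h.measurable_linForm v |>.pow_const k).aestronglyMeasurable
    (Eventually.of_forall fun ω => ?_)
  rw [norm_pow]

/-- From `x⁶ / 6! ≤ e^|x| ≤ e^x + e^(-x)`; the constant is `2 · 6!`. -/
theorem IsNoise.integral_linForm_pow_six_le (h : IsNoise μ σ η ε) {v : Fin n → ℝ}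
    (hv : sqNorm v = 1) : ∫ ω, linForm ε v ω ^ 6 ∂μ ≤ 1440 * Real.exp (η / 2) := by
  have hneg : ∀ ω, linForm ε (-v) ω = -linForm ε v ω := fun ω => by simp [linForm]
  have hv' : sqNorm (-v) = 1 := by simpa [sqNorm] using hv
  have h1 := h.integral_exp_linForm_le v
  have h2 := h.integral_exp_linForm_le (-v)
  have i1 := h.integrable_exp_linForm v
  have i2 := h.integrable_exp_linForm (-v)
  rw [hv, mul_one] at h1
  rw [hv', mul_one] at h2
  have h3 : ∀ ω, linForm ε v ω ^ 6
      ≤ 720 * (Real.exp (linForm ε v ω) + Real.exp (linForm ε (-v) ω)) := by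
    intro ω
    rw [hneg]
    have h4 := Real.pow_div_factorial_le_exp |linForm ε v ω| (abs_nonneg _) 6
    have h5 := h4.trans (Real.exp_abs_le _)
    have h6 : |linForm ε v ω| ^ 6 = linForm ε v ω ^ 6 := by
      rw [pow_abs, abs_of_nonneg (by positivity)]
    rw [h6, div_le_iff₀ (by positivity)] at h5
    have h7 : ((Nat.factorial 6 : ℕ) : ℝ) = 720 := by norm_num [Nat.factorial]
    rw [h7] at h5
    linarith
  have h8 := integral_mono (h.integrable_linForm_pow v (by norm_num))
    ((i1.add i2).const_mul 720) h3
  simp only [Pi.add_apply] at h8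
  rw [integral_const_mul, integral_add i1 i2] at h8
  linarith

/-- A chi-square type exponential moment, by comparison with Gaussian variables. -/
theorem IsNoise.integral_exp_sum_sq_le [IsProbabilityMeasure μ] (h : IsNoise μ σ η ε) {ι : Type*} [Fintype ι]
    [DecidableEq ι]
    {u : ι → Fin n → ℝ} (hu : ∀ i j, u i ⬝ᵥ u j = if i = j then 1 else 0) {lam c : ℝ}
    (hlam : 0 ≤ lam) (hc : lam * η ≤ c)
    (hG : Integrable (fun g : ℝ => Real.exp (c * g ^ 2)) (gaussianReal 0 1)) :
    Integrable (fun ω => Real.exp (lam * ∑ i, linForm ε (u i) ω ^ 2)) μ ∧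
      ∫ ω, Real.exp (lam * ∑ i, linForm ε (u i) ω ^ 2) ∂μ
        ≤ (∫ g, Real.exp (c * g ^ 2) ∂gaussianReal 0 1) ^ Fintype.card ι := by
  -- Since `b² = 2 lam`, a standard Gaussian `g` gives `E exp(b x g) = exp(lam x²)`. The squares
  -- become linear forms, to which the sub-Gaussian bound applies once `g` is fixed and the
  -- integrals are swapped.
  set b := Real.sqrt (2 * lam) with hb
  have hb2 : b ^ 2 = 2 * lam := Real.sq_sqrt (by positivity)
  set γ : Measure (ι → ℝ) := Measure.pi fun _ => gaussianReal 0 1 with hγ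
  have hmeas : ∀ i, Measurable (linForm ε (u i)) := fun i => h.measurable_linForm _
  have hgauss : ∀ x : ℝ, ∫ g, Real.exp (b * x * g) ∂gaussianReal 0 1 = Real.exp (lam * x ^ 2) := by
    intro x
    have h1 := congrFun (mgf_id_gaussianReal (μ := 0) (v := 1)) (b * x)
    simp only [mgf, id, zero_mul, zero_add, NNReal.coe_one, one_mul] at h1
    rw [h1, mul_pow, hb2]; ring_nf
  have hinner : ∀ ω, ENNReal.ofReal (Real.exp (lam * ∑ i, linForm ε (u i) ω ^ 2))
      = ∫⁻ g, ENNReal.ofReal (∏ i, Real.exp (b * linForm ε (u i) ω * g i)) ∂γ := by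
    intro ω
    rw [← ofReal_integral_eq_lintegral_ofReal]
    · rw [hγ, integral_fintype_prod_eq_prod
        (f := fun i (g : ℝ) => Real.exp (b * linForm ε (u i) ω * g))]
      simp_rw [hgauss]
      rw [← Real.exp_sum, Finset.mul_sum]
    · exact Integrable.fintype_prod (f := fun i (g : ℝ) => Real.exp (b * linForm ε (u i) ω * g))
        fun i => integrable_exp_mul_gaussianReal _
    · exact Eventually.of_forall fun g => Finset.prod_nonneg fun i _ => (Real.exp_pos _).le
  have houter : ∀ g : ι → ℝ,
      ∫⁻ ω, ENNReal.ofReal (∏ i, Real.exp (b * linForm ε (u i) ω * g i)) ∂μ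
        ≤ ENNReal.ofReal (∏ i, Real.exp (c * g i ^ 2)) := by
    intro g
    set v : Fin n → ℝ := ∑ i, (b * g i) • u i with hv
    have e1 : ∀ ω, ∏ i, Real.exp (b * linForm ε (u i) ω * g i) = Real.exp (linForm ε v ω) := by
      intro ω
      rw [← Real.exp_sum, linForm, hv, sum_dotProduct]
      congr 1
      refine Finset.sum_congr rfl fun i _ => ?_
      rw [smul_dotProduct, smul_eq_mul, linForm]; ring
    have e2 : sqNorm v = 2 * lam * ∑ i, g i ^ 2 := by
      rw [sqNorm_eq_dotProduct, hv, sum_dotProduct, Finset.mul_sum]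
      refine Finset.sum_congr rfl fun i _ => ?_
      rw [dotProduct_sum, Finset.sum_eq_single i]
      · rw [smul_dotProduct, dotProduct_smul, hu, if_pos rfl, ← hb2]
        simp only [smul_eq_mul]; ring
      · intro j _ hji
        rw [smul_dotProduct, dotProduct_smul, hu, if_neg hji.symm]; simp
      · simp
    simp_rw [e1]
    rw [← ofReal_integral_eq_lintegral_ofReal (h.integrable_exp_linForm v)
      (Eventually.of_forall fun ω => (Real.exp_pos _).le)]
    refine ENNReal.ofReal_le_ofReal ((h.integral_exp_linForm_le v).trans ?_)
    rw [← Real.exp_sum, Real.exp_le_exp, ← Finset.mul_sum, e2]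
    have : 0 ≤ ∑ i, g i ^ 2 := Finset.sum_nonneg fun _ _ => sq_nonneg _
    nlinarith
  have hprodG : Integrable (fun g : ι → ℝ => ∏ i, Real.exp (c * g i ^ 2)) γ :=
    Integrable.fintype_prod (f := fun _ (g : ℝ) => Real.exp (c * g ^ 2)) fun _ => hG
  have hfin : ∫⁻ ω, ENNReal.ofReal (Real.exp (lam * ∑ i, linForm ε (u i) ω ^ 2)) ∂μ
      ≤ ENNReal.ofReal ((∫ g, Real.exp (c * g ^ 2) ∂gaussianReal 0 1) ^ Fintype.card ι) := by
    simp_rw [hinner]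
    rw [lintegral_lintegral_swap]
    · refine (lintegral_mono houter).trans ?_
      rw [← ofReal_integral_eq_lintegral_ofReal hprodG
        (Eventually.of_forall fun g => Finset.prod_nonneg fun i _ => (Real.exp_pos _).le), hγ,
        integral_fintype_prod_eq_pow (fun g : ℝ => Real.exp (c * g ^ 2))]
    · refine (ENNReal.measurable_ofReal.comp ?_).aemeasurable
      refine Finset.measurable_fun_prod _ fun i _ => Real.measurable_exp.comp ?_
      exact (((hmeas i).comp measurable_fst).const_mul b).mul
        ((measurable_pi_apply i).comp measurable_snd)
  have hm : Measurable fun ω => Real.exp (lam * ∑ i, linForm ε (u i) ω ^ 2) := by fun_prop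
  have hint : Integrable (fun ω => Real.exp (lam * ∑ i, linForm ε (u i) ω ^ 2)) μ := by
    refine ⟨hm.aestronglyMeasurable, ?_⟩
    rw [hasFiniteIntegral_iff_ofReal (Eventually.of_forall fun ω => (Real.exp_pos _).le)]
    exact hfin.trans_lt ENNReal.ofReal_lt_top
  refine ⟨hint, ?_⟩
  rw [← ofReal_integral_eq_lintegral_ofReal hint
    (Eventually.of_forall fun ω => (Real.exp_pos _).le)] at hfin
  exact (ENNReal.ofReal_le_ofReal_iff
    (pow_nonneg (integral_nonneg fun g => (Real.exp_pos _).le) _)).1 hfin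

end Noise

/-- A dimension-free upper deviation bound for the projected noise. -/
theorem exists_excess_bound (η : ℝ≥0) :
    ∃ B D : ℝ, 0 < B ∧ 0 < D ∧ ∀ {n : ℕ} {Ω : Type*} [MeasurableSpace Ω] (μ : Measure Ω)
      [IsProbabilityMeasure μ] (σ : ℝ) (ε : Fin n → Ω → ℝ), IsNoise μ σ η ε →
      ∀ (p : ℕ) (X : Matrix (Fin n) (Fin p) ℝ) (ψ : ℕ → Fin n → ℝ), NestedBasis X ψ →
      ∀ a b, a ≤ b → b ≤ p →
        ∫ ω, max 0 (∑ j ∈ Finset.Ico a b, linForm ε (ψ j) ω ^ 2 - B * ((b : ℝ) - a)) ∂μ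
          ≤ D * (1 / 2) ^ (b - a) := by
  -- Fernique's theorem supplies some positive `c`; its value is irrelevant.
  obtain ⟨c, hc, hG⟩ := IsGaussian.exists_integrable_exp_sq (gaussianReal 0 1)
  simp only [Real.norm_eq_abs, sq_abs] at hG
  set lam := c / (η + 1) with hlam
  have hlam0 : 0 < lam := by positivity
  have hlamη : lam * η ≤ c := by
    rw [hlam, div_mul_eq_mul_div, div_le_iff₀ (by positivity)]
    nlinarith
  set A := ∫ g, Real.exp (c * g ^ 2) ∂gaussianReal 0 1 with hA
  have hA1 : 1 ≤ A := by
    have := integral_mono (μ := gaussianReal 0 1) (integrable_const (1 : ℝ)) hG fun g =>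
      Real.one_le_exp (by positivity : 0 ≤ c * g ^ 2)
    simpa using this
  have hA0 : 0 < A := by linarith
  have hlog : 0 < Real.log (2 * A) := Real.log_pos (by linarith)
  -- Centring at `B (b - a)` multiplies the exponential moment by `(2 A)^(-(b - a))`; against the
  -- moment bound `A^(b - a)` this leaves `2^(-(b - a))`, summable over `b`.
  refine ⟨Real.log (2 * A) / lam, 1 / lam, by positivity, by positivity, ?_⟩
  intro n Ω _ μ _ σ ε h p X ψ hψ a b hab hbp
  set u : Finset.Ico a b → Fin n → ℝ := fun j => ψ j with hu
  have hort : ∀ i j, u i ⬝ᵥ u j = if i = j then 1 else 0 := by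
    intro i j
    have hi := Finset.mem_Ico.1 i.2
    have hj := Finset.mem_Ico.1 j.2
    simp only [hu]
    rw [hψ.orth _ (by omega) _ (by omega)]
    by_cases hij : i = j
    · rw [if_pos hij, if_pos (congrArg Subtype.val hij)]
    · rw [if_neg hij, if_neg fun e => hij (Subtype.ext e)]
  obtain ⟨hint, hle⟩ := h.integral_exp_sum_sq_le hort hlam0.le hlamη hG
  have hsum : ∀ ω, ∑ i, linForm ε (u i) ω ^ 2 = ∑ j ∈ Finset.Ico a b, linForm ε (ψ j) ω ^ 2 :=
    fun ω => Finset.sum_coe_sort (Finset.Ico a b) fun j => linForm ε (ψ j) ω ^ 2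
  simp_rw [hsum] at hint hle
  rw [Fintype.card_coe, Nat.card_Ico, ← hA] at hle
  set S : Ω → ℝ := fun ω => ∑ j ∈ Finset.Ico a b, linForm ε (ψ j) ω ^ 2 with hS
  have hpt : ∀ ω, max 0 (S ω - Real.log (2 * A) / lam * ((b : ℝ) - a))
      ≤ 1 / lam * ((1 / (2 * A)) ^ (b - a) * Real.exp (lam * S ω)) := by
    intro ω
    have e1 : (1 / (2 * A)) ^ (b - a) * Real.exp (lam * S ω)
        = Real.exp (lam * (S ω - Real.log (2 * A) / lam * ((b : ℝ) - a))) := by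
      rw [mul_sub, Real.exp_sub, ← mul_assoc, mul_div_cancel₀ _ hlam0.ne', ← Nat.cast_sub hab,
        mul_comm (Real.log _), Real.exp_nat_mul, Real.exp_log (by positivity), one_div, inv_pow]
      field_simp
    rw [e1]
    set z := S ω - Real.log (2 * A) / lam * ((b : ℝ) - a)
    refine max_le (by positivity) ?_
    have := Real.add_one_le_exp (lam * z)
    rw [div_mul_eq_mul_div, one_mul, le_div_iff₀ hlam0]
    linarith
  have h1 : ∫ ω, max 0 (S ω - Real.log (2 * A) / lam * ((b : ℝ) - a)) ∂μ
      ≤ ∫ ω, 1 / lam * ((1 / (2 * A)) ^ (b - a) * Real.exp (lam * S ω)) ∂μ :=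
    integral_mono_of_nonneg (Eventually.of_forall fun ω => le_max_left _ _)
      ((hint.const_mul _).const_mul _) (Eventually.of_forall hpt)
  refine h1.trans ?_
  rw [integral_const_mul, integral_const_mul]
  have h2 : (1 / (2 * A)) ^ (b - a) * A ^ (b - a) = (1 / 2) ^ (b - a) := by
    rw [← mul_pow]; congr 1; field_simp
  rw [← h2]
  gcongr

section NoiseBounds

variable {n p : ℕ} {X : Matrix (Fin n) (Fin p) ℝ} {ψ : ℕ → Fin n → ℝ}
  {Ω : Type*} [MeasurableSpace Ω] {μ : Measure Ω}
  {σ : ℝ} {η : ℝ≥0} {ε : Fin n → Ω → ℝ}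

theorem NestedBasis.sqNorm_eq_one (hψ : NestedBasis X ψ) {j : ℕ} (hj : j < p) :
    sqNorm (ψ j) = 1 := by
  rw [sqNorm_eq_dotProduct, hψ.orth j hj j hj, if_pos rfl]

theorem IsNoise.integrable_sum_sq (h : IsNoise μ σ η ε) (ψ : ℕ → Fin n → ℝ) (J : Finset ℕ) :
    Integrable (fun ω => ∑ j ∈ J, linForm ε (ψ j) ω ^ 2 / n) μ :=
  integrable_finsetSum _ fun _ _ => (h.integrable_linForm_pow _ two_ne_zero).div_const _

theorem IsNoise.integral_sum_sq [IsProbabilityMeasure μ] (h : IsNoise μ σ η ε) (hψ : NestedBasis X ψ) {J : Finset ℕ}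
    (hJ : ∀ j ∈ J, j < p) :
    ∫ ω, ∑ j ∈ J, linForm ε (ψ j) ω ^ 2 / n ∂μ = J.card * (σ ^ 2 / n) := by
  rw [integral_finsetSum _ fun _ _ => (h.integrable_linForm_pow _ two_ne_zero).div_const _]
  simp_rw [integral_div, h.integral_linForm_sq]
  rw [Finset.sum_congr rfl fun j hj => by rw [hψ.sqNorm_eq_one (hJ j hj), mul_one]]
  simp

end NoiseBounds

/-- For `l ≤ m` the segment is simply enlarged to `m`. For `l > m` the excess over a linear budget
has geometrically small mean, so the excesses of all `l` may be added into one `Z`, whatever `p` is.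
-/
theorem exists_prefix_bound (η : ℝ≥0) {σ : ℝ} (hσ : 0 < σ) :
    ∃ B D : ℝ, 0 < B ∧ 0 < D ∧ ∀ {n : ℕ} {Ω : Type*} [MeasurableSpace Ω] (μ : Measure Ω)
      [IsProbabilityMeasure μ] (ε : Fin n → Ω → ℝ), IsNoise μ σ η ε → 1 ≤ n →
      ∀ (p : ℕ) (X : Matrix (Fin n) (Fin p) ℝ) (ψ : ℕ → Fin n → ℝ), NestedBasis X ψ →
      ∀ m ≤ p, ∃ Z : Ω → ℝ, Integrable Z μ ∧ ∫ ω, Z ω ∂μ ≤ D * (σ ^ 2 / n) ∧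
        ∀ ω, ∀ l ≤ p, ∑ j ∈ Finset.range l, linForm ε (ψ j) ω ^ 2 / n
          ≤ ∑ j ∈ Finset.range m, linForm ε (ψ j) ω ^ 2 / n
            + B * (max 0 ((l : ℝ) - m) * (σ ^ 2 / n)) + Z ω := by
  obtain ⟨B, D, hB, hD, hBD⟩ := exists_excess_bound η
  refine ⟨B / σ ^ 2, 2 * D / σ ^ 2, by positivity, by positivity, ?_⟩
  intro n Ω _ μ _ ε h hn p X ψ hψ m hm
  have hn' : (0 : ℝ) < n := by exact_mod_cast hn
  set Y : ℕ → Ω → ℝ := fun l ω =>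
    max 0 (∑ j ∈ Finset.Ico m l, linForm ε (ψ j) ω ^ 2 - B * ((l : ℝ) - m)) with hY
  have hY0 : ∀ l ω, 0 ≤ Y l ω := fun l ω => le_max_left _ _
  have hYint : ∀ l, Integrable (Y l) μ := by
    intro l
    have h1 : Integrable (fun ω => ∑ j ∈ Finset.Ico m l, linForm ε (ψ j) ω ^ 2) μ :=
      integrable_finsetSum _ fun _ _ => h.integrable_linForm_pow _ two_ne_zero
    exact (integrable_const (0 : ℝ)).sup (h1.sub (integrable_const _))
  refine ⟨fun ω => (∑ l ∈ Finset.Ico m (p + 1), Y l ω) / n,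
    (integrable_finsetSum _ fun l _ => hYint l).div_const _, ?_, ?_⟩
  · rw [integral_div, integral_finsetSum _ fun l _ => hYint l]
    have h1 : ∑ l ∈ Finset.Ico m (p + 1), ∫ ω, Y l ω ∂μ
        ≤ ∑ l ∈ Finset.Ico m (p + 1), D * (1 / 2) ^ (l - m) :=
      Finset.sum_le_sum fun l hl => by
        have hl' := Finset.mem_Ico.1 hl
        exact hBD μ σ ε h p X ψ hψ m l hl'.1 (by omega)
    have h2 : ∑ l ∈ Finset.Ico m (p + 1), D * (1 / 2 : ℝ) ^ (l - m) ≤ D * 2 := by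
      rw [← Finset.mul_sum, Finset.sum_Ico_eq_sum_range]
      simp only [Nat.add_sub_cancel_left]
      gcongr
      exact sum_geometric_two_le _
    have h3 : 2 * D / σ ^ 2 * (σ ^ 2 / n) = D * 2 / n := by field_simp
    rw [h3]
    gcongr
    exact h1.trans h2
  · intro ω l hl
    have hZ0 : 0 ≤ (∑ l ∈ Finset.Ico m (p + 1), Y l ω) / n :=
      div_nonneg (Finset.sum_nonneg fun l _ => hY0 l ω) hn'.le
    rcases le_or_gt l m with hlm | hlm
    · have h1 : ∑ j ∈ Finset.range l, linForm ε (ψ j) ω ^ 2 / n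
          ≤ ∑ j ∈ Finset.range m, linForm ε (ψ j) ω ^ 2 / n :=
        Finset.sum_le_sum_of_subset_of_nonneg (Finset.range_mono hlm)
          fun _ _ _ => by positivity
      have h2 : 0 ≤ B / σ ^ 2 * (max 0 ((l : ℝ) - m) * (σ ^ 2 / n)) := by positivity
      linarith
    · have h1 : ∑ j ∈ Finset.Ico m l, linForm ε (ψ j) ω ^ 2
          ≤ B * ((l : ℝ) - m) + Y l ω := by
        have := le_max_right 0 (∑ j ∈ Finset.Ico m l, linForm ε (ψ j) ω ^ 2 - B * ((l : ℝ) - m))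
        simp only [hY]; linarith
      have h2 : Y l ω ≤ ∑ l ∈ Finset.Ico m (p + 1), Y l ω :=
        Finset.single_le_sum (f := fun l => Y l ω) (fun l _ => hY0 l ω)
          (Finset.mem_Ico.2 (by omega))
      have h3 : ∑ j ∈ Finset.Ico m l, linForm ε (ψ j) ω ^ 2 / n
          ≤ B / σ ^ 2 * (max 0 ((l : ℝ) - m) * (σ ^ 2 / n))
            + (∑ l ∈ Finset.Ico m (p + 1), Y l ω) / n := by
        have hlm' : (m : ℝ) ≤ l := by exact_mod_cast hlm.le
        rw [max_eq_right (by linarith), ← Finset.sum_div]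
        have h4 : B / σ ^ 2 * (((l : ℝ) - m) * (σ ^ 2 / n)) = B * ((l : ℝ) - m) / n := by
          field_simp
        rw [h4, ← add_div]
        gcongr
        linarith
      rw [sum_range_split hlm.le le_rfl]
      simp only [Finset.Ico_self, Finset.sum_empty, add_zero]
      linarith

/-- Coordinate `j` gets the threshold `a = δ (j + 1) s`, and the overshoot is at most `y³ / a²` for
the normalised squared noise `y`. Its mean is of order `s / (δ² (j + 1)²)`, which is summable.
Bounding the overshoot by `y² / a` would give a harmonic series, whence sixth moments. -/
theorem exists_window_bound (η : ℝ≥0) {σ : ℝ} (hσ : 0 < σ) :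
    ∃ D : ℝ, 0 < D ∧ ∀ {n : ℕ} {Ω : Type*} [MeasurableSpace Ω] (μ : Measure Ω)
      [IsProbabilityMeasure μ] (ε : Fin n → Ω → ℝ), IsNoise μ σ η ε → 1 ≤ n →
      ∀ (p : ℕ) (X : Matrix (Fin n) (Fin p) ℝ) (ψ : ℕ → Fin n → ℝ), NestedBasis X ψ →
      ∀ δ : ℝ, 0 < δ → ∃ Z : Ω → ℝ, Integrable Z μ ∧ ∫ ω, Z ω ∂μ ≤ D * (σ ^ 2 / n) / δ ^ 2 ∧
        ∀ ω, ∀ l u : ℕ, l ≤ u → u ≤ p → ∑ j ∈ Finset.Ico l u, linForm ε (ψ j) ω ^ 2 / n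
          ≤ δ * (((u : ℝ) - l) * (u * (σ ^ 2 / n))) + Z ω := by
  have hsum : Summable fun j : ℕ => 1 / ((j : ℝ) + 1) ^ 2 := by
    have := (summable_nat_add_iff 1).2 (Real.summable_one_div_nat_pow.2 one_lt_two)
    simpa using this
  set c₀ := ∑' j : ℕ, 1 / ((j : ℝ) + 1) ^ 2 with hc₀
  have hc₀0 : 0 ≤ c₀ := tsum_nonneg fun j => by positivity
  set c₆ := 1440 * Real.exp (η / 2) with hc₆
  refine ⟨c₆ * (c₀ + 1) / σ ^ 6, by positivity, ?_⟩
  intro n Ω _ μ _ ε h hn p X ψ hψ δ hδ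
  have hn' : (0 : ℝ) < n := by exact_mod_cast hn
  set s := σ ^ 2 / (n : ℝ) with hs
  have hs0 : 0 < s := by positivity
  set Y : ℕ → Ω → ℝ := fun j ω => linForm ε (ψ j) ω ^ 6 / n ^ 3 / (δ * (j + 1) * s) ^ 2 with hY
  have hY0 : ∀ j ω, 0 ≤ Y j ω := fun j ω => by simp only [hY]; positivity
  have hYint : ∀ j, Integrable (Y j) μ := fun j =>
    ((h.integrable_linForm_pow _ (by norm_num)).div_const _).div_const _
  refine ⟨fun ω => ∑ j ∈ Finset.range p, Y j ω, integrable_finsetSum _ fun j _ => hYint j, ?_, ?_⟩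
  · rw [integral_finsetSum _ fun j _ => hYint j]
    have h1 : ∀ j ∈ Finset.range p, ∫ ω, Y j ω ∂μ
        ≤ c₆ / σ ^ 6 * s / δ ^ 2 * (1 / ((j : ℝ) + 1) ^ 2) := by
      intro j hj
      simp only [hY]
      rw [integral_div, integral_div]
      have h2 := h.integral_linForm_pow_six_le (hψ.sqNorm_eq_one (Finset.mem_range.1 hj))
      have h3 : c₆ / σ ^ 6 * s / δ ^ 2 * (1 / ((j : ℝ) + 1) ^ 2)
          = c₆ / n ^ 3 / (δ * (j + 1) * s) ^ 2 := by
        rw [hs]; field_simp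
      rw [h3]
      gcongr
    refine (Finset.sum_le_sum h1).trans ?_
    rw [← Finset.mul_sum]
    have h2 : ∑ j ∈ Finset.range p, 1 / ((j : ℝ) + 1) ^ 2 ≤ c₀ + 1 :=
      (hsum.sum_le_tsum _ fun j _ => by positivity).trans (by linarith)
    calc c₆ / σ ^ 6 * s / δ ^ 2 * ∑ j ∈ Finset.range p, 1 / ((j : ℝ) + 1) ^ 2
        ≤ c₆ / σ ^ 6 * s / δ ^ 2 * (c₀ + 1) := by gcongr
      _ = _ := by ring
  · intro ω l u hlu hup
    have h1 : ∀ j ∈ Finset.Ico l u, linForm ε (ψ j) ω ^ 2 / n ≤ δ * (u * s) + Y j ω := by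
      intro j hj
      have hj' := Finset.mem_Ico.1 hj
      set y := linForm ε (ψ j) ω ^ 2 / n with hy
      have hy0 : 0 ≤ y := by positivity
      set a := δ * ((j : ℝ) + 1) * s with ha
      have ha0 : 0 < a := by positivity
      have h2 : Y j ω = y ^ 3 / a ^ 2 := by simp only [hY, hy, ha]; ring
      have h3 : a ≤ δ * (u * s) := by
        have : ((j : ℝ) + 1) ≤ u := by exact_mod_cast hj'.2
        rw [ha, mul_assoc]
        gcongr
      have h4 : y ≤ a + y ^ 3 / a ^ 2 := by
        rcases le_total y a with h5 | h5
        · have : 0 ≤ y ^ 3 / a ^ 2 := by positivity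
          linarith
        · have : y ≤ y ^ 3 / a ^ 2 := by
            rw [le_div_iff₀ (by positivity)]
            calc y * a ^ 2 ≤ y * y ^ 2 := by gcongr
              _ = y ^ 3 := by ring
          linarith
      rw [h2]; linarith
    refine (Finset.sum_le_sum h1).trans ?_
    rw [Finset.sum_add_distrib, Finset.sum_const, Nat.card_Ico, nsmul_eq_mul, Nat.cast_sub hlu]
    have h2 : ∑ j ∈ Finset.Ico l u, Y j ω ≤ ∑ j ∈ Finset.range p, Y j ω := by
      refine Finset.sum_le_sum_of_subset_of_nonneg (fun j hj => ?_) fun j _ _ => hY0 j ω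
      have := Finset.mem_Ico.1 hj
      exact Finset.mem_range.2 (by omega)
    have h3 : ((u : ℝ) - l) * (δ * (u * s)) = δ * (((u : ℝ) - l) * (u * s)) := by ring
    linarith

/-! ### Fast decay: the risk near the optimal size, and criteria for `AsympLe`. -/

/-- Under fast decay the optimal size `m` carries almost all of the optimal averaging risk. -/
theorem exists_fast_decay_facts {θ : ℕ → ℝ}
    (hA : ∀ j, 1 ≤ j → 0 < θ j ^ 2 ∧ θ (j + 1) ^ 2 ≤ θ j ^ 2) (hfast : FastDecay θ)
    {σ : ℝ} (hσ : 0 < σ) {δ : ℝ} (hδ : 0 < δ) (hδ1 : δ < 1) :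
    ∃ M : ℕ, ∀ {n p : ℕ} (X : Matrix (Fin n) (Fin p) ℝ) (f : Fin n → ℝ) (ψ : ℕ → Fin n → ℝ)
      (m : ℕ), NestedBasis X ψ → HasCoords p ψ f (fun j => θ (j + 1)) → 1 ≤ n → M ≤ m →
      IsOptSize X f σ m →
      ∑ j ∈ Finset.Ico m p, θ (j + 1) ^ 2 ≤ δ * (m * (σ ^ 2 / n)) ∧
      (1 - δ) * (m * (σ ^ 2 / n)) ≤ fullOptRisk X f σ ∧
      (∀ k ∈ Finset.Icc 1 p, ∑ j ∈ Finset.Ico k p, θ (j + 1) ^ 2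
        ≤ ∑ j ∈ Finset.Ico m p, θ (j + 1) ^ 2 + δ * (m * (σ ^ 2 / n))
          + 2 * (msRisk X f σ k - msRisk X f σ m)) ∧
      σ ^ 2 / n ≤ δ * (m * (σ ^ 2 / n)) := by
  have hfast' : ∀ κ q : ℝ, 1 < κ → 0 < q →
      ∀ᶠ l : ℕ in atTop, (fun j => θ j ^ 2) ⌊κ * l⌋₊ ≤ q * (fun j => θ j ^ 2) l :=
    fun κ q hκ hq => hfast.eventually_sq_le (fun j hj => (hA j hj).1) hκ hq
  obtain ⟨M₁, hM₁⟩ := exists_tail_small (A := fun j => θ j ^ 2) hA hfast' hδ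
  obtain ⟨M₂, hM₂⟩ := exists_many_large (A := fun j => θ j ^ 2) hA hfast' hδ hδ1 two_pos
  -- Coefficients above `(2 / δ) s` have ideal cost at least `(1 - δ / 2) s`, and at least `(1 - δ /
  -- 2) m` of them exist; the product of the two factors is at least `1 - δ`.
  obtain ⟨M₃, hM₃⟩ := exists_many_large (A := fun j => θ j ^ 2) hA hfast' (half_pos hδ)
    (by linarith) (div_pos two_pos hδ)
  obtain ⟨M₄, hM₄⟩ := exists_nat_ge (1 / δ)
  -- The `2` guarantees that size `m - 1` is a legitimate competitor.
  refine ⟨max (max M₁ M₂) (max (max M₃ M₄) 2), ?_⟩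
  intro n p X f ψ m hψ hf hn hm hopt
  have hn' : (0 : ℝ) < n := by exact_mod_cast hn
  have hmIcc := Finset.mem_Icc.1 hopt.1
  have hnext : m < p → θ (m + 1) ^ 2 ≤ σ ^ 2 / n := fun h => by
    have h1 := hψ.sq_le_of_isOptSize hn hf hopt h
    exact h1
  have hlast : σ ^ 2 / n ≤ θ m ^ 2 := by
    obtain ⟨m', rfl⟩ : ∃ m', m = m' + 1 := ⟨m - 1, by omega⟩
    have h1 := hψ.le_sq_of_isOptSize hn hf hopt (by omega)
    exact h1
  have hrisk : ∀ k ∈ Finset.Icc 1 p, msRisk X f σ k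
      = k * (σ ^ 2 / n) + ∑ j ∈ Finset.Ico k p, θ (j + 1) ^ 2 :=
    fun k hk => hψ.msRisk_eq hn hf σ hk
  set s := σ ^ 2 / (n : ℝ) with hs
  have hs0 : 0 < s := by positivity
  have hbig : ∀ j, j < m → s ≤ θ (j + 1) ^ 2 := fun j hj =>
    hlast.trans (le_of_ordered (A := fun j => θ j ^ 2) hA (by omega) (by omega))
  refine ⟨?_, ?_, ?_, ?_⟩
  · rw [Finset.sum_Ico_add' (fun j => θ j ^ 2) m p 1]
    exact hM₁ m (by omega) p s hs0.le hnext
  · obtain ⟨k, hkm, hk, hG⟩ := hM₃ m (by omega)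
    have h1 := hψ.le_fullOptRisk hn (hmIcc.1.trans hmIcc.2) hf hσ
    rw [← hs] at h1
    refine le_trans ?_ h1
    have h2 : ∑ _j ∈ Finset.range k, (1 - δ / 2) * s
        ≤ ∑ j ∈ Finset.range k, θ (j + 1) ^ 2 * s / (θ (j + 1) ^ 2 + s) := by
      refine Finset.sum_le_sum fun j hj => ?_
      have h3 := hG s hlast (j + 1) (by omega) (Finset.mem_range.1 hj)
      rw [div_mul_eq_mul_div, div_le_iff₀ hδ] at h3
      rw [le_div_iff₀ (by positivity)]
      have h4 : (1 - δ / 2) * (θ (j + 1) ^ 2 + s) ≤ θ (j + 1) ^ 2 := by nlinarith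
      nlinarith
    have h3 : ∑ j ∈ Finset.range k, θ (j + 1) ^ 2 * s / (θ (j + 1) ^ 2 + s)
        ≤ ∑ j ∈ Finset.range p, θ (j + 1) ^ 2 * s / (θ (j + 1) ^ 2 + s) :=
      Finset.sum_le_sum_of_subset_of_nonneg (Finset.range_mono (hkm.trans hmIcc.2))
        fun j _ _ => by positivity
    refine le_trans ?_ (h2.trans h3)
    rw [Finset.sum_const, Finset.card_range, nsmul_eq_mul]
    have h4 : (1 - δ / 2) * m ≤ k := by linarith
    have hm0 : (0 : ℝ) ≤ m := Nat.cast_nonneg m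
    calc (1 - δ) * (m * s) ≤ (1 - δ / 2) * m * ((1 - δ / 2) * s) := by
          have : 0 ≤ m * s := by positivity
          nlinarith [sq_nonneg δ]
      _ ≤ k * ((1 - δ / 2) * s) := by
          have : 0 ≤ 1 - δ / 2 := by linarith
          gcongr
  · intro k hk
    have hkIcc := Finset.mem_Icc.1 hk
    have hgap : 0 ≤ msRisk X f σ k - msRisk X f σ m := sub_nonneg.2 (hopt.2 k hk)
    have hms : 0 ≤ δ * (m * s) := by positivity
    rcases le_total m k with hmk | hkm
    · have : ∑ j ∈ Finset.Ico k p, θ (j + 1) ^ 2 ≤ ∑ j ∈ Finset.Ico m p, θ (j + 1) ^ 2 :=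
        Finset.sum_le_sum_of_subset_of_nonneg (Finset.Ico_subset_Ico hmk le_rfl)
          fun j _ _ => sq_nonneg _
      linarith
    · rw [hrisk k hk, hrisk m hopt.1, ← Finset.sum_Ico_consecutive _ hkm hmIcc.2]
      obtain ⟨k', hkm', hk', hG⟩ := hM₂ m (by omega)
      -- The excess risk of `k ≤ m` is `∑ (θ² - s)` over the omitted coordinates. Where `θ² ≥ 2 s`
      -- the bias is at most twice the excess; on the few coordinates from `k'` on, where only `θ² ≥
      -- s` is available, an additional `s` suffices.
      have h1 : ∑ j ∈ Finset.Ico k m, θ (j + 1) ^ 2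
          ≤ ∑ j ∈ Finset.Ico k m, (2 * (θ (j + 1) ^ 2 - s) + if k' ≤ j then s else 0) := by
        refine Finset.sum_le_sum fun j hj => ?_
        have hj' := Finset.mem_Ico.1 hj
        by_cases h : k' ≤ j
        · rw [if_pos h]; linarith [hbig j hj'.2]
        · rw [if_neg h]; linarith [hG s hlast (j + 1) (by omega) (by omega)]
      have h2 : ∑ j ∈ Finset.Ico k m, (if k' ≤ j then s else 0) ≤ δ * (m * s) := by
        rw [← Finset.sum_filter, Finset.sum_const, nsmul_eq_mul]
        have h3 : ((Finset.Ico k m).filter fun j => k' ≤ j).card ≤ m - k' := by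
          rw [← Nat.card_Ico]
          refine Finset.card_le_card fun j hj => ?_
          simp only [Finset.mem_filter, Finset.mem_Ico] at hj ⊢
          omega
        have h4 : ((((Finset.Ico k m).filter fun j => k' ≤ j).card : ℕ) : ℝ) ≤ m - k' := by
          rw [← Nat.cast_sub hkm']; exact_mod_cast h3
        rw [← mul_assoc]
        gcongr
        linarith
      rw [Finset.sum_add_distrib, ← Finset.mul_sum, Finset.sum_sub_distrib, Finset.sum_const,
        Nat.card_Ico, nsmul_eq_mul, Nat.cast_sub hkm] at h1
      linarith
  · have h1 : (M₄ : ℝ) ≤ m := by exact_mod_cast (by omega : M₄ ≤ m)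
    have h2 := hM₄.trans h1
    rw [div_le_iff₀ hδ] at h2
    nlinarith

theorem asympLe_of_forall {Q R : ℕ → ℝ} (hR : ∀ᶠ n in atTop, 0 < R n)
    (h : ∀ ρ : ℝ, 0 < ρ → ∀ᶠ n in atTop, Q n ≤ (1 + ρ) * R n) : AsympLe Q R := by
  refine ⟨fun n => max 0 (Q n / R n - 1), ?_, ?_⟩
  · rw [Metric.tendsto_atTop']
    intro ρ hρ
    have h1 := (h (ρ / 2) (by linarith)).and hR
    obtain ⟨N, hN⟩ := eventually_atTop.1 h1
    refine ⟨N, fun n hn => ?_⟩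
    obtain ⟨h2, h3⟩ := hN n hn.le
    rw [Real.dist_eq, sub_zero, abs_of_nonneg (le_max_left _ _)]
    refine max_lt hρ ?_
    have : Q n / R n ≤ 1 + ρ / 2 := (div_le_iff₀ h3).2 h2
    linarith
  · filter_upwards [hR] with n hn
    have h1 : Q n / R n ≤ 1 + max 0 (Q n / R n - 1) := by
      linarith [le_max_right 0 (Q n / R n - 1)]
    exact (div_le_iff₀ hn).1 h1

/-! ### Expected loss and risk on a window chosen independently of the sample. -/

section FixedSampleSize

variable {n p : ℕ} {X : Matrix (Fin n) (Fin p) ℝ} {ψ : ℕ → Fin n → ℝ} {f : Fin n → ℝ}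
  {t : ℕ → ℝ} {Ω : Type*} [MeasurableSpace Ω] {μ : Measure Ω} [IsProbabilityMeasure μ]
  {σ : ℝ} {η : ℝ≥0} {ε : Fin n → Ω → ℝ} {v : Ω → ℝ}
  {κl κu C₂ : ℝ}

theorem integrable_of_finite_range {k : Ω → ℕ} (hk : Measurable k) {p : ℕ}
    (hkp : ∀ ω, k ω ∈ Finset.Icc 1 p) (g : ℕ → ℝ) : Integrable (fun ω => g (k ω)) μ := by
  refine Integrable.of_bound (C := ∑ j ∈ Finset.Icc 1 p, |g j|)
    ((measurable_from_nat (f := g)).comp hk).aestronglyMeasurable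
    (Eventually.of_forall fun ω => ?_)
  exact Finset.single_le_sum (f := fun j => |g j|) (fun _ _ => abs_nonneg _) (hkp ω)

/-- `F` need not be measurable: it is nonnegative and has an integrable majorant, and if it is not
integrable its integral is `0`. No measurability of the selected weights is then needed for upper
bounds. -/
theorem integral_le_lincomb {F G₁ G₂ G₃ G₄ : Ω → ℝ} (hF : ∀ ω, 0 ≤ F ω)
    (h₁ : Integrable G₁ μ) (h₂ : Integrable G₂ μ) (h₃ : Integrable G₃ μ) (h₄ : Integrable G₄ μ)
    (c₀ c₁ c₂ c₃ c₄ : ℝ)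
    (h : ∀ᵐ ω ∂μ, F ω ≤ c₀ + c₁ * G₁ ω + c₂ * G₂ ω + c₃ * G₃ ω + c₄ * G₄ ω) :
    ∫ ω, F ω ∂μ ≤ c₀ + c₁ * ∫ ω, G₁ ω ∂μ + c₂ * ∫ ω, G₂ ω ∂μ + c₃ * ∫ ω, G₃ ω ∂μ
      + c₄ * ∫ ω, G₄ ω ∂μ := by
  have i1 : Integrable (fun ω => c₀ + c₁ * G₁ ω) μ := (integrable_const _).add (h₁.const_mul _)
  have i2 : Integrable (fun ω => c₀ + c₁ * G₁ ω + c₂ * G₂ ω) μ := i1.add (h₂.const_mul _)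
  have i3 : Integrable (fun ω => c₀ + c₁ * G₁ ω + c₂ * G₂ ω + c₃ * G₃ ω) μ :=
    i2.add (h₃.const_mul _)
  have i4 : Integrable (fun ω => c₀ + c₁ * G₁ ω + c₂ * G₂ ω + c₃ * G₃ ω + c₄ * G₄ ω) μ :=
    i3.add (h₄.const_mul _)
  refine (integral_mono_of_nonneg (Eventually.of_forall hF) i4 h).trans (le_of_eq ?_)
  rw [integral_add i3 (h₄.const_mul _), integral_add i2 (h₃.const_mul _),
    integral_add i1 (h₂.const_mul _), integral_add (integrable_const _) (h₁.const_mul _)]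
  simp [integral_const_mul]

/-- Crude but sufficient: the constant `1` contributes a multiple of `1 / n`, which is negligible
against `m* σ² / n`. -/
theorem abs_le_one_add_sq (x : ℝ) : |x| ≤ 1 + x ^ 2 := by
  rw [← sq_abs]; nlinarith [sq_nonneg (|x| - 1)]

theorem excess_variance_le (hn : 1 ≤ n) (σ v : ℝ) {a b : ℝ} (hab : a ≤ b) (h0 : 0 ≤ a) :
    (σ ^ 2 + |v - σ ^ 2|) / n * a ≤ b * (σ ^ 2 / n + (1 + (v - σ ^ 2) ^ 2) / n) := by
  have hn' : (0 : ℝ) < n := by exact_mod_cast hn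
  rw [mul_comm, ← add_div]
  have := abs_le_one_add_sq (v - σ ^ 2)
  have hb : 0 ≤ b := h0.trans hab
  gcongr

/-- Loss and risk of MMA on the candidates around a non-random size. -/
theorem fixed_candidates_bound (hψ : NestedBasis X ψ) (hn : 1 ≤ n) (hf : HasCoords p ψ f t)
    (hε : IsNoise μ σ η ε) (hκl : 1 < κl) (hκu : 1 < κu) {k : ℕ} (hk : k ∈ Finset.Icc 1 p)
    (hv : MemLp (fun ω => v ω - σ ^ 2) 2 μ)
    (hwin : (upperSize p κu k : ℝ) - lowerSize κl k ≤ C₂)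
    {w : Ω → ℕ → ℝ} (hw : ∀ ω, IsMMAWeight X (msCandidates p κl κu k) (v ω)
      (f + fun i => ε i ω) (w ω)) :
    ∫ ω, maLoss X f (msCandidates p κl κu k) (w ω) (f + fun i => ε i ω) ∂μ
        ≤ msRisk X f σ k + C₂ * (14 * (σ ^ 2 / n)
          + 8 * ((1 + ∫ ω, (v ω - σ ^ 2) ^ 2 ∂μ) / n)) ∧
      ∫ ω, maRisk X f σ (msCandidates p κl κu k) (w ω) ∂μ
        ≤ msRisk X f σ k + C₂ * (14 * (σ ^ 2 / n)
          + 8 * ((1 + ∫ ω, (v ω - σ ^ 2) ^ 2 ∂μ) / n)) := by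
  have hn' : (0 : ℝ) < n := by exact_mod_cast hn
  obtain ⟨hl1, hlk, hku, hup⟩ := candidates_bounds hκl hκu hk
  have hrisk := hψ.msRisk_eq hn hf σ hk
  simp only [msCandidates] at hw ⊢
  set l := lowerSize κl k
  set u := upperSize p κu k
  have hlu : l ≤ u := hlk.trans hku
  have hlu' : (0 : ℝ) ≤ (u : ℝ) - l := sub_nonneg.2 (by exact_mod_cast hlu)
  have hC0 : 0 ≤ C₂ := hlu'.trans hwin
  have hT : ∑ j ∈ Finset.Ico u p, t j ^ 2 ≤ ∑ j ∈ Finset.Ico k p, t j ^ 2 :=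
    Finset.sum_le_sum_of_subset_of_nonneg (Finset.Ico_subset_Ico hku le_rfl)
      fun _ _ _ => sq_nonneg _
  have hlk' : (l : ℝ) * (σ ^ 2 / n) ≤ k * (σ ^ 2 / n) := by
    have : (l : ℝ) ≤ k := by exact_mod_cast hlk
    gcongr
  have hvi : Integrable (fun ω => (v ω - σ ^ 2) ^ 2) μ := hv.integrable_sq
  have hi1 := hε.integrable_sum_sq ψ (Finset.range l)
  have hi2 := hε.integrable_sum_sq ψ (Finset.Ico l u)
  have hi3 : Integrable (fun ω => (1 + (v ω - σ ^ 2) ^ 2) / (n : ℝ)) μ :=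
    ((integrable_const _).add hvi).div_const _
  have he1 := hε.integral_sum_sq hψ (J := Finset.range l) fun j hj => by
    have := Finset.mem_range.1 hj; omega
  have he2 := hε.integral_sum_sq hψ (J := Finset.Ico l u) fun j hj => by
    have := Finset.mem_Ico.1 hj; omega
  rw [Finset.card_range] at he1
  rw [Nat.card_Ico, Nat.cast_sub hlu] at he2
  have he3 : ∫ ω, (1 + (v ω - σ ^ 2) ^ 2) / (n : ℝ) ∂μ
      = (1 + ∫ ω, (v ω - σ ^ 2) ^ 2 ∂μ) / n := by
    rw [integral_div, integral_add (integrable_const _) hvi]; simp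
  have hve : ∀ ω, (σ ^ 2 + |v ω - σ ^ 2|) / n * ((u : ℝ) - l)
      ≤ C₂ * (σ ^ 2 / n + (1 + (v ω - σ ^ 2) ^ 2) / n) := fun ω =>
    excess_variance_le hn σ (v ω) hwin hlu'
  set S := σ ^ 2 / (n : ℝ) with hS
  have hS0 : 0 ≤ S := by positivity
  set a := (1 + ∫ ω, (v ω - σ ^ 2) ^ 2 ∂μ) / (n : ℝ) with ha
  have ha0 : 0 ≤ a := by
    have : 0 ≤ ∫ ω, (v ω - σ ^ 2) ^ 2 ∂μ := integral_nonneg fun ω => sq_nonneg _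
    positivity
  have hwS : ((u : ℝ) - l) * S ≤ C₂ * S := by gcongr
  have hCS : 0 ≤ C₂ * S := by positivity
  have hCa : 0 ≤ C₂ * a := by positivity
  constructor
  · have h1 := integral_le_lincomb (μ := μ)
      (fun ω => maLoss_nonneg X f (Finset.Icc l u) (w ω) (f + fun i => ε i ω)) hi1 hi2 hi3 hi3
      (∑ j ∈ Finset.Ico k p, t j ^ 2 + 8 * C₂ * S) 1 6 (8 * C₂) 0
      (Eventually.of_forall fun ω => by
        have h1 := hψ.maLoss_mma_le hn hf hl1 hlu hup σ (hw ω)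
        have h2 := hve ω
        simp only [linForm]
        linarith)
    rw [he1, he2, he3] at h1
    rw [hrisk]
    linarith
  · have h1 := integral_le_lincomb (μ := μ)
      (fun ω => maRisk_nonneg X f σ (Finset.Icc l u) (w ω)) hi2 hi3 hi3 hi3
      (k * S + ∑ j ∈ Finset.Ico k p, t j ^ 2 + 5 * C₂ * S) 2 (5 * C₂) 0 0
      (Eventually.of_forall fun ω => by
        have h1 := hψ.maRisk_mma_le hn hf hl1 hlu hup σ (hw ω)
        have h2 := hve ω
        simp only [linForm]
        linarith)
    rw [he2, he3] at h1
    rw [hrisk]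
    linarith

end FixedSampleSize

/-! ### Expected loss and risk when window and weights share the sample. -/

section SameSample

variable {n p : ℕ} {X : Matrix (Fin n) (Fin p) ℝ} {ψ : ℕ → Fin n → ℝ} {f : Fin n → ℝ}
  {t : ℕ → ℝ} {Ω : Type*} [MeasurableSpace Ω] {μ : Measure Ω} [IsProbabilityMeasure μ]
  {σ : ℝ} {η : ℝ≥0} {ε : Fin n → Ω → ℝ} {v : Ω → ℝ} {κl κu C₂ : ℝ}

/-- The budget grows with the upper end `u` of the window, but `u ≤ k + C₂`, and `k S` is part of
the risk `r` of the selected size. Hence the budget is a small multiple of that risk. -/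
theorem window_noise_le {k l u C₂ S r δ z Z : ℝ} (hl : l ≤ k) (hlu : l ≤ u)
    (hu : u - l ≤ C₂) (hS : 0 ≤ S) (hr : k * S ≤ r) (hu0 : 0 ≤ u) (hδ : 0 ≤ δ)
    (hz : z ≤ δ * ((u - l) * (u * S)) + Z) : z ≤ δ * (C₂ * (r + C₂ * S)) + Z := by
  have h1 : u * S ≤ r + C₂ * S := by nlinarith
  have h2 : 0 ≤ C₂ := by linarith
  have h3 : (u - l) * (u * S) ≤ C₂ * (r + C₂ * S) := by
    have : 0 ≤ u * S := by positivity
    gcongr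
  have := mul_le_mul_of_nonneg_left h3 hδ
  linarith

/-- Risk of MMA with the candidates and the weights from the same sample. -/
theorem same_sample_risk_le (hψ : NestedBasis X ψ) (hn : 1 ≤ n) (hf : HasCoords p ψ f t)
    (hκl : 1 < κl) (hκu : 1 < κu) {k : Ω → ℕ} (hkm : Measurable k)
    (hk : ∀ ω, k ω ∈ Finset.Icc 1 p) (hv : MemLp (fun ω => v ω - σ ^ 2) 2 μ)
    (hwin : ∀ᵐ ω ∂μ, (upperSize p κu (k ω) : ℝ) - lowerSize κl (k ω) ≤ C₂)
    {w : Ω → ℕ → ℝ} (hw : ∀ ω, IsMMAWeight X (msCandidates p κl κu (k ω)) (v ω)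
      (f + fun i => ε i ω) (w ω)) {δ : ℝ} (hδ : 0 < δ) {Z : Ω → ℝ} (hZ : Integrable Z μ)
    (hZw : ∀ ω, ∀ l u : ℕ, l ≤ u → u ≤ p → ∑ j ∈ Finset.Ico l u, linForm ε (ψ j) ω ^ 2 / n
          ≤ δ * (((u : ℝ) - l) * (u * (σ ^ 2 / n))) + Z ω) :
    ∫ ω, maRisk X f σ (msCandidates p κl κu (k ω)) (w ω) ∂μ
      ≤ (1 + 2 * δ * C₂) * ∫ ω, msRisk X f σ (k ω) ∂μ + 2 * ∫ ω, Z ω ∂μ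
        + (2 * δ * C₂ ^ 2 + 5 * C₂) * (σ ^ 2 / n)
        + 5 * C₂ * ((1 + ∫ ω, (v ω - σ ^ 2) ^ 2 ∂μ) / n) := by
  have hn' : (0 : ℝ) < n := by exact_mod_cast hn
  have hvi : Integrable (fun ω => (v ω - σ ^ 2) ^ 2) μ := hv.integrable_sq
  have hi3 : Integrable (fun ω => (1 + (v ω - σ ^ 2) ^ 2) / (n : ℝ)) μ :=
    ((integrable_const _).add hvi).div_const _
  have he3 : ∫ ω, (1 + (v ω - σ ^ 2) ^ 2) / (n : ℝ) ∂μ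
      = (1 + ∫ ω, (v ω - σ ^ 2) ^ 2 ∂μ) / n := by
    rw [integral_div, integral_add (integrable_const _) hvi]; simp
  have hR := integrable_of_finite_range (μ := μ) hkm hk (msRisk X f σ)
  have hS0 : 0 ≤ σ ^ 2 / (n : ℝ) := by positivity
  have h1 := integral_le_lincomb (μ := μ)
    (fun ω => maRisk_nonneg X f σ (msCandidates p κl κu (k ω)) (w ω)) hR hZ hi3 hi3
    ((2 * δ * C₂ ^ 2 + 5 * C₂) * (σ ^ 2 / n)) (1 + 2 * δ * C₂) 2 (5 * C₂) 0 (by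
      filter_upwards [hwin] with ω hω
      obtain ⟨hl1, hlk, hku, hup⟩ := candidates_bounds hκl hκu (hk ω)
      have hlu := hlk.trans hku
      have h2 := hψ.maRisk_mma_le hn hf hl1 hlu hup σ (hw ω)
      have hrisk := hψ.msRisk_eq hn hf σ (hk ω)
      have hlk' : (lowerSize κl (k ω) : ℝ) ≤ k ω := by exact_mod_cast hlk
      have hlu' : (lowerSize κl (k ω) : ℝ) ≤ upperSize p κu (k ω) := by exact_mod_cast hlu
      have hT : ∑ j ∈ Finset.Ico (upperSize p κu (k ω)) p, t j ^ 2
          ≤ ∑ j ∈ Finset.Ico (k ω) p, t j ^ 2 :=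
        Finset.sum_le_sum_of_subset_of_nonneg (Finset.Ico_subset_Ico hku le_rfl)
          fun _ _ _ => sq_nonneg _
      have hT0 : 0 ≤ ∑ j ∈ Finset.Ico (k ω) p, t j ^ 2 := Finset.sum_nonneg fun _ _ => sq_nonneg _
      have hls := mul_le_mul_of_nonneg_right hlk' hS0
      have h3 := window_noise_le hlk' hlu' hω hS0 (r := msRisk X f σ (k ω))
        (by rw [hrisk]; linarith) (Nat.cast_nonneg _) hδ.le (hZw ω _ _ hlu hup)
      have h4 := excess_variance_le hn σ (v ω) hω (sub_nonneg.2 hlu')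
      change maRisk X f σ (Finset.Icc _ _) (w ω) ≤ _
      simp only [linForm] at h3
      linarith)
  rw [he3] at h1
  linarith

/-- Loss of MMA with the candidates and the weights from the same sample. -/
theorem same_sample_loss_le (hψ : NestedBasis X ψ) (hn : 1 ≤ n) (hf : HasCoords p ψ f t)
    (hε : IsNoise μ σ η ε)
    (hκl : 1 < κl) (hκu : 1 < κu) {k : Ω → ℕ} (hkm : Measurable k)
    (hk : ∀ ω, k ω ∈ Finset.Icc 1 p) (hv : MemLp (fun ω => v ω - σ ^ 2) 2 μ)
    (hwin : ∀ᵐ ω ∂μ, (upperSize p κu (k ω) : ℝ) - lowerSize κl (k ω) ≤ C₂)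
    {w : Ω → ℕ → ℝ} (hw : ∀ ω, IsMMAWeight X (msCandidates p κl κu (k ω)) (v ω)
      (f + fun i => ε i ω) (w ω)) {δ : ℝ} (hδ : 0 < δ) {Z : Ω → ℝ} (hZ : Integrable Z μ)
    (hZw : ∀ ω, ∀ l u : ℕ, l ≤ u → u ≤ p → ∑ j ∈ Finset.Ico l u, linForm ε (ψ j) ω ^ 2 / n
          ≤ δ * (((u : ℝ) - l) * (u * (σ ^ 2 / n))) + Z ω)
    {m : ℕ} (hm : IsOptSize X f σ m) {B : ℝ} (hB : 0 < B) {Y : Ω → ℝ} (hY : Integrable Y μ)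
    (hYp : ∀ ω, ∀ l ≤ p, ∑ j ∈ Finset.range l, linForm ε (ψ j) ω ^ 2 / n
          ≤ ∑ j ∈ Finset.range m, linForm ε (ψ j) ω ^ 2 / n
            + B * (max 0 ((l : ℝ) - m) * (σ ^ 2 / n)) + Y ω)
    {b : ℝ} (htail : ∀ k ∈ Finset.Icc 1 p, ∑ j ∈ Finset.Ico k p, t j ^ 2
        ≤ ∑ j ∈ Finset.Ico m p, t j ^ 2 + b + 2 * (msRisk X f σ k - msRisk X f σ m)) :
    ∫ ω, maLoss X f (msCandidates p κl κu (k ω)) (w ω) (f + fun i => ε i ω) ∂μ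
      ≤ m * (σ ^ 2 / n) + b + (B + 1) * ∑ j ∈ Finset.Ico m p, t j ^ 2
        + (B + 2) * (∫ ω, msRisk X f σ (k ω) ∂μ - msRisk X f σ m)
        + 6 * δ * C₂ * ∫ ω, msRisk X f σ (k ω) ∂μ + (∫ ω, Y ω ∂μ + 6 * ∫ ω, Z ω ∂μ)
        + (6 * δ * C₂ ^ 2 + 8 * C₂) * (σ ^ 2 / n)
        + 8 * C₂ * ((1 + ∫ ω, (v ω - σ ^ 2) ^ 2 ∂μ) / n) := by
  have hn' : (0 : ℝ) < n := by exact_mod_cast hn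
  have hvi : Integrable (fun ω => (v ω - σ ^ 2) ^ 2) μ := hv.integrable_sq
  have hi3 : Integrable (fun ω => (1 + (v ω - σ ^ 2) ^ 2) / (n : ℝ)) μ :=
    ((integrable_const _).add hvi).div_const _
  have he3 : ∫ ω, (1 + (v ω - σ ^ 2) ^ 2) / (n : ℝ) ∂μ
      = (1 + ∫ ω, (v ω - σ ^ 2) ^ 2 ∂μ) / n := by
    rw [integral_div, integral_add (integrable_const _) hvi]; simp
  have hR := integrable_of_finite_range (μ := μ) hkm hk (msRisk X f σ)
  have hS0 : 0 ≤ σ ^ 2 / (n : ℝ) := by positivity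
  have hmp := (Finset.mem_Icc.1 hm.1).2
  have hYZ : Integrable (fun ω => Y ω + 6 * Z ω) μ := hY.add (hZ.const_mul 6)
  have heYZ : ∫ ω, (Y ω + 6 * Z ω) ∂μ = ∫ ω, Y ω ∂μ + 6 * ∫ ω, Z ω ∂μ := by
    rw [integral_add hY (hZ.const_mul 6), integral_const_mul]
  have hi1 := hε.integrable_sum_sq ψ (Finset.range m)
  have he1 := hε.integral_sum_sq hψ (J := Finset.range m) fun j hj => by
    have := Finset.mem_range.1 hj; omega
  rw [Finset.card_range] at he1
  have hriskm := hψ.msRisk_eq hn hf σ hm.1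
  set T := ∑ j ∈ Finset.Ico m p, t j ^ 2 with hT_def
  have hT0 : 0 ≤ T := Finset.sum_nonneg fun _ _ => sq_nonneg _
  have h1 := integral_le_lincomb (μ := μ)
    (fun ω => maLoss_nonneg X f (msCandidates p κl κu (k ω)) (w ω) (f + fun i => ε i ω))
    hi1 hR hYZ hi3
    (b + (B + 1) * T - (B + 2) * msRisk X f σ m + (6 * δ * C₂ ^ 2 + 8 * C₂) * (σ ^ 2 / n))
    1 (B + 2 + 6 * δ * C₂) 1 (8 * C₂) (by
      filter_upwards [hwin] with ω hω
      obtain ⟨hl1, hlk, hku, hup⟩ := candidates_bounds hκl hκu (hk ω)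
      have hlu := hlk.trans hku
      have h2 := hψ.maLoss_mma_le hn hf hl1 hlu hup σ (hw ω)
      have hrisk := hψ.msRisk_eq hn hf σ (hk ω)
      have hlk' : (lowerSize κl (k ω) : ℝ) ≤ k ω := by exact_mod_cast hlk
      have hlu' : (lowerSize κl (k ω) : ℝ) ≤ upperSize p κu (k ω) := by exact_mod_cast hlu
      have hT : ∑ j ∈ Finset.Ico (upperSize p κu (k ω)) p, t j ^ 2
          ≤ ∑ j ∈ Finset.Ico (k ω) p, t j ^ 2 :=
        Finset.sum_le_sum_of_subset_of_nonneg (Finset.Ico_subset_Ico hku le_rfl)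
          fun _ _ _ => sq_nonneg _
      have hTk := htail (k ω) (hk ω)
      have hTk0 : 0 ≤ ∑ j ∈ Finset.Ico (k ω) p, t j ^ 2 :=
        Finset.sum_nonneg fun _ _ => sq_nonneg _
      have hgap := hm.2 (k ω) (hk ω)
      have h3 := window_noise_le hlk' hlu' hω hS0 (r := msRisk X f σ (k ω))
        (by rw [hrisk]; linarith) (Nat.cast_nonneg _) hδ.le (hZw ω _ _ hlu hup)
      have h4 := excess_variance_le hn σ (v ω) hω (sub_nonneg.2 hlu')
      have h5 := hYp ω (lowerSize κl (k ω)) (hlu.trans hup)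
      -- Overshooting `m` costs variance, which the excess risk pays for up to the tail `T` that the
      -- larger model may have removed.
      have h6 : max 0 ((lowerSize κl (k ω) : ℝ) - m) * (σ ^ 2 / n)
          ≤ msRisk X f σ (k ω) - msRisk X f σ m + T := by
        rcases le_total (lowerSize κl (k ω) : ℝ) m with h | h
        · rw [max_eq_left (by linarith), zero_mul]; linarith
        · rw [max_eq_right (by linarith), hrisk, hriskm]
          have := mul_le_mul_of_nonneg_right hlk' hS0
          linarith
      have h7 := mul_le_mul_of_nonneg_left h6 hB.le
      change maLoss X f (Finset.Icc _ _) (w ω) (f + fun i => ε i ω) ≤ _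
      simp only [linForm] at h3 h5 ⊢
      linarith)
  rw [he3, heYZ, he1] at h1
  linarith

end SameSample

/-! ### Assembly of the fast decay bound. -/

/-- `N` is the intermediate scale `m* σ² / n`: for `δ ≤ 1 / 2` the lower bound on `R` inverts to `N
≤ (1 + 2 δ) R`, and the error `K δ` is then made small. -/
theorem asympLe_of_linear {Q R N : ℕ → ℝ} {K : ℝ} (hK : 0 ≤ K)
    (h : ∀ δ : ℝ, 0 < δ → δ ≤ 1 / 2 →
      ∀ᶠ n in atTop, 0 < N n ∧ (1 - δ) * N n ≤ R n ∧ Q n ≤ (1 + K * δ) * N n) :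
    AsympLe Q R := by
  refine asympLe_of_forall ?_ fun ρ hρ => ?_
  · filter_upwards [h (1 / 2) (by norm_num) le_rfl] with n hn
    linarith [hn.1, hn.2.1]
  · set δ := min (1 / 2) (ρ / (2 * K + 2)) with hδ
    have hδ0 : 0 < δ := lt_min (by norm_num) (by positivity)
    have hδ1 : δ ≤ 1 / 2 := min_le_left _ _
    have hδ2 : (2 * K + 2) * δ ≤ ρ := by
      have := min_le_right (1 / 2) (ρ / (2 * K + 2))
      rw [← hδ, le_div_iff₀ (by positivity)] at this
      linarith
    filter_upwards [h δ hδ0 hδ1] with n hn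
    obtain ⟨h1, h2, h3⟩ := hn
    have hR : 0 < R n := by nlinarith
    have h4 : N n ≤ (1 + 2 * δ) * R n := by
      have h5 : 0 ≤ δ * (1 - 2 * δ) * N n := by
        have : 0 ≤ 1 - 2 * δ := by linarith
        positivity
      have h6 : (1 + 2 * δ) * ((1 - δ) * N n) ≤ (1 + 2 * δ) * R n := by gcongr
      linarith
    have hKδ : 0 ≤ K * δ := by positivity
    calc Q n ≤ (1 + K * δ) * N n := h3
      _ ≤ (1 + K * δ) * ((1 + 2 * δ) * R n) := by gcongr
      _ = ((1 + K * δ) * (1 + 2 * δ)) * R n := by ring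
      _ ≤ (1 + ρ) * R n := by
        gcongr
        nlinarith

theorem fast_decay_upper_bound
    {Ω : Type*} [MeasurableSpace Ω] (μ : Measure Ω) [IsProbabilityMeasure μ]
    (p : ℕ → ℕ) (X : (n : ℕ) → Matrix (Fin n) (Fin (p n)) ℝ) (f : (n : ℕ) → Fin n → ℝ)
    (σ : ℝ) (hσ : 0 < σ) (η : ℝ≥0) (ε : (n : ℕ) → Fin n → Ω → ℝ)
    (hε : ∀ n, IsNoise μ σ η (ε n))
    (θ : ℕ → ℝ) (hθ_ord : ∀ j, 1 ≤ j → 0 < |θ j| ∧ |θ (j + 1)| ≤ |θ j|)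
    (ψ : (n : ℕ) → ℕ → Fin n → ℝ) (hψ : ∀ n, NestedBasis (X n) (ψ n))
    (hf : ∀ n, 1 ≤ n → HasCoords (p n) (ψ n) (f n) fun j => θ (j + 1))
    (mstar : ℕ → ℕ) (hmstar : ∀ n, 1 ≤ n → IsOptSize (X n) (f n) σ (mstar n))
    (κl κu : ℕ → ℝ) (hκl : ∀ n, 1 < κl n) (hκu : ∀ n, 1 < κu n)
    (s2 : ℕ → Ω → ℝ) (what : ℕ → Finset ℕ → Ω → ℕ → ℝ)
    (hwhat : ∀ n (K : Finset ℕ), K.Nonempty → K ⊆ Finset.Icc 1 (p n) →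
      ∀ ω, IsMMAWeight (X n) K (s2 n ω) (f n + fun i => ε n i ω) (what n K ω))
    (hfast : FastDecay θ) (mhat : ℕ → Ω → ℕ) (hmhat_meas : ∀ n, Measurable (mhat n))
    (hmhat : ∀ n, 1 ≤ n → ∀ ω, mhat n ω ∈ Finset.Icc 1 (p n))
    (hmstar_top : Tendsto mstar atTop atTop)
    (hratio : Tendsto (fun n => (∫ ω, msRisk (X n) (f n) σ (mhat n ω) ∂μ)
        / msRisk (X n) (f n) σ (mstar n)) atTop (𝓝 1))
    {C₂ : ℝ} (hC₂ : 1 ≤ C₂) (hwin : ∀ n, ∀ᵐ ω ∂μ,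
        (upperSize (p n) (κu n) (mhat n ω) : ℝ) - (lowerSize (κl n) (mhat n ω) : ℝ) ≤ C₂)
    (hs2 : ∀ n, MemLp (fun ω => s2 n ω - σ ^ 2) 2 μ)
    (hs2o : (fun n : ℕ => (p n : ℝ) * ∫ ω, (s2 n ω - σ ^ 2) ^ 2 ∂μ)
        =o[atTop] (fun n : ℕ => (n : ℝ) * fullOptRisk (X n) (f n) σ)) :
    AsympLe
        (fun n => ∫ ω', (∫ ω, maLoss (X n) (f n) (msCandidates (p n) (κl n) (κu n) (mhat n ω'))
            (what n (msCandidates (p n) (κl n) (κu n) (mhat n ω')) ω)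
            (f n + fun i => ε n i ω) ∂μ) ∂μ)
        (fun n => fullOptRisk (X n) (f n) σ) ∧
      AsympLe
        (fun n => ∫ ω', (∫ ω, maRisk (X n) (f n) σ
            (msCandidates (p n) (κl n) (κu n) (mhat n ω'))
            (what n (msCandidates (p n) (κl n) (κu n) (mhat n ω')) ω) ∂μ) ∂μ)
        (fun n => fullOptRisk (X n) (f n) σ) ∧
      AsympLe
        (fun n => ∫ ω, maLoss (X n) (f n) (msCandidates (p n) (κl n) (κu n) (mhat n ω))
            (what n (msCandidates (p n) (κl n) (κu n) (mhat n ω)) ω)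
            (f n + fun i => ε n i ω) ∂μ)
        (fun n => fullOptRisk (X n) (f n) σ) ∧
      AsympLe
        (fun n => ∫ ω, maRisk (X n) (f n) σ (msCandidates (p n) (κl n) (κu n) (mhat n ω))
            (what n (msCandidates (p n) (κl n) (κu n) (mhat n ω)) ω) ∂μ)
        (fun n => fullOptRisk (X n) (f n) σ) := by
  have hA : ∀ j, 1 ≤ j → 0 < θ j ^ 2 ∧ θ (j + 1) ^ 2 ≤ θ j ^ 2 := fun j hj => by
    obtain ⟨h1, h2⟩ := hθ_ord j hj
    exact ⟨by rw [← sq_abs]; positivity, sq_le_sq.2 h2⟩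
  have hw : ∀ n, 1 ≤ n → ∀ k ∈ Finset.Icc 1 (p n), ∀ ω,
      IsMMAWeight (X n) (msCandidates (p n) (κl n) (κu n) k) (s2 n ω) (f n + fun i => ε n i ω)
        (what n (msCandidates (p n) (κl n) (κu n) k) ω) := by
    intro n hn k hk ω
    obtain ⟨hl1, hlk, hku, hup⟩ := candidates_bounds (hκl n) (hκu n) hk
    exact hwhat n _ ⟨k, Finset.mem_Icc.2 ⟨hlk, hku⟩⟩ (Finset.Icc_subset_Icc hl1 hup) ω
  set N : ℕ → ℝ := fun n => mstar n * (σ ^ 2 / n) with hN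
  set E : ℕ → ℝ := fun n => ∫ ω, msRisk (X n) (f n) σ (mhat n ω) ∂μ with hE
  set v : ℕ → ℝ := fun n => (1 + ∫ ω, (s2 n ω - σ ^ 2) ^ 2 ∂μ) / n with hv
  have package : ∀ δ : ℝ, 0 < δ → δ ≤ 1 / 2 → ∀ᶠ n : ℕ in atTop,
      1 ≤ n ∧ 0 < N n ∧ (1 - δ) * N n ≤ fullOptRisk (X n) (f n) σ ∧
      σ ^ 2 / n ≤ δ ^ 3 * N n ∧ E n ≤ (1 + 3 * δ) * N n ∧
      E n - msRisk (X n) (f n) σ (mstar n) ≤ 2 * δ * N n ∧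
      v n ≤ (1 / σ ^ 2 + 2) * δ * N n ∧
      ∑ j ∈ Finset.Ico (mstar n) (p n), θ (j + 1) ^ 2 ≤ δ * N n ∧
      ∀ k ∈ Finset.Icc 1 (p n), ∑ j ∈ Finset.Ico k (p n), θ (j + 1) ^ 2
        ≤ ∑ j ∈ Finset.Ico (mstar n) (p n), θ (j + 1) ^ 2 + δ * N n
          + 2 * (msRisk (X n) (f n) σ k - msRisk (X n) (f n) σ (mstar n)) := by
    intro δ hδ hδ2
    have hδ3 : δ ^ 3 ≤ δ := by
      have : δ ^ 2 ≤ 1 := by nlinarith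
      nlinarith
    -- Accuracy `δ³` rather than `δ`, because the remainder of `exists_window_bound` carries a
    -- factor `δ⁻²` and must still be `O(δ N)`.
    obtain ⟨M, hM⟩ := exists_fast_decay_facts hA hfast hσ (pow_pos hδ 3)
      (hδ3.trans_lt (by linarith))
    have hr := hratio.eventually_le_const (by linarith : (1 : ℝ) < 1 + δ)
    filter_upwards [hr, hs2o.bound hδ, hmstar_top.eventually_ge_atTop M, eventually_ge_atTop 1]
      with n hr hs hm hn
    have hn' : (0 : ℝ) < n := by exact_mod_cast hn
    have hopt := hmstar n hn
    have hmIcc := Finset.mem_Icc.1 hopt.1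
    obtain ⟨f1, f2, f3, f4⟩ := hM (X n) (f n) (ψ n) (mstar n) (hψ n) (hf n hn) hn hm hopt
    have hm0 : (1 : ℝ) ≤ mstar n := by exact_mod_cast hmIcc.1
    have hN0 : 0 < N n := by simp only [hN]; positivity
    have hδN : δ ^ 3 * N n ≤ δ * N n := by gcongr
    have hrisk : msRisk (X n) (f n) σ (mstar n)
        = N n + ∑ j ∈ Finset.Ico (mstar n) (p n), θ (j + 1) ^ 2 :=
      (hψ n).msRisk_eq hn (hf n hn) σ hopt.1
    have hT0 : 0 ≤ ∑ j ∈ Finset.Ico (mstar n) (p n), θ (j + 1) ^ 2 :=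
      Finset.sum_nonneg fun _ _ => sq_nonneg _
    have hT : ∑ j ∈ Finset.Ico (mstar n) (p n), θ (j + 1) ^ 2 ≤ δ * N n := f1.trans hδN
    have hR0 : 0 < msRisk (X n) (f n) σ (mstar n) := by linarith
    have hR2 : msRisk (X n) (f n) σ (mstar n) ≤ (1 + δ) * N n := by linarith
    have hE1 : E n ≤ (1 + δ) * msRisk (X n) (f n) σ (mstar n) := (div_le_iff₀ hR0).1 hr
    have hR3 : δ * msRisk (X n) (f n) σ (mstar n) ≤ 2 * δ * N n := by
      have : (1 + δ) * N n ≤ 2 * N n := by gcongr; linarith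
      calc δ * msRisk (X n) (f n) σ (mstar n) ≤ δ * (2 * N n) := by gcongr; linarith
        _ = _ := by ring
    have hopt_le := (hψ n).fullOptRisk_le_msRisk hn (hf n hn) σ hopt.1
    have hlow : (1 - δ) * N n ≤ fullOptRisk (X n) (f n) σ := by
      refine le_trans ?_ f2
      change (1 - δ) * N n ≤ (1 - δ ^ 3) * N n
      gcongr
    refine ⟨hn, hN0, hlow, f4, ?_, by linarith, ?_, hT, fun k hk => ?_⟩
    · linarith
    · have hI0 : 0 ≤ ∫ ω, (s2 n ω - σ ^ 2) ^ 2 ∂μ := integral_nonneg fun ω => sq_nonneg _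
      have hopt0 : 0 ≤ fullOptRisk (X n) (f n) σ := by
        have : 0 ≤ 1 - δ := by linarith
        have := mul_nonneg this hN0.le
        linarith
      rw [Real.norm_of_nonneg (by positivity), Real.norm_of_nonneg (by positivity)] at hs
      have hp1 : (1 : ℝ) ≤ p n := by exact_mod_cast hmIcc.1.trans hmIcc.2
      -- Windows have bounded width, so the factor `p n ≥ 1` in the assumption can be dropped.
      have h1 : ∫ ω, (s2 n ω - σ ^ 2) ^ 2 ∂μ ≤ δ * (n * fullOptRisk (X n) (f n) σ) := by
        nlinarith
      have h2 : (∫ ω, (s2 n ω - σ ^ 2) ^ 2 ∂μ) / n ≤ δ * fullOptRisk (X n) (f n) σ := by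
        rw [div_le_iff₀ hn']; linarith
      have h3 : δ * fullOptRisk (X n) (f n) σ ≤ 2 * δ * N n :=
        le_trans (by gcongr) hR3
      have h4 : 1 / (n : ℝ) = 1 / σ ^ 2 * (σ ^ 2 / n) := by field_simp
      have h5 : 1 / (n : ℝ) ≤ 1 / σ ^ 2 * (δ * N n) := by
        rw [h4]
        have : σ ^ 2 / n ≤ δ * N n := f4.trans hδN
        gcongr
      simp only [hv]
      rw [add_div]
      linarith
    · have := f3 k hk
      change _ ≤ _ + δ ^ 3 * N n + _ at this
      linarith
  have hsmall : ∀ {δ S M : ℝ}, 0 < δ → δ ≤ 1 / 2 → 0 < M → S ≤ δ ^ 3 * M → S ≤ δ * M := by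
    intro δ S M hδ hδ2 hM hS
    have h1 : δ ^ 3 ≤ δ := by
      have : δ ^ 2 ≤ 1 := by nlinarith
      nlinarith
    exact hS.trans (by gcongr)
  set c₁ := 1 / σ ^ 2 + 2 with hc₁
  have hc₁0 : 0 < c₁ := by positivity
  have hC0 : 0 < C₂ := by linarith
  have hcond : ∀ n, 1 ≤ n → ∀ F : ℕ → ℝ, (∀ k, 0 ≤ F k) →
      (∀ k ∈ Finset.Icc 1 (p n), (upperSize (p n) (κu n) k : ℝ) - lowerSize (κl n) k ≤ C₂ →
        F k ≤ msRisk (X n) (f n) σ k + C₂ * (14 * (σ ^ 2 / n) + 8 * v n)) →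
      ∫ ω, F (mhat n ω) ∂μ ≤ E n + C₂ * (14 * (σ ^ 2 / n) + 8 * v n) := by
    intro n hn F hF0 hF
    have hR := integrable_of_finite_range (μ := μ) (hmhat_meas n) (hmhat n hn)
      (msRisk (X n) (f n) σ)
    have h1 := integral_le_lincomb (μ := μ) (fun ω => hF0 (mhat n ω)) hR hR hR hR
      (C₂ * (14 * (σ ^ 2 / n) + 8 * v n)) 1 0 0 0 (by
        filter_upwards [hwin n] with ω hω
        linarith [hF (mhat n ω) (hmhat n hn ω) hω])
    linarith
  -- The inner expectation depends on `ω'` only through the selected size, so a bound for each fixed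
  -- size is averaged over `mhat`.
  have hplug : ∀ F : ℕ → ℕ → ℝ, (∀ n k, 0 ≤ F n k) →
      (∀ n, 1 ≤ n → ∀ k ∈ Finset.Icc 1 (p n),
        (upperSize (p n) (κu n) k : ℝ) - lowerSize (κl n) k ≤ C₂ →
        F n k ≤ msRisk (X n) (f n) σ k + C₂ * (14 * (σ ^ 2 / n) + 8 * v n)) →
      AsympLe (fun n => ∫ ω, F n (mhat n ω) ∂μ) (fun n => fullOptRisk (X n) (f n) σ) := by
    intro F hF0 hF
    refine asympLe_of_linear (N := N) (K := 3 + C₂ * (14 + 8 * c₁)) (by positivity)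
      fun δ hδ hδ2 => ?_
    filter_upwards [package δ hδ hδ2] with n ⟨hn, hN0, hlow, hS, hE1, hE2, hv1, hT, hk⟩
    refine ⟨hN0, hlow, ?_⟩
    have h1 := hcond n hn (F n) (hF0 n) (hF n hn)
    have hS' := hsmall hδ hδ2 hN0 hS
    have h2 : C₂ * (14 * (σ ^ 2 / n) + 8 * v n) ≤ C₂ * (14 * (δ * N n) + 8 * (c₁ * δ * N n)) := by
      gcongr
    linarith
  refine ⟨?_, ?_, ?_, ?_⟩
  · refine hplug (fun n k => ∫ ω, maLoss (X n) (f n) (msCandidates (p n) (κl n) (κu n) k)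
      (what n (msCandidates (p n) (κl n) (κu n) k) ω) (f n + fun i => ε n i ω) ∂μ)
      (fun n k => integral_nonneg fun ω => maLoss_nonneg _ _ _ _ _) fun n hn k hk hwk => ?_
    exact (fixed_candidates_bound (hψ n) hn (hf n hn) (hε n) (hκl n) (hκu n) hk (hs2 n) hwk
      (hw n hn k hk)).1
  · refine hplug (fun n k => ∫ ω, maRisk (X n) (f n) σ (msCandidates (p n) (κl n) (κu n) k)
      (what n (msCandidates (p n) (κl n) (κu n) k) ω) ∂μ)
      (fun n k => integral_nonneg fun ω => maRisk_nonneg _ _ _ _ _) fun n hn k hk hwk => ?_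
    exact (fixed_candidates_bound (hψ n) hn (hf n hn) (hε n) (hκl n) (hκu n) hk (hs2 n) hwk
      (hw n hn k hk)).2
  · obtain ⟨D, hD, hwindow⟩ := exists_window_bound η hσ
    obtain ⟨B, D', hB, hD', hprefix⟩ := exists_prefix_bound η hσ
    refine asympLe_of_linear (N := N)
      (K := 1 + (B + 1) + 2 * (B + 2) + 18 * C₂ + D' + 6 * D + (6 * C₂ ^ 2 + 8 * C₂)
        + 8 * C₂ * c₁) (by positivity) fun δ hδ hδ2 => ?_
    filter_upwards [package δ hδ hδ2] with n ⟨hn, hN0, hlow, hS, hE1, hE2, hv1, hT, hk⟩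
    refine ⟨hN0, hlow, ?_⟩
    have hn' : (0 : ℝ) < n := by exact_mod_cast hn
    have hopt := hmstar n hn
    obtain ⟨Z, hZ, hZi, hZw⟩ := hwindow μ (ε n) (hε n) hn (p n) (X n) (ψ n) (hψ n) δ hδ
    obtain ⟨Y, hY, hYi, hYp⟩ := hprefix μ (ε n) (hε n) hn (p n) (X n) (ψ n) (hψ n) (mstar n)
      (Finset.mem_Icc.1 hopt.1).2
    have h1 := same_sample_loss_le (hψ n) hn (hf n hn) (hε n) (hκl n) (hκu n) (hmhat_meas n)
      (hmhat n hn) (hs2 n) (hwin n) (fun ω => hw n hn _ (hmhat n hn ω) ω) hδ hZ hZw hopt hB hY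
      hYp hk
    refine h1.trans ?_
    change N n + δ * N n + (B + 1) * ∑ j ∈ Finset.Ico (mstar n) (p n), θ (j + 1) ^ 2
      + (B + 2) * (E n - msRisk (X n) (f n) σ (mstar n)) + 6 * δ * C₂ * E n
      + (∫ ω, Y ω ∂μ + 6 * ∫ ω, Z ω ∂μ) + (6 * δ * C₂ ^ 2 + 8 * C₂) * (σ ^ 2 / n)
      + 8 * C₂ * v n ≤ _
    have hS' := hsmall hδ hδ2 hN0 hS
    have hS0 : 0 ≤ σ ^ 2 / (n : ℝ) := by positivity
    have b1 : (B + 1) * ∑ j ∈ Finset.Ico (mstar n) (p n), θ (j + 1) ^ 2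
        ≤ (B + 1) * (δ * N n) := by gcongr
    have b2 : (B + 2) * (E n - msRisk (X n) (f n) σ (mstar n)) ≤ (B + 2) * (2 * δ * N n) := by
      gcongr
    have b3 : 6 * δ * C₂ * E n ≤ 6 * δ * C₂ * (3 * N n) := by
      have : E n ≤ 3 * N n := hE1.trans (by gcongr; linarith)
      gcongr
    have b4 : ∫ ω, Y ω ∂μ ≤ D' * (δ * N n) := hYi.trans (by gcongr)
    have b5 : ∫ ω, Z ω ∂μ ≤ D * (δ * N n) := by
      refine hZi.trans ?_
      rw [div_le_iff₀ (by positivity)]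
      calc D * (σ ^ 2 / n) ≤ D * (δ ^ 3 * N n) := by gcongr
        _ = _ := by ring
    have b6 : (6 * δ * C₂ ^ 2 + 8 * C₂) * (σ ^ 2 / n) ≤ (6 * C₂ ^ 2 + 8 * C₂) * (δ * N n) := by
      have : 6 * δ * C₂ ^ 2 ≤ 6 * C₂ ^ 2 := by
        have : 0 ≤ C₂ ^ 2 := by positivity
        nlinarith
      gcongr
    have b7 : 8 * C₂ * v n ≤ 8 * C₂ * (c₁ * δ * N n) := by gcongr
    linarith
  · obtain ⟨D, hD, hwindow⟩ := exists_window_bound η hσ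
    refine asympLe_of_linear (N := N)
      (K := 3 + 6 * C₂ + 2 * D + (2 * C₂ ^ 2 + 5 * C₂) + 5 * C₂ * c₁) (by positivity)
      fun δ hδ hδ2 => ?_
    filter_upwards [package δ hδ hδ2] with n ⟨hn, hN0, hlow, hS, hE1, hE2, hv1, hT, hk⟩
    refine ⟨hN0, hlow, ?_⟩
    obtain ⟨Z, hZ, hZi, hZw⟩ := hwindow μ (ε n) (hε n) hn (p n) (X n) (ψ n) (hψ n) δ hδ
    have h1 := same_sample_risk_le (hψ n) hn (hf n hn) (hκl n) (hκu n) (hmhat_meas n)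
      (hmhat n hn) (hs2 n) (hwin n) (fun ω => hw n hn _ (hmhat n hn ω) ω) hδ hZ hZw
    refine h1.trans ?_
    change (1 + 2 * δ * C₂) * E n + 2 * ∫ ω, Z ω ∂μ
      + (2 * δ * C₂ ^ 2 + 5 * C₂) * (σ ^ 2 / n) + 5 * C₂ * v n ≤ _
    have hS' := hsmall hδ hδ2 hN0 hS
    have hS0 : 0 ≤ σ ^ 2 / (n : ℝ) := by positivity
    have b3 : 2 * δ * C₂ * E n ≤ 2 * δ * C₂ * (3 * N n) := by
      have : E n ≤ 3 * N n := hE1.trans (by gcongr; linarith)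
      gcongr
    have b5 : ∫ ω, Z ω ∂μ ≤ D * (δ * N n) := by
      refine hZi.trans ?_
      rw [div_le_iff₀ (by positivity)]
      calc D * (σ ^ 2 / n) ≤ D * (δ ^ 3 * N n) := by gcongr
        _ = _ := by ring
    have b6 : (2 * δ * C₂ ^ 2 + 5 * C₂) * (σ ^ 2 / n) ≤ (2 * C₂ ^ 2 + 5 * C₂) * (δ * N n) := by
      have : 2 * δ * C₂ ^ 2 ≤ 2 * C₂ ^ 2 := by
        have : 0 ≤ C₂ ^ 2 := by positivity
        nlinarith
      gcongr
    have b7 : 5 * C₂ * v n ≤ 5 * C₂ * (c₁ * δ * N n) := by gcongr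
    linarith

end MallowsMA

theorem mainTheorem12
    {Ω : Type*} [MeasurableSpace Ω] (μ : Measure Ω) [IsProbabilityMeasure μ]
    -- the linear models: for each sample size `n`, `y = f + ε` with `f = X β`
    (p : ℕ → ℕ) (hp_pos : ∀ n, 1 ≤ n → 1 ≤ p n) (hp_le : ∀ n, p n ≤ n)
    (X : (n : ℕ) → Matrix (Fin n) (Fin (p n)) ℝ) (hX : ∀ n, (X n).rank = p n)
    (β : (n : ℕ) → Fin (p n) → ℝ)
    (f : (n : ℕ) → Fin n → ℝ) (hf : ∀ n, f n = X n *ᵥ β n)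
    -- the noise: i.i.d., centred, with variance `σ²`, sub-Gaussian
    (σ : ℝ) (hσ : 0 < σ) (η : ℝ≥0)
    (ε : (n : ℕ) → Fin n → Ω → ℝ)
    (hε_meas : ∀ n i, Measurable (ε n i))
    (hε_indep : ∀ n, iIndepFun (ε n) μ)
    (hε_ident : ∀ n i j, IdentDistrib (ε n i) (ε n j) μ μ)
    (hε_mean : ∀ n i, ∫ ω, ε n i ω ∂μ = 0)
    (hε_var : ∀ n i, ∫ ω, ε n i ω ^ 2 ∂μ = σ ^ 2)
    (hε_subG : ∀ n i, HasSubgaussianMGF (ε n i) η μ)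
    (y : (n : ℕ) → Ω → Fin n → ℝ) (hy : ∀ n ω i, y n ω i = f n i + ε n i ω)
    -- the regression mean vectors are square summable
    (hf_bdd : IsBoundedUnder (· ≤ ·) atTop fun n : ℕ => MallowsMA.sqNorm (f n) / n)
    -- the transformed coefficients `θ 1, θ 2, …` and their complete ordering
    (φ : (n : ℕ) → Fin (p n) → Fin n → ℝ)
    (hφ : ∀ n, MallowsMA.IsNestedEigenbasis (X n) (φ n))
    (θ : ℕ → ℝ)
    (hθ : ∀ n (j : Fin (p n)), MallowsMA.transCoef (φ n) (f n) j = θ ((j : ℕ) + 1))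
    (hθ_ord : ∀ j, 1 ≤ j → 0 < |θ j| ∧ |θ (j + 1)| ≤ |θ j|)
    -- the size of an optimal nested model
    (mstar : ℕ → ℕ) (hmstar : ∀ n, 1 ≤ n → MallowsMA.IsOptSize (X n) (f n) σ (mstar n))
    -- the bounded widening factors
    (κl κu : ℕ → ℝ) (hκl : ∀ n, 1 < κl n) (hκu : ∀ n, 1 < κu n)
    (C : ℝ) (hκ_bdd : ∀ n, max (κl n) (κu n) ≤ C)
    -- the variance estimator and the MMA weights on every nested candidate set
    (s2 : ℕ → Ω → ℝ) (hs2_meas : ∀ n, Measurable (s2 n))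
    (what : ℕ → Finset ℕ → Ω → ℕ → ℝ)
    (hwhat_meas : ∀ n K, Measurable (what n K))
    (hwhat : ∀ n (K : Finset ℕ), K.Nonempty → K ⊆ Finset.Icc 1 (p n) →
      ∀ ω, MallowsMA.IsMMAWeight (X n) K (s2 n ω) (y n ω) (what n K ω)) :
    -- slow decay, candidate set centred at the optimal size itself
    (MallowsMA.SlowDecay θ →
      (∀ᶠ n : ℕ in atTop, θ (p n + 1) ^ 2 ≤ σ ^ 2 / n) →
      ∃ c : ℝ, 0 < c ∧ ∀ᶠ n : ℕ in atTop,
        c * MallowsMA.fullOptRisk (X n) (f n) σ ≤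
          (∫ ω, MallowsMA.maRisk (X n) (f n) σ
              (MallowsMA.msCandidates (p n) (κl n) (κu n) (mstar n))
              (what n (MallowsMA.msCandidates (p n) (κl n) (κu n) (mstar n)) ω) ∂μ)
            - MallowsMA.fullOptRisk (X n) (f n) σ) ∧
    -- fast decay, candidate set centred at an estimated size
    (MallowsMA.FastDecay θ →
      ∀ mhat : ℕ → Ω → ℕ, (∀ n, Measurable (mhat n)) →
      (∀ n, 1 ≤ n → ∀ ω, mhat n ω ∈ Finset.Icc 1 (p n)) →
      Tendsto mstar atTop atTop →
      Tendsto (fun n => (∫ ω, MallowsMA.msRisk (X n) (f n) σ (mhat n ω) ∂μ)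
        / MallowsMA.msRisk (X n) (f n) σ (mstar n)) atTop (𝓝 1) →
      (∃ C₂ : ℝ, 1 ≤ C₂ ∧ ∀ n, ∀ᵐ ω ∂μ,
        (MallowsMA.upperSize (p n) (κu n) (mhat n ω) : ℝ)
          - (MallowsMA.lowerSize (κl n) (mhat n ω) : ℝ) ≤ C₂) →
      (∀ n, MemLp (fun ω => s2 n ω - σ ^ 2) 2 μ) →
      (fun n : ℕ => (p n : ℝ) * ∫ ω, (s2 n ω - σ ^ 2) ^ 2 ∂μ)
        =o[atTop] (fun n : ℕ => (n : ℝ) * MallowsMA.fullOptRisk (X n) (f n) σ) →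
      -- the estimated candidate set is plugged into the two risk functions of a fixed one
      MallowsMA.AsympLe
        (fun n => ∫ ω', (∫ ω, MallowsMA.maLoss (X n) (f n)
            (MallowsMA.msCandidates (p n) (κl n) (κu n) (mhat n ω'))
            (what n (MallowsMA.msCandidates (p n) (κl n) (κu n) (mhat n ω')) ω)
            (y n ω) ∂μ) ∂μ)
        (fun n => MallowsMA.fullOptRisk (X n) (f n) σ) ∧
      MallowsMA.AsympLe
        (fun n => ∫ ω', (∫ ω, MallowsMA.maRisk (X n) (f n) σ
            (MallowsMA.msCandidates (p n) (κl n) (κu n) (mhat n ω'))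
            (what n (MallowsMA.msCandidates (p n) (κl n) (κu n) (mhat n ω')) ω) ∂μ) ∂μ)
        (fun n => MallowsMA.fullOptRisk (X n) (f n) σ) ∧
      -- the estimated candidate set and the weights are computed from the same sample
      MallowsMA.AsympLe
        (fun n => ∫ ω, MallowsMA.maLoss (X n) (f n)
            (MallowsMA.msCandidates (p n) (κl n) (κu n) (mhat n ω))
            (what n (MallowsMA.msCandidates (p n) (κl n) (κu n) (mhat n ω)) ω)
            (y n ω) ∂μ)
        (fun n => MallowsMA.fullOptRisk (X n) (f n) σ) ∧
      MallowsMA.AsympLe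
        (fun n => ∫ ω, MallowsMA.maRisk (X n) (f n) σ
            (MallowsMA.msCandidates (p n) (κl n) (κu n) (mhat n ω))
            (what n (MallowsMA.msCandidates (p n) (κl n) (κu n) (mhat n ω)) ω) ∂μ)
        (fun n => MallowsMA.fullOptRisk (X n) (f n) σ)) := by
  -- After this the design enters only through its orthonormal system and the coordinates of `f`.
  have hbasis := fun n => MallowsMA.exists_nestedBasis (X n) (φ n) (hφ n)
  choose ψ hψ hψφ using hbasis
  have hcoords : ∀ n, 1 ≤ n → MallowsMA.HasCoords (p n) (ψ n) (f n) fun j => θ (j + 1) :=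
    fun n hn => (hψ n).hasCoords hn (hX n) (β n) (hf n) _ fun j hj => by
      rw [hψφ n ⟨j, hj⟩]
      exact hθ n ⟨j, hj⟩
  have hyf : ∀ n ω, y n ω = f n + fun i => ε n i ω := fun n ω => funext fun i => hy n ω i
  simp only [hyf] at hwhat ⊢
  refine ⟨fun hslow hlast => ?_, ?_⟩
  · refine MallowsMA.slow_decay_lower_bound μ p hp_pos X f σ hσ θ hθ_ord ψ hψ hcoords mstar
      hmstar κl κu hκl hκu C (fun n => (le_max_left _ _).trans (hκ_bdd n)) _
      (fun n => hwhat_meas n _) (fun n hn ω => ?_) hslow hlast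
    obtain ⟨hl1, hlm, hmu, hup⟩ := MallowsMA.candidates_bounds (hκl n) (hκu n) (hmstar n hn).1
    exact (hwhat n _ ⟨mstar n, Finset.mem_Icc.2 ⟨hlm, hmu⟩⟩
      (Finset.Icc_subset_Icc hl1 hup) ω).1
  · rintro hfast mhat hmhat_meas hmhat hmstar_top hratio ⟨C₂, hC₂, hwin⟩ hs2 hs2o
    exact MallowsMA.fast_decay_upper_bound μ p X f σ hσ η ε
      (fun n => ⟨hε_meas n, hε_indep n, hε_mean n, hε_var n, hε_subG n⟩) θ hθ_ord ψ hψ hcoords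
      mstar hmstar κl κu hκl hκu s2 what hwhat hfast mhat hmhat_meas hmhat hmstar_top hratio hC₂
      hwin hs2 hs2o
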